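/- Work in the piecewise linear category. Let $M$ be a closed, connected, oriented $3$-manifold. A compact polyhedron $P$ is *simple* if each of its points has a regular neighbourhood which is, with the point at the centre, a disk, the cone over the theta graph (three half-disks glued along their diameters), or the cone over the $1$-skeleton of a tetrahedron; points of the last kind are the *true vertices* (their set is $V(P)$), and the points of the last two kinds form the *singular set* $S(P)$. The components $R_1,\dots,R_n$ of $P\setminus S(P)$ are the *regions*, the components $e_1,\dots,e_m$ of $S(P)\setminus V(P)$ the *edges*; $P$ is *special* if all regions are open disks and all edges are open arcs. A *branching* of $P$ is an orientation of each region such that along each edge the three orientations induced by the adjacent regions do not all agree. $P\subset M$ is a *spine* of $M$ if $M$ with an open ball removed collapses onto $P$. Let $P$ be a special spine of $M$ with a branching, and orient the edges of $P$ arbitrarily. For a region $R_i$ and an edge $e_j$ let $a_{ij}\in\mathbb{Z}$ be the sum of $\varepsilon$ over all lifts of $e_j$ to the boundary of the completion $\bar R_i$ of $R_i$ in its path metric, where $\varepsilon=1$ if the orientation of the lift as part of $\partial \bar R_i$ agrees with that of $e_j$, and $\varepsilon=-1$ otherwise. $P$ is *admissible* if there are real numbers $x_1,\dots,x_m$ such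 that $\sum_{j=1}^m a_{ij}x_j>0$ for every $i=1,\dots,n$. $M$ is a *rational homology $3$-sphere* if $H_k(M;\mathbb{Q})\cong H_k(S^3;\mathbb{Q})$ for all $k$. Then: 1. For every maximal tree $T$ of the graph $S(P)$, the number of edges of $P$ that are not contained in $T$ equals the number $n$ of regions, and the square matrix $A=(a_{ij})$, with $i$ running over the regions and $j$ over the edges not contained in $T$, satisfies $\det(A)\neq 0$ if and only if $M$ is a rational homology $3$-sphere. 2. If $M$ is a rational homology $3$-sphere, then $P$ is admissible. -/

import Mathlib

/-!
Everything lives in the piecewise linear category. A compact polyhedron is given by a triangulation,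
that is a finite abstract simplicial complex with vertices in `ℕ`; a point of the polyhedron lies in
the interior of exactly one simplex, so that sets of open simplices stand for the subsets which
they cover.
-/

noncomputable section

open scoped Classical in
/-- `Y` is obtained from `X` by the stellar subdivision at the simplex `A`, the new vertex being
`a`: the open star of `A` is replaced by the cone with apex `a` over its frontier. (If `A` is a
vertex, this renames it.) -/
def StellarStep (X Y : PreAbstractSimplicialComplex ℕ) : Prop :=
  ∃ A ∈ X, ∃ a : ℕ, {a} ∉ X ∧ ∀ σ : Finset ℕ, σ ∈ Y ↔
    (σ ∈ X ∧ ¬ A ⊆ σ) ∨ ∃ ρ : Finset ℕ, σ = insert a ρ ∧ ¬ A ⊆ ρ ∧ ρ ∪ A ∈ X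

open scoped Classical in
/-- The polyhedra triangulated by `X` and `Y` are PL homeomorphic: after its vertices are numbered,
`X` is related to `Y` by stellar subdivisions and their inverses. -/
def PLHomeomorphic {α : Type} (X : PreAbstractSimplicialComplex α)
    (Y : PreAbstractSimplicialComplex ℕ) : Prop :=
  ∃ f : α → ℕ, Set.InjOn f {v | {v} ∈ X} ∧ Relation.EqvGen StellarStep (X.map f) Y

/-- The `n`-simplex with all its faces, a PL `n`-ball. -/
def stdSimplexComplex (n : ℕ) : PreAbstractSimplicialComplex ℕ where
  faces := {σ | σ.Nonempty ∧ σ ⊆ Finset.range (n + 1)}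
  isRelLowerSet_faces := fun _ h => ⟨h.1, fun _ hb hn => ⟨hn, hb.trans h.2⟩⟩

/-- The boundary of the `(n + 1)`-simplex, a PL `n`-sphere. -/
def stdSphereComplex (n : ℕ) : PreAbstractSimplicialComplex ℕ where
  faces := {σ | σ.Nonempty ∧ σ ⊂ Finset.range (n + 2)}
  isRelLowerSet_faces := fun _ h =>
    ⟨h.1, fun _ hb hn => ⟨hn, lt_of_le_of_lt hb h.2⟩⟩

/-- The theta graph: the vertices `0` and `1` are joined by three arcs, through `2`, `3`, `4`. -/
def thetaComplex : PreAbstractSimplicialComplex ℕ where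
  faces := {σ | σ.Nonempty ∧ ∃ i j : ℕ, i < 2 ∧ 2 ≤ j ∧ j < 5 ∧ σ ⊆ {i, j}}
  isRelLowerSet_faces := fun _ h => ⟨h.1, fun _ hb hn =>
    ⟨hn, h.2.imp fun _ h => h.imp fun _ h => ⟨h.1, h.2.1, h.2.2.1, hb.trans h.2.2.2⟩⟩⟩

/-- The complete graph on four vertices, the 1-skeleton of the tetrahedron. -/
def completeFourComplex : PreAbstractSimplicialComplex ℕ where
  faces := {σ | σ.Nonempty ∧ σ ⊆ Finset.range 4 ∧ σ.card ≤ 2}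
  isRelLowerSet_faces := fun _ h =>
    ⟨h.1, fun _ hb hn => ⟨hn, hb.trans h.2.1, (Finset.card_le_card hb).trans h.2.2⟩⟩

/-- The link of the vertex `v`. -/
def vertexLink (K : PreAbstractSimplicialComplex ℕ) (v : ℕ) : PreAbstractSimplicialComplex ℕ where
  faces := {σ | σ.Nonempty ∧ v ∉ σ ∧ insert v σ ∈ K}
  isRelLowerSet_faces := fun _ h => ⟨h.1, fun _ hb hn => ⟨hn, fun hv => h.2.1 (hb hv),
    (K.isRelLowerSet_faces h.2.2).2 (Finset.insert_subset_insert v hb)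
      (Finset.insert_nonempty _ _)⟩⟩

/-- The connected components of the union of the open simplices that belong to `U`: the classes of
the equivalence relation generated by the face relation on `U`. -/
def Pieces {α : Type} (U : Set (Finset α)) : Type :=
  Quot fun a b : U => (a : Finset α) ⊆ (b : Finset α)

/-- The open simplices that make up the component `c`. -/
def Pieces.simplices {α : Type} {U : Set (Finset α)} (c : Pieces U) : Set (Finset α) :=
  {σ | ∃ h : σ ∈ U, Quot.mk _ ⟨σ, h⟩ = c}

/-- The incidence number `[τ : σ]` for simplices oriented by the increasing order of their
vertices: `(-1) ^ i` if `σ` is obtained from `τ` by omitting the vertex in position `i`, counted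
from `0`, and `0` if `σ` is not a face of codimension one. -/
def incidence (τ σ : Finset ℕ) : ℤ :=
  ∑ v ∈ τ, if τ.erase v = σ then (-1) ^ (τ.filter (· < v)).card else 0

/-! ### Rational simplicial homology -/

/-- The boundary map of simplicial chains. Vertices have boundary `0`. -/
def chainBoundary : (Finset ℕ →₀ ℚ) →ₗ[ℚ] (Finset ℕ →₀ ℚ) :=
  Finsupp.lsum ℚ fun τ => LinearMap.toSpanSingleton ℚ (Finset ℕ →₀ ℚ)
    (∑ v ∈ τ with (τ.erase v).Nonempty,
      Finsupp.single (τ.erase v) ((-1 : ℚ) ^ (τ.filter (· < v)).card))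

/-- The `k`-chains of `K`. -/
def simplicialChains (K : PreAbstractSimplicialComplex ℕ) (k : ℕ) : Submodule ℚ (Finset ℕ →₀ ℚ) :=
  Finsupp.supported ℚ ℚ {σ | σ ∈ K ∧ σ.card = k + 1}

/-- The `k`-cycles of `K`. -/
def simplicialCycles (K : PreAbstractSimplicialComplex ℕ) (k : ℕ) : Submodule ℚ (Finset ℕ →₀ ℚ) :=
  simplicialChains K k ⊓ LinearMap.ker chainBoundary

/-- The `k`-boundaries of `K`. -/
def simplicialBoundaries (K : PreAbstractSimplicialComplex ℕ) (k : ℕ) :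
    Submodule ℚ (Finset ℕ →₀ ℚ) :=
  (simplicialChains K (k + 1)).map chainBoundary

/-- `H_k(K; ℚ)`. -/
abbrev SimplicialHomology (K : PreAbstractSimplicialComplex ℕ) (k : ℕ) : Type :=
  simplicialCycles K k ⧸ (simplicialBoundaries K k).submoduleOf (simplicialCycles K k)

/-- `H_k(K; ℚ) ≅ H_k(S³; ℚ)` for all `k`. -/
def IsRationalHomologyThreeSphere (K : PreAbstractSimplicialComplex ℕ) : Prop :=
  ∀ k, Module.finrank ℚ (SimplicialHomology K k) = if k = 0 ∨ k = 3 then 1 else 0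

/-! ### Manifolds and spines -/

/-- `K` triangulates a closed, connected, orientable (PL) 3-manifold. -/
structure IsClosedOrientableThreeManifold (K : PreAbstractSimplicialComplex ℕ) : Prop where
  finite : K.faces.Finite
  nonempty : K.faces.Nonempty
  connected : Subsingleton (Pieces K.faces)
  link_sphere : ∀ v, {v} ∈ K → PLHomeomorphic (vertexLink K v) (stdSphereComplex 2)
  /-- The tetrahedra can be oriented such that any two of them that share a triangle induce
  opposite orientations on it. -/
  orientable : ∃ o : Finset ℕ → ℤˣ, ∀ s ∈ K, s.card = 3 → ∀ t₁ ∈ K, ∀ t₂ ∈ K,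
    t₁.card = 4 → t₂.card = 4 → s ⊆ t₁ → s ⊆ t₂ → t₁ ≠ t₂ →
      (o t₁ : ℤ) * incidence t₁ s + (o t₂ : ℤ) * incidence t₂ s = 0

/-- An elementary collapse: `τ` is a free face of `σ`, and both are removed. -/
def ElementaryCollapse (X Y : Set (Finset ℕ)) : Prop :=
  ∃ σ ∈ X, ∃ τ ∈ X, τ ⊆ σ ∧ σ.card = τ.card + 1 ∧
    (∀ ρ ∈ X, τ ⊆ ρ → ρ = τ ∨ ρ = σ) ∧ Y = X \ {τ, σ}

/-- `L` is a spine of the closed 3-manifold `K`: `K` with an open ball removed, namely the interior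
of one of its tetrahedra, collapses onto `L`. -/
def IsSpine (K L : PreAbstractSimplicialComplex ℕ) : Prop :=
  ∃ B ∈ K, B.card = 4 ∧ Relation.ReflTransGen ElementaryCollapse (K.faces \ {B}) L.faces

/-! ### Simple and special polyhedra -/

/-- A vertex in whose neighbourhood the polyhedron is a surface. -/
def IsSurfaceVertex (L : PreAbstractSimplicialComplex ℕ) (v : ℕ) : Prop :=
  {v} ∈ L ∧ PLHomeomorphic (vertexLink L v) (stdSphereComplex 1)

/-- A vertex in whose neighbourhood the polyhedron consists of three half-planes with a common
boundary line on which the vertex lies. -/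
def IsTripleVertex (L : PreAbstractSimplicialComplex ℕ) (v : ℕ) : Prop :=
  {v} ∈ L ∧ PLHomeomorphic (vertexLink L v) thetaComplex

/-- A true vertex: the polyhedron is there the cone over the 1-skeleton of a tetrahedron. -/
def IsTrueVertex (L : PreAbstractSimplicialComplex ℕ) (v : ℕ) : Prop :=
  {v} ∈ L ∧ PLHomeomorphic (vertexLink L v) completeFourComplex

/-- A simple polyhedron. The condition at the vertices of the triangulation implies that the other
points have neighbourhoods of the first two kinds as well. -/
def IsSimplePolyhedron (L : PreAbstractSimplicialComplex ℕ) : Prop :=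
  L.faces.Finite ∧ ∀ v, {v} ∈ L → IsSurfaceVertex L v ∨ IsTripleVertex L v ∨ IsTrueVertex L v

/-- The triangles that contain the simplex `s`. -/
def trianglesAt (L : PreAbstractSimplicialComplex ℕ) (s : Finset ℕ) : Set (Finset ℕ) :=
  {t | t ∈ L ∧ t.card = 3 ∧ s ⊆ t}

/-- The simplices whose interiors make up the singular set `S(P)`. -/
def singularSet (L : PreAbstractSimplicialComplex ℕ) : Set (Finset ℕ) :=
  {σ | σ ∈ L ∧ ((∃ v, σ = {v} ∧ (IsTripleVertex L v ∨ IsTrueVertex L v)) ∨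
    (σ.card = 2 ∧ (trianglesAt L σ).ncard = 3))}

/-- The regions: the components of `P \ S(P)`. -/
abbrev Region (L : PreAbstractSimplicialComplex ℕ) : Type :=
  Pieces {σ | σ ∈ L ∧ σ ∉ singularSet L}

/-- The edges: the components of `S(P) \ V(P)`, where `V(P)` is the set of true vertices. -/
abbrev Edge (L : PreAbstractSimplicialComplex ℕ) : Type :=
  Pieces {σ | σ ∈ singularSet L ∧ ¬ ∃ v, σ = {v} ∧ IsTrueVertex L v}

/-- The points over the vertex `v` of the completion of `U`: the components of the part of `U` that
lies in the open star of `v`. -/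
abbrev LocalPieces (U : Set (Finset ℕ)) (v : ℕ) : Type := Pieces {σ | σ ∈ U ∧ v ∈ σ}

open scoped Classical in
/-- The simplex of the completion of `U` whose interior is the open simplex `σ`. -/
def completionSimplex (U : Set (Finset ℕ)) (σ : U) : Finset (Σ v : ℕ, LocalPieces U v) :=
  (σ : Finset ℕ).attach.image fun v => ⟨v.1, Quot.mk _ ⟨σ.1, σ.2, v.2⟩⟩

/-- The completion, with respect to a path metric, of the union of the open simplices in `U`, where
`U` is a region or an edge. -/
def completion (U : Set (Finset ℕ)) :
    PreAbstractSimplicialComplex (Σ v : ℕ, LocalPieces U v) where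
  faces := {ρ | ρ.Nonempty ∧ ∃ σ : U, ρ ⊆ completionSimplex U σ}
  isRelLowerSet_faces := fun _ h =>
    ⟨h.1, fun _ hb hn => ⟨hn, h.2.imp fun _ hσ => Finset.Subset.trans hb hσ⟩⟩

/-- A special polyhedron: every region is an open disk and every edge an open arc. A region is the
interior of its completion, a compact surface, and so it is an open disk exactly if the completion
is a disk; similarly for the edges. -/
structure IsSpecialPolyhedron (L : PreAbstractSimplicialComplex ℕ) : Prop where
  simple : IsSimplePolyhedron L
  region_disk : ∀ R : Region L, PLHomeomorphic (completion R.simplices) (stdSimplexComplex 2)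
  edge_arc : ∀ e : Edge L, PLHomeomorphic (completion e.simplices) (stdSimplexComplex 1)

/-! ### Branchings and admissibility -/

/-- `o` is a branching of the simple polyhedron `L`. The orientation `o t` of a triangle `t` is
relative to the increasing order of its vertices, so that `o t * incidence t s` is the orientation
which it induces on its side `s`. -/
structure IsBranching (L : PreAbstractSimplicialComplex ℕ) (o : Finset ℕ → ℤˣ) : Prop where
  /-- `o` is an orientation of each region: triangles on the two sides of a segment inside a region
  induce opposite orientations on it. -/
  orientation : ∀ s ∈ L, s.card = 2 → s ∉ singularSet L →
    ∀ t₁ ∈ trianglesAt L s, ∀ t₂ ∈ trianglesAt L s, t₁ ≠ t₂ →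
      (o t₁ : ℤ) * incidence t₁ s + (o t₂ : ℤ) * incidence t₂ s = 0
  /-- The three orientations induced on an edge do not agree. -/
  not_agree : ∀ s ∈ singularSet L, s.card = 2 →
    ¬ ∀ t₁ ∈ trianglesAt L s, ∀ t₂ ∈ trianglesAt L s,
      (o t₁ : ℤ) * incidence t₁ s = (o t₂ : ℤ) * incidence t₂ s

/-- `w` is an orientation of every edge of `P`: it orients the segments in `S(P)` consistently at
the points which are not true vertices. -/
def IsEdgeOrientation (L : PreAbstractSimplicialComplex ℕ) (w : Finset ℕ → ℤˣ) : Prop :=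
  ∀ v, IsTripleVertex L v → ∀ s₁ ∈ singularSet L, ∀ s₂ ∈ singularSet L,
    s₁.card = 2 → s₂.card = 2 → v ∈ s₁ → v ∈ s₂ → s₁ ≠ s₂ →
      (w s₁ : ℤ) * incidence s₁ {v} + (w s₂ : ℤ) * incidence s₂ {v} = 0

/-- Some segment on the edge `e`. -/
def Edge.segment {L : PreAbstractSimplicialComplex ℕ} (e : Edge L) : Finset ℕ :=
  Classical.epsilon fun s => s ∈ e.simplices ∧ s.card = 2

/-- The number of times, counted with signs, that the boundary of the completion of the region `R`
runs along the edge `e`. The lifts of `e` to that boundary correspond to the triangles of `R` that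
contain a given segment of `e`; the sign of a lift tells whether the orientation that it gets
from `R` is the one of `e`. -/
def boundaryCoeff (L : PreAbstractSimplicialComplex ℕ) (o w : Finset ℕ → ℤˣ)
    (R : Region L) (e : Edge L) : ℤ :=
  ∑ᶠ t ∈ trianglesAt L e.segment ∩ R.simplices,
    (o t : ℤ) * incidence t e.segment * (w e.segment : ℤ)

/-- The admissibility of `L` with the branching `o`; the edges are oriented by `w`. -/
def IsAdmissible (L : PreAbstractSimplicialComplex ℕ) (o w : Finset ℕ → ℤˣ) : Prop :=
  ∃ x : Edge L → ℝ, ∀ R : Region L, 0 < ∑ᶠ e : Edge L, (boundaryCoeff L o w R e : ℝ) * x e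

/-- The graph formed by all true vertices and the edges in `T`, subdivided as in the
triangulation. -/
def edgeSubgraph (L : PreAbstractSimplicialComplex ℕ) (T : Set (Edge L)) :
    SimpleGraph {v : ℕ // IsTrueVertex L v ∨ ∃ e ∈ T, {v} ∈ e.simplices} where
  Adj u v := u ≠ v ∧ ∃ e ∈ T, {u.1, v.1} ∈ e.simplices
  symm := ⟨fun _ _ h => ⟨h.1.symm, h.2.imp fun _ he => ⟨he.1, by rw [Finset.pair_comm]; exact he.2⟩⟩⟩
  loopless := ⟨fun _ h => h.1 rfl⟩

/-- `T` is the set of edges of a maximal tree of the graph `S(P)`. -/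
def IsMaximalTree (L : PreAbstractSimplicialComplex ℕ) (T : Set (Edge L)) : Prop :=
  (edgeSubgraph L T).IsTree

end

/-! ### Vertex maps, stellar subdivision and the Euler characteristic -/

noncomputable section

namespace PreAbstractSimplicialComplex

variable {α : Type*} {K : PreAbstractSimplicialComplex α} {s t : Finset α}

/-! A special polyhedron `P` has a cell structure given by its true vertices, edges and regions, and
the integers `a_ij` are the coefficients of the cellular boundary from regions to edges. Since the
punctured manifold collapses onto `P`, and `P` has no 3-cells, `H_2(M; ℚ)` is the kernel of `c ↦ (∑
i, c_i a_ij)_j`. The proof rests on the following equivalence: `M` is a rational homology sphere if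
and only if this map is injective.

Reduction to second homology: connectedness gives `b_0 = 1`, counting simplices in the vertex links
gives `χ(M) = 0`, and the fundamental cycle gives `b_3 ≥ 1`. If `b_2 = 0`, then `b_1 = 1 - b_3`
forces `b_1 = 0` and `b_3 = 1`, so duality is not needed (`isRationalHomologyThreeSphere_iff`).
Neither the removal of a tetrahedron (`secondHomologyVanishes_diff_iff`) nor an elementary collapse
(`ElementaryCollapse.secondHomologyVanishes_iff`) affects the vanishing of `H_2`.

Reduction to cells: a simplicial 2-cycle has, up to orientation, a constant coefficient on each
region (`IsSpecialPolyhedron.exists_eq_regionChain`), and a 1-cycle on the singular set a constant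
one on each edge (`IsSimplePolyhedron.eq_of_mem_edge`). A boundary is a 1-cycle, and a 1-cycle
carried by a tree is zero, so the columns of a maximal tree can be deleted without changing the
kernel (`IsSpecialPolyhedron.secondHomologyVanishes_iff`).

The remaining matrix is square: `χ(P) = χ(M) + 1 = 1`, open regions and open edges have Euler
characteristic `1` and `-1`, and a maximal tree has one edge fewer than there are true vertices
(`IsMaximalTree.card_region`). Injectivity then means a nonzero determinant. With all the edges
kept, injectivity provides a left inverse, and hence a solution of `∑ j, a_ij x_j = 1` for every
`i`, which shows admissibility.

The hypotheses on links, disks and arcs are PL homeomorphisms, that is, chains of stellar moves.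
Only three invariants of such moves are used: the Euler characteristic, being a closed
pseudomanifold, and, for graphs, the pattern of arcs between vertices of degree three
(`IsArcGraph`). -/

theorem nonempty_of_mem (h : s ∈ K) : s.Nonempty := (K.isRelLowerSet_faces h).1

theorem mem_of_subset (h : s ∈ K) (hts : t ⊆ s) (ht : t.Nonempty) : t ∈ K :=
  (K.isRelLowerSet_faces h).2 hts ht

theorem singleton_mem_of_mem (h : s ∈ K) {v : α} (hv : v ∈ s) : {v} ∈ K :=
  mem_of_subset h (Finset.singleton_subset_iff.2 hv) (Finset.singleton_nonempty v)

theorem mem_map_iff {β : Type*} [DecidableEq β] {f : α → β} {τ : Finset β} :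
    τ ∈ K.map f ↔ ∃ s ∈ K, s.image f = τ := Iff.rfl

theorem image_mem_map {β : Type*} [DecidableEq β] (f : α → β) (h : s ∈ K) :
    s.image f ∈ K.map f := ⟨s, h, rfl⟩

theorem subset_of_image_subset {β : Type*} [DecidableEq β] {f : α → β}
    (hf : Set.InjOn f {v | {v} ∈ K}) (hs : s ∈ K) (ht : t ∈ K) (h : s.image f ⊆ t.image f) :
    s ⊆ t := by
  intro v hv
  obtain ⟨w, hw, hwv⟩ := Finset.mem_image.1 (h (Finset.mem_image_of_mem f hv))
  rwa [← hf (singleton_mem_of_mem ht hw) (singleton_mem_of_mem hs hv) hwv]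

theorem image_injOn {β : Type*} [DecidableEq β] {f : α → β}
    (hf : Set.InjOn f {v | {v} ∈ K}) : Set.InjOn (fun s => s.image f) K.faces :=
  fun _ hs _ ht h => (subset_of_image_subset hf hs ht h.subset).antisymm
    (subset_of_image_subset hf ht hs h.superset)

theorem card_image_of_mem {β : Type*} [DecidableEq β] {f : α → β}
    (hf : Set.InjOn f {v | {v} ∈ K}) (hs : s ∈ K) : (s.image f).card = s.card :=
  Finset.card_image_of_injOn fun _ hx _ hy h =>
    hf (singleton_mem_of_mem hs hx) (singleton_mem_of_mem hs hy) h

theorem image_mem_map_iff [DecidableEq α] {β : Type*} [DecidableEq β] {f : α → β}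
    (hf : Set.InjOn f {v | {v} ∈ K}) (hs : ∀ v ∈ s, {v} ∈ K) :
    s.image f ∈ K.map f ↔ s ∈ K := by
  refine ⟨?_, image_mem_map f⟩
  rintro ⟨t, ht, h⟩
  suffices hst : s = t from hst ▸ ht
  ext v
  have h' := fun w => congrArg (w ∈ ·) h
  simp only [Finset.mem_image, eq_iff_iff] at h'
  constructor
  · intro hv
    obtain ⟨w, hw, hwv⟩ := (h' (f v)).2 ⟨v, hv, rfl⟩
    rwa [← hf (singleton_mem_of_mem ht hw) (hs v hv) hwv]
  · intro hv
    obtain ⟨w, hw, hwv⟩ := (h' (f v)).1 ⟨v, hv, rfl⟩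
    rwa [← hf (hs w hw) (singleton_mem_of_mem ht hv) hwv]

end PreAbstractSimplicialComplex

open PreAbstractSimplicialComplex

/-- A property that is not affected by a stellar subdivision is not affected by any number of them
and of their inverses. -/
theorem iff_of_eqvGen_stellarStep {P : PreAbstractSimplicialComplex ℕ → Prop}
    (hP : ∀ X Y, StellarStep X Y → (P X ↔ P Y)) {X Y : PreAbstractSimplicialComplex ℕ}
    (h : Relation.EqvGen StellarStep X Y) : P X ↔ P Y := by
  induction h with
  | rel X Y h => exact hP X Y h
  | refl X => rfl
  | symm X Y _ ih => exact ih.symm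
  | trans X Y Z _ _ ih₁ ih₂ => exact ih₁.trans ih₂

/-- The Euler characteristic (with compact supports) of a union of open simplices. -/
def eulerChar {α : Type*} (S : Set (Finset α)) : ℤ := ∑ᶠ σ ∈ S, (-1) ^ (σ.card + 1)

theorem eulerChar_image {α β : Type*} {S : Set (Finset α)} {g : Finset α → Finset β}
    (hg : Set.InjOn g S) (hc : ∀ s ∈ S, (g s).card = s.card) :
    eulerChar (g '' S) = eulerChar S := by
  unfold eulerChar
  rw [finsum_mem_image hg]
  exact finsum_mem_congr rfl fun s hs => by rw [hc s hs]

theorem eulerChar_union {α : Type*} {S T : Set (Finset α)} (h : Disjoint S T) (hS : S.Finite)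
    (hT : T.Finite) : eulerChar (S ∪ T) = eulerChar S + eulerChar T :=
  finsum_mem_union h hS hT

/-- The simplices of constant cardinality `k` contribute with the same sign. -/
theorem eulerChar_of_card {α : Type*} {S : Set (Finset α)} (hS : S.Finite) {k : ℕ}
    (h : ∀ σ ∈ S, σ.card = k) : eulerChar S = (-1) ^ (k + 1) * (S.ncard : ℤ) := by
  unfold eulerChar
  rw [finsum_mem_congr rfl fun σ hσ => by rw [h σ hσ], finsum_mem_eq_finite_toFinset_sum _ hS,
    Finset.sum_const, Set.ncard_eq_toFinset_card _ hS]
  simp [mul_comm]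

/-- If `ρ ↦ ρ ∪ A` is considered, toggling a vertex of `A` cancels the alternating sum. -/
theorem finsum_union_mem_eq_zero {S : Set (Finset ℕ)} (hS : S.Finite) {A : Finset ℕ}
    (hA : A.Nonempty) : ∑ᶠ ρ ∈ {ρ : Finset ℕ | ρ ∪ A ∈ S}, (-1 : ℤ) ^ ρ.card = 0 := by
  classical
  obtain ⟨x, hx⟩ := hA
  have hfin : {ρ : Finset ℕ | ρ ∪ A ∈ S}.Finite := by
    refine Set.Finite.subset (hS.toFinset.biUnion id).powerset.finite_toSet fun ρ hρ => ?_
    simp only [Finset.coe_powerset, Set.mem_preimage, Set.mem_powerset_iff, Finset.coe_subset]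
    exact Finset.subset_union_left.trans
      (Finset.subset_biUnion_of_mem (u := id) (hS.mem_toFinset.2 hρ))
  rw [finsum_mem_eq_finite_toFinset_sum _ hfin]
  refine Finset.sum_involution (fun ρ _ => if x ∈ ρ then ρ.erase x else insert x ρ) ?_ ?_ ?_ ?_
  · intro ρ _
    split_ifs with h
    · have := Finset.card_erase_add_one h
      rw [← this, pow_succ]; ring
    · rw [Finset.card_insert_of_notMem h, pow_succ]; ring
  · intro ρ _ _
    split_ifs with h
    · exact fun h' => Finset.notMem_erase x ρ (h'.symm ▸ h)
    · exact fun h' => h (h' ▸ Finset.mem_insert_self x ρ)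
  · intro ρ hρ
    simp only [Set.Finite.mem_toFinset, Set.mem_ofPred_eq] at hρ ⊢
    convert hρ using 1
    ext y
    split_ifs <;> grind
  · intro ρ _
    ext y
    split_ifs <;> grind

/-- The vertices of either complex are among those of the other and one more. In the backward
direction a simplex `σ ⊇ A` is gone from `Y`, but it reappears there with the vertex `x` of `A`
replaced by `a`, so that only `x` can be missing. -/
theorem StellarStep.finite_iff {X Y : PreAbstractSimplicialComplex ℕ} (h : StellarStep X Y) :
    X.faces.Finite ↔ Y.faces.Finite := by
  obtain ⟨A, hA, a, -, hY⟩ := h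
  obtain ⟨x, hx⟩ := nonempty_of_mem hA
  constructor
  · intro hX
    refine ((insert a (hX.toFinset.biUnion id)).powerset.finite_toSet).subset fun σ hσ => ?_
    simp only [Finset.coe_powerset, Set.mem_preimage, Set.mem_powerset_iff, Finset.coe_subset]
    have key : ∀ τ ∈ X, τ ⊆ hX.toFinset.biUnion id := fun τ hτ =>
      Finset.subset_biUnion_of_mem (u := id) (hX.mem_toFinset.2 hτ)
    rcases (hY σ).1 hσ with h | ⟨ρ, rfl, -, h⟩
    · exact (key σ h.1).trans (Finset.subset_insert _ _)
    · exact Finset.insert_subset_insert _ (Finset.subset_union_left.trans (key _ h))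
  · intro hYf
    refine ((insert x (hYf.toFinset.biUnion id)).powerset.finite_toSet).subset fun σ hσ => ?_
    simp only [Finset.coe_powerset, Set.mem_preimage, Set.mem_powerset_iff, Finset.coe_subset]
    have key : ∀ τ ∈ Y, τ ⊆ hYf.toFinset.biUnion id := fun τ hτ =>
      Finset.subset_biUnion_of_mem (u := id) (hYf.mem_toFinset.2 hτ)
    by_cases hAσ : A ⊆ σ
    · have : insert a (σ.erase x) ∈ Y := (hY _).2 (Or.inr ⟨_, rfl,
        fun h => Finset.notMem_erase x σ (h hx), by
          have : σ.erase x ∪ A = σ := by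
            ext y; have := @hAσ y; grind
          rw [this]; exact hσ⟩)
      have := (Finset.subset_insert _ _).trans (key _ this)
      intro y hy
      by_cases hyx : y = x
      · simp [hyx]
      · exact Finset.mem_insert_of_mem (this (Finset.mem_erase.2 ⟨hyx, hy⟩))
    · exact (key σ ((hY σ).2 (Or.inl ⟨hσ, hAσ⟩))).trans (Finset.subset_insert _ _)

/-- The simplices `X₁` are exchanged for the cones `insert a ρ` with `ρ ∈ R`, and `R ∪ X₁` is
exactly the set of all `ρ` with `ρ ∪ A ∈ X`, over which the alternating sum vanishes. Coning changes
the sign, so the two contributions are equal. The empty set lies in `R` and accounts for the new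
vertex. -/
theorem StellarStep.eulerChar_eq {X Y : PreAbstractSimplicialComplex ℕ} (h : StellarStep X Y)
    (hX : X.faces.Finite) : eulerChar X.faces = eulerChar Y.faces := by
  have hYf := h.finite_iff.1 hX
  obtain ⟨A, hA, a, ha, hY⟩ := h
  set X₀ : Set (Finset ℕ) := {σ | σ ∈ X ∧ ¬ A ⊆ σ}
  set X₁ : Set (Finset ℕ) := {σ | σ ∈ X ∧ A ⊆ σ}
  set R : Set (Finset ℕ) := {ρ | ¬ A ⊆ ρ ∧ ρ ∪ A ∈ X}
  have haR : ∀ ρ ∈ R, a ∉ ρ := fun ρ hρ h =>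
    ha (singleton_mem_of_mem hρ.2 (Finset.mem_union_left _ h))
  have hinj : Set.InjOn (fun ρ => insert a ρ) R := fun ρ hρ ρ' hρ' h => by
    have := congrArg (fun s => s.erase a) h
    simpa [Finset.erase_insert (haR _ hρ), Finset.erase_insert (haR _ hρ')] using this
  have hXe : X.faces = X₀ ∪ X₁ := by
    ext σ
    change σ ∈ X ↔ (σ ∈ X ∧ _) ∨ (σ ∈ X ∧ _)
    tauto
  have hYe : Y.faces = X₀ ∪ (fun ρ => insert a ρ) '' R := by
    ext σ
    change σ ∈ Y ↔ _
    rw [hY σ]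
    simp only [X₀, R, Set.mem_union, Set.mem_ofPred_eq, Set.mem_image]
    grind
  have hWe : {ρ : Finset ℕ | ρ ∪ A ∈ X.faces} = R ∪ X₁ := by
    ext ρ
    simp only [R, X₁, Set.mem_union, Set.mem_ofPred_eq]
    change ρ ∪ A ∈ X ↔ _
    by_cases h : A ⊆ ρ
    · simp [h, Finset.union_eq_left.2 h]
    · simp [h]
  have hf₀ : X₀.Finite := hX.subset fun σ h => h.1
  have hf₁ : X₁.Finite := hX.subset fun σ h => h.1
  have hfi : ((fun ρ => insert a ρ) '' R).Finite := hYf.subset (hYe ▸ Set.subset_union_right)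
  have hfR : R.Finite := Set.Finite.of_finite_image hfi hinj
  have h0 := finsum_union_mem_eq_zero hX (nonempty_of_mem hA)
  rw [hWe, finsum_mem_union (Set.disjoint_left.2 fun σ h h' => h.1 h'.2) hfR hf₁] at h0
  have d₁ : Disjoint X₀ X₁ := Set.disjoint_left.2 fun σ h h' => h.2 h'.2
  have d₂ : Disjoint X₀ ((fun ρ => insert a ρ) '' R) := by
    refine Set.disjoint_left.2 ?_
    rintro _ h ⟨ρ, -, rfl⟩
    exact ha (singleton_mem_of_mem h.1 (Finset.mem_insert_self a ρ))
  rw [hXe, hYe, eulerChar_union d₁ hf₀ hf₁, eulerChar_union d₂ hf₀ hfi]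
  congr 1
  have e₁ : eulerChar X₁ = - ∑ᶠ ρ ∈ X₁, (-1 : ℤ) ^ ρ.card := by
    rw [← finsum_mem_neg_distrib _ hf₁]
    exact finsum_mem_congr rfl fun σ _ => by rw [pow_succ]; ring
  have e₂ : eulerChar ((fun ρ => insert a ρ) '' R) = ∑ᶠ ρ ∈ R, (-1 : ℤ) ^ ρ.card := by
    unfold eulerChar
    rw [finsum_mem_image hinj]
    exact finsum_mem_congr rfl fun ρ hρ => by
      rw [Finset.card_insert_of_notMem (haR ρ hρ)]; ring
  rw [e₁, e₂]; linarith

theorem eulerChar_map {α : Type*} {X : PreAbstractSimplicialComplex α} {f : α → ℕ}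
    (hf : Set.InjOn f {v | {v} ∈ X}) : eulerChar (X.map f).faces = eulerChar X.faces :=
  eulerChar_image (image_injOn hf) fun _ hs => card_image_of_mem hf hs

/-- Finiteness has to travel along with the Euler characteristic, which is invariant under a stellar
step for finite complexes only. -/
theorem PLHomeomorphic.finite_and_eulerChar {α : Type} {X : PreAbstractSimplicialComplex α}
    {Y : PreAbstractSimplicialComplex ℕ} (h : PLHomeomorphic X Y) (hY : Y.faces.Finite) :
    X.faces.Finite ∧ eulerChar X.faces = eulerChar Y.faces := by
  obtain ⟨f, hf, h⟩ := h
  have key := (iff_of_eqvGen_stellarStep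
    (P := fun Z => Z.faces.Finite ∧ eulerChar Z.faces = eulerChar Y.faces) (fun Z W hs =>
      ⟨fun hZ => ⟨hs.finite_iff.1 hZ.1, hs.eulerChar_eq hZ.1 ▸ hZ.2⟩,
       fun hW => ⟨hs.finite_iff.2 hW.1, (hs.eulerChar_eq (hs.finite_iff.2 hW.1)) ▸ hW.2⟩⟩) h).2
    ⟨hY, rfl⟩
  exact ⟨Set.Finite.of_finite_image key.1 (image_injOn hf), eulerChar_map hf ▸ key.2⟩

end

/-! ### Closed pseudomanifolds are preserved by stellar subdivision -/

noncomputable section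

open PreAbstractSimplicialComplex

/-- `Y` is the stellar subdivision of `X` at `A` with the new vertex `a`. -/
structure StellarAt (X Y : PreAbstractSimplicialComplex ℕ) (A : Finset ℕ) (a : ℕ) : Prop where
  mem : A ∈ X
  notMem : {a} ∉ X
  mem_iff : ∀ σ : Finset ℕ, σ ∈ Y ↔
    (σ ∈ X ∧ ¬ A ⊆ σ) ∨ ∃ ρ : Finset ℕ, σ = insert a ρ ∧ ¬ A ⊆ ρ ∧ ρ ∪ A ∈ X

theorem StellarStep.exists_stellarAt {X Y : PreAbstractSimplicialComplex ℕ}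
    (h : StellarStep X Y) : ∃ A a, StellarAt X Y A a := by
  obtain ⟨A, hA, a, ha, hY⟩ := h
  exact ⟨A, a, hA, ha, hY⟩

namespace StellarAt

variable {X Y : PreAbstractSimplicialComplex ℕ} {A s ρ : Finset ℕ} {a : ℕ}

theorem notMem_of_mem (h : StellarAt X Y A a) (hs : s ∈ X) : a ∉ s :=
  fun ha => h.notMem (singleton_mem_of_mem hs ha)

theorem mem_iff_of_notMem (h : StellarAt X Y A a) (hs : a ∉ s) : s ∈ Y ↔ s ∈ X ∧ ¬ A ⊆ s := by
  rw [h.mem_iff]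
  refine ⟨?_, Or.inl⟩
  rintro (h | ⟨ρ, rfl, -⟩)
  · exact h
  · exact absurd (Finset.mem_insert_self a ρ) hs

theorem insert_mem_iff (h : StellarAt X Y A a) (hs : a ∉ s) :
    insert a s ∈ Y ↔ ¬ A ⊆ s ∧ s ∪ A ∈ X := by
  rw [h.mem_iff]
  constructor
  · rintro (h' | ⟨ρ, h₁, h₂⟩)
    · exact absurd (Finset.mem_insert_self a s) (h.notMem_of_mem h'.1)
    · have hρ : a ∉ ρ := fun ha => h.notMem_of_mem h₂.2 (Finset.mem_union_left _ ha)
      have := congrArg (fun t => t.erase a) h₁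
      simp only [Finset.erase_insert hs, Finset.erase_insert hρ] at this
      rwa [this]
  · exact fun h' => Or.inr ⟨s, rfl, h'⟩

/-- A new simplex `insert a ρ` misses a vertex `y` of `A`, and exchanging `a` for `y` gives a face
of `ρ ∪ A`. Conversely, in a simplex that contains `A` a vertex of `A` can be exchanged for `a`. -/
theorem card_le_iff (h : StellarAt X Y A a) (n : ℕ) :
    (∀ σ ∈ X, σ.card ≤ n) ↔ ∀ σ ∈ Y, σ.card ≤ n := by
  obtain ⟨x, hx⟩ := nonempty_of_mem h.mem
  constructor
  · intro hX σ hσ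
    rcases (h.mem_iff σ).1 hσ with h' | ⟨ρ, rfl, h₁, h₂⟩
    · exact hX _ h'.1
    · obtain ⟨y, hy, hyρ⟩ := Finset.not_subset.1 h₁
      calc (insert a ρ).card ≤ ρ.card + 1 := Finset.card_insert_le _ _
        _ = (insert y ρ).card := (Finset.card_insert_of_notMem hyρ).symm
        _ ≤ (ρ ∪ A).card := Finset.card_le_card (by grind)
        _ ≤ n := hX _ h₂
  · intro hY σ hσ
    by_cases hA : A ⊆ σ
    · have ha := h.notMem_of_mem hσ
      have he : σ.erase x ∪ A = σ := by ext y; have := @hA y; grind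
      have := hY _ ((h.insert_mem_iff (s := σ.erase x) (by grind)).2
        ⟨fun h => Finset.notMem_erase x σ (h hx), he.symm ▸ hσ⟩)
      rwa [Finset.card_insert_of_notMem (by grind), Finset.card_erase_add_one (hA hx)] at this
    · exact hY σ ((h.mem_iff σ).2 (Or.inl ⟨hσ, hA⟩))

end StellarAt

/-- The vertices that span, together with `s`, a simplex of one dimension more. -/
def cofaceVertices (X : PreAbstractSimplicialComplex ℕ) (s : Finset ℕ) : Set ℕ :=
  {x | x ∉ s ∧ insert x s ∈ X}

namespace StellarAt

variable {X Y : PreAbstractSimplicialComplex ℕ} {A s ρ : Finset ℕ} {a d : ℕ}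

/-- If `s ∪ A` is a simplex, the bound on the dimension forces `s ∪ A = insert y s`, and the coface
at `y` is replaced by the one at `a`. Otherwise `s` is not on the frontier of the subdivided star
and no coface changes. -/
theorem ncard_cofaceVertices_of_notMem (h : StellarAt X Y A a) (hX : ∀ σ ∈ X, σ.card ≤ d + 1)
    (hs : s ∈ X) (hd : s.card = d) (hA : ¬ A ⊆ s) :
    (cofaceVertices Y s).ncard = (cofaceVertices X s).ncard := by
  have has := h.notMem_of_mem hs
  have haX : a ∉ cofaceVertices X s := fun h' =>
    h.notMem_of_mem h'.2 (Finset.mem_insert_self a s)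
  have hmem : ∀ x ≠ a, x ∈ cofaceVertices Y s ↔ x ∈ cofaceVertices X s ∧ ¬ A ⊆ insert x s := by
    intro x hx
    change x ∉ s ∧ _ ↔ (x ∉ s ∧ _) ∧ _
    rw [h.mem_iff_of_notMem (by grind)]
    tauto
  have hmema : a ∈ cofaceVertices Y s ↔ s ∪ A ∈ X := by
    change a ∉ s ∧ _ ↔ _
    rw [h.insert_mem_iff has]
    tauto
  obtain ⟨y, hyA, hys⟩ := Finset.not_subset.1 hA
  by_cases hsA : s ∪ A ∈ X
  · have hle : insert y s = s ∪ A := Finset.eq_of_subset_of_card_le (by grind) (by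
      rw [Finset.card_insert_of_notMem hys, hd]; exact hX _ hsA)
    have hy : y ∈ cofaceVertices X s := ⟨hys, hle ▸ hsA⟩
    have : cofaceVertices Y s = insert a (cofaceVertices X s \ {y}) := by
      ext x
      by_cases hxa : x = a
      · subst hxa; simp [hmema, hsA]
      · rw [hmem x hxa]
        simp only [Set.mem_insert_iff, hxa, false_or, Set.mem_sdiff, Set.mem_singleton_iff]
        refine and_congr_right fun hx => not_congr ⟨fun h' => ?_, ?_⟩
        · have := h' hyA
          grind
        · rintro rfl
          rw [hle]; exact Finset.subset_union_right
    rw [this, Set.ncard_exchange haX hy]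
  · congr 1
    ext x
    by_cases hxa : x = a
    · subst hxa; simp [hmema, hsA, haX]
    · rw [hmem x hxa]
      refine and_iff_left_of_imp fun hx h' => hsA ?_
      exact mem_of_subset hx.2 (by grind) ⟨y, by grind⟩

/-- Since `ρ` misses a vertex of `A`, the simplex `ρ ∪ A` has `d` or `d + 1` vertices. In the first
case `insert a ρ` takes over the cofaces of `ρ ∪ A`. In the second case `ρ` misses two vertices of
the top-dimensional `ρ ∪ A`, and either of them spans a coface. -/
theorem ncard_cofaceVertices_insert (h : StellarAt X Y A a) (hX : ∀ σ ∈ X, σ.card ≤ d + 1)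
    (hρ : ρ.card + 1 = d) (hA : ¬ A ⊆ ρ) (hρA : ρ ∪ A ∈ X) :
    ((ρ ∪ A).card = d ∧
      (cofaceVertices Y (insert a ρ)).ncard = (cofaceVertices X (ρ ∪ A)).ncard) ∨
    (cofaceVertices Y (insert a ρ)).ncard = 2 := by
  obtain ⟨y, hyA, hyρ⟩ := Finset.not_subset.1 hA
  have haρ : a ∉ ρ ∪ A := h.notMem_of_mem hρA
  have hmem : ∀ x, x ∈ cofaceVertices Y (insert a ρ) ↔
      x ≠ a ∧ x ∉ ρ ∧ ¬ A ⊆ insert x ρ ∧ insert x (ρ ∪ A) ∈ X := by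
    intro x
    by_cases hxa : x = a
    · simp [cofaceVertices, hxa]
    · have hax : a ∉ insert x ρ := by grind
      change x ∉ insert a ρ ∧ _ ↔ _
      rw [Finset.insert_comm, h.insert_mem_iff hax, Finset.insert_union]
      simp only [Finset.mem_insert]
      tauto
  have hsub : insert y ρ ⊆ ρ ∪ A := by grind
  have hc : (insert y ρ).card = d := by rw [Finset.card_insert_of_notMem hyρ, hρ]
  have h₁ := Finset.card_le_card hsub
  have h₂ := hX _ hρA
  rcases (show (ρ ∪ A).card = d ∨ (ρ ∪ A).card = d + 1 by omega) with hd | hd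
  · refine Or.inl ⟨hd, ?_⟩
    have hle : insert y ρ = ρ ∪ A := Finset.eq_of_subset_of_card_le hsub (by omega)
    congr 1
    ext x
    rw [hmem]
    change _ ↔ x ∉ ρ ∪ A ∧ _
    constructor
    · rintro ⟨-, hxρ, hxA, hx⟩
      refine ⟨fun hx' => hxA ?_, hx⟩
      rw [← hle, Finset.mem_insert, or_iff_left hxρ] at hx'
      rw [hx', hle]; exact Finset.subset_union_right
    · rintro ⟨hxρ, hx⟩
      refine ⟨?_, by grind, fun h' => ?_, hx⟩
      · rintro rfl
        exact h.notMem_of_mem hx (Finset.mem_insert_self _ _)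
      · have := h' hyA
        grind
  · right
    have hcard : ((ρ ∪ A) \ ρ).card = 2 := by
      rw [Finset.card_sdiff_of_subset Finset.subset_union_left]; omega
    have : cofaceVertices Y (insert a ρ) = ((ρ ∪ A) \ ρ : Finset ℕ) := by
      ext x
      rw [hmem, Finset.mem_coe, Finset.mem_sdiff]
      constructor
      · rintro ⟨-, hxρ, -, hx⟩
        refine ⟨?_, hxρ⟩
        by_contra hx'
        have := hX _ hx
        rw [Finset.card_insert_of_notMem hx'] at this
        omega
      · rintro ⟨hx, hxρ⟩
        refine ⟨by grind, hxρ, fun h' => ?_, by rwa [Finset.insert_eq_of_mem hx]⟩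
        have h₃ : ρ ∪ A ⊆ insert x ρ := Finset.union_subset (Finset.subset_insert _ _) h'
        have := Finset.card_le_card h₃
        rw [Finset.card_insert_of_notMem hxρ] at this
        omega
    rw [this, Set.ncard_coe_finset, hcard]

end StellarAt

/-- Every simplex with `d` vertices is a side of exactly two simplices with `d + 1` vertices, and
there are no larger simplices. -/
def IsClosedPseudomanifold (d : ℕ) (X : PreAbstractSimplicialComplex ℕ) : Prop :=
  (∀ σ ∈ X, σ.card ≤ d + 1) ∧ ∀ s ∈ X, s.card = d → (cofaceVertices X s).ncard = 2

theorem StellarStep.isClosedPseudomanifold_iff {X Y : PreAbstractSimplicialComplex ℕ}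
    (h : StellarStep X Y) (d : ℕ) :
    IsClosedPseudomanifold d X ↔ IsClosedPseudomanifold d Y := by
  obtain ⟨A, a, h⟩ := h.exists_stellarAt
  rw [IsClosedPseudomanifold, IsClosedPseudomanifold, ← h.card_le_iff]
  refine and_congr_right fun hX => ⟨fun hs₀ s hs hd => ?_, fun hs₀ s hs hd => ?_⟩
  · rcases (h.mem_iff s).1 hs with h' | ⟨ρ, rfl, h₁, h₂⟩
    · rw [h.ncard_cofaceVertices_of_notMem hX h'.1 hd h'.2]
      exact hs₀ s h'.1 hd
    · have ha : a ∉ ρ := fun h' => h.notMem_of_mem h₂ (Finset.mem_union_left _ h')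
      rw [Finset.card_insert_of_notMem ha] at hd
      rcases h.ncard_cofaceVertices_insert hX hd h₁ h₂ with h' | h'
      · rw [h'.2]; exact hs₀ _ h₂ h'.1
      · exact h'
  -- A face that contains `A` does not survive in `Y`, but the face with `x ∈ A` exchanged for `a`
  -- does, and it has the same coface vertices.
  · by_cases hA : A ⊆ s
    · obtain ⟨x, hx⟩ := nonempty_of_mem h.mem
      have he : s.erase x ∪ A = s := by ext y; have := @hA y; grind
      have hAx : ¬ A ⊆ s.erase x := fun h => Finset.notMem_erase x s (h hx)
      have ha := h.notMem_of_mem hs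
      have hce := Finset.card_erase_add_one (hA hx)
      have hY := hs₀ _ ((h.insert_mem_iff (s := s.erase x) (by grind)).2
        ⟨hAx, he.symm ▸ hs⟩) (by rw [Finset.card_insert_of_notMem (by grind)]; omega)
      have hρ : (s.erase x).card + 1 = d := by omega
      have haρ : a ∉ s.erase x := by grind
      have key : cofaceVertices X s ⊆ cofaceVertices Y (insert a (s.erase x)) ∧
          cofaceVertices Y (insert a (s.erase x)) ⊆ cofaceVertices X s := by
        constructor
        · rintro y ⟨hys, hy⟩
          have hya : y ≠ a := by
            rintro rfl
            exact h.notMem_of_mem hy (Finset.mem_insert_self _ _)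
          refine ⟨by grind, ?_⟩
          rw [Finset.insert_comm, h.insert_mem_iff (by grind), Finset.insert_union, he]
          exact ⟨fun h' => by have := h' hx; grind, hy⟩
        · rintro y ⟨hys, hy⟩
          rw [Finset.insert_comm, h.insert_mem_iff (by grind), Finset.insert_union, he] at hy
          refine ⟨fun hys' => ?_, hy.2⟩
          have : y = x := by grind
          refine hy.1 ?_
          rw [this, Finset.insert_erase (hA hx)]
          exact hA
      rw [key.1.antisymm key.2]
      exact hY
    · rw [← h.ncard_cofaceVertices_of_notMem hX hs hd hA]
      exact hs₀ s ((h.mem_iff s).2 (Or.inl ⟨hs, hA⟩)) hd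

theorem cofaceVertices_map {X : PreAbstractSimplicialComplex ℕ} {f : ℕ → ℕ}
    (hf : Set.InjOn f {v | {v} ∈ X}) {s : Finset ℕ} (hs : s ∈ X) :
    cofaceVertices (X.map f) (s.image f) = f '' cofaceVertices X s := by
  ext y
  constructor
  · rintro ⟨hy, t, ht, hte⟩
    have hyt : y ∈ t.image f := hte.superset (Finset.mem_insert_self _ _)
    obtain ⟨x, hx, rfl⟩ := Finset.mem_image.1 hyt
    refine ⟨x, ⟨fun hxs => hy (Finset.mem_image_of_mem f hxs), ?_⟩, rfl⟩
    rw [← Finset.image_insert] at hte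
    have hm : (insert x s).image f ∈ X.map f := ⟨t, ht, hte⟩
    refine (image_mem_map_iff hf fun v hv => ?_).1 hm
    rcases Finset.mem_insert.1 hv with rfl | hv
    · exact singleton_mem_of_mem ht hx
    · exact singleton_mem_of_mem hs hv
  · rintro ⟨x, ⟨hx, hxs⟩, rfl⟩
    refine ⟨fun h => hx ?_, ?_⟩
    · obtain ⟨x', hx', he⟩ := Finset.mem_image.1 h
      rwa [← hf (singleton_mem_of_mem hs hx')
        (singleton_mem_of_mem hxs (Finset.mem_insert_self _ _)) he]
    · rw [← Finset.image_insert]; exact image_mem_map f hxs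

theorem cofaceVertices_subset (X : PreAbstractSimplicialComplex ℕ) (s : Finset ℕ) :
    cofaceVertices X s ⊆ {v | {v} ∈ X} :=
  fun _ h => singleton_mem_of_mem h.2 (Finset.mem_insert_self _ _)

theorem ncard_cofaceVertices_map {X : PreAbstractSimplicialComplex ℕ} {f : ℕ → ℕ}
    (hf : Set.InjOn f {v | {v} ∈ X}) {s : Finset ℕ} (hs : s ∈ X) :
    (cofaceVertices (X.map f) (s.image f)).ncard = (cofaceVertices X s).ncard := by
  rw [cofaceVertices_map hf hs, (hf.mono (cofaceVertices_subset X s)).ncard_image]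

theorem PLHomeomorphic.isClosedPseudomanifold {X Y : PreAbstractSimplicialComplex ℕ} {d : ℕ}
    (h : PLHomeomorphic X Y) (hY : IsClosedPseudomanifold d Y) : IsClosedPseudomanifold d X := by
  obtain ⟨f, hf, h⟩ := h
  have key := (iff_of_eqvGen_stellarStep (fun Z W hs => hs.isClosedPseudomanifold_iff d) h).2 hY
  refine ⟨fun σ hσ => ?_, fun s hs hd => ?_⟩
  · rw [← card_image_of_mem hf hσ]; exact key.1 _ (image_mem_map f hσ)
  · rw [← ncard_cofaceVertices_map hf hs]
    exact key.2 _ (image_mem_map f hs) (by rw [card_image_of_mem hf hs, hd])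

theorem stdSphereComplex_finite (n : ℕ) : (stdSphereComplex n).faces.Finite :=
  (Finset.range (n + 2)).powerset.finite_toSet.subset fun _ h =>
    Finset.mem_powerset.2 h.2.subset

theorem isClosedPseudomanifold_stdSphereComplex (n : ℕ) :
    IsClosedPseudomanifold n (stdSphereComplex n) := by
  have hle : ∀ σ ∈ stdSphereComplex n, σ.card ≤ n + 1 := fun σ h => by
    have := Finset.card_lt_card h.2
    rw [Finset.card_range] at this
    omega
  refine ⟨hle, fun s hs hd => ?_⟩
  have : cofaceVertices (stdSphereComplex n) s = (Finset.range (n + 2) \ s : Finset ℕ) := by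
    ext x
    rw [Finset.mem_coe, Finset.mem_sdiff]
    constructor
    · rintro ⟨hx, h⟩
      exact ⟨h.2.subset (Finset.mem_insert_self _ _), hx⟩
    · rintro ⟨hx, hxs⟩
      refine ⟨hxs, Finset.insert_nonempty _ _, ?_⟩
      have hsub : insert x s ⊆ Finset.range (n + 2) := Finset.insert_subset hx hs.2.subset
      refine Finset.ssubset_iff_subset_ne.2 ⟨hsub, fun h => ?_⟩
      have := congrArg Finset.card h
      rw [Finset.card_insert_of_notMem hxs, Finset.card_range] at this
      omega
  rw [this, Set.ncard_coe_finset, Finset.card_sdiff_of_subset hs.2.subset, Finset.card_range]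
  omega

end

/-! ### Graphs cut into arcs at their vertices of degree three -/

noncomputable section

open PreAbstractSimplicialComplex

theorem mem_cofaceVertices_singleton {X : PreAbstractSimplicialComplex ℕ} {x y : ℕ} :
    y ∈ cofaceVertices X {x} ↔ y ≠ x ∧ {y, x} ∈ X := by
  simp [cofaceVertices]

theorem mem_cofaceVertices_comm {X : PreAbstractSimplicialComplex ℕ} {x y : ℕ} :
    y ∈ cofaceVertices X {x} ↔ x ∈ cofaceVertices X {y} := by
  rw [mem_cofaceVertices_singleton, mem_cofaceVertices_singleton, ne_comm, Finset.pair_comm]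

/-- The vertices of degree three of a graph. -/
def trivalentVertices (X : PreAbstractSimplicialComplex ℕ) : Set ℕ :=
  {x | (cofaceVertices X {x}).ncard = 3}

/-- `X` is a graph all of whose vertices have degree two or three. Cut at the vertices of degree
three it falls into arcs or circles, which are the classes of the colouring `col`, and each of them
has `j` ends, at different vertices. -/
structure ArcColoring (X : PreAbstractSimplicialComplex ℕ) (col : Finset ℕ → Finset ℕ) (j : ℕ) :
    Prop where
  card_le : ∀ σ ∈ X, σ.card ≤ 2
  vertex : ∀ x, {x} ∈ X →
    ((cofaceVertices X {x}).ncard = 2 ∧ ∀ y ∈ cofaceVertices X {x}, col {y, x} = col {x}) ∨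
    ((cofaceVertices X {x}).ncard = 3 ∧ ∀ y ∈ cofaceVertices X {x}, ∀ z ∈ cofaceVertices X {x},
      col {y, x} = col {z, x} → y = z)
  ends : ∀ e ∈ X, e.card = 2 →
    {x | x ∈ trivalentVertices X ∧ ∃ y ∈ cofaceVertices X {x}, col {y, x} = col e}.ncard = j
  -- Connectedness of a colour class without paths: a set that at each vertex of degree two contains
  -- the vertex together with both its segments or none of them contains the whole class as soon as
  -- it contains one segment of it.
  conn : ∀ S : Set (Finset ℕ), (∀ x, (cofaceVertices X {x}).ncard = 2 →
      ∀ y ∈ cofaceVertices X {x}, ({x} ∈ S ↔ {y, x} ∈ S)) →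
    ∀ e ∈ X, ∀ e' ∈ X, e.card = 2 → e'.card = 2 → col e = col e' → e ∈ S → e' ∈ S

/-- A graph with `k` vertices of degree three, all others being of degree two, the edges of which
form arcs with `j` ends. If `k = 0` it is a circle. -/
def IsArcGraph (X : PreAbstractSimplicialComplex ℕ) (k j : ℕ) : Prop :=
  X.faces.Nonempty ∧ (trivalentVertices X).ncard = k ∧ ∃ col, ArcColoring X col j ∧
    (k = 0 → ∀ e ∈ X, ∀ e' ∈ X, e.card = 2 → e'.card = 2 → col e = col e')

theorem trivalentVertices_subset (X : PreAbstractSimplicialComplex ℕ) :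
    trivalentVertices X ⊆ {v | {v} ∈ X} := by
  intro x hx
  have : (cofaceVertices X {x}).Nonempty := by
    rw [Set.nonempty_iff_ne_empty]
    intro h
    rw [trivalentVertices, Set.mem_ofPred_eq, h, Set.ncard_empty] at hx
    omega
  obtain ⟨y, hy⟩ := this
  exact mem_of_subset hy.2 (Finset.subset_insert _ _) (Finset.singleton_nonempty x)

theorem trivalentVertices_map {X : PreAbstractSimplicialComplex ℕ} {f : ℕ → ℕ}
    (hf : Set.InjOn f {v | {v} ∈ X}) :
    trivalentVertices (X.map f) = f '' trivalentVertices X := by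
  ext y
  constructor
  · intro hy
    obtain ⟨t, ht, hte⟩ := trivalentVertices_subset _ hy
    dsimp only at hte
    obtain ⟨x, hx, rfl⟩ := Finset.mem_image.1 (hte.superset (Finset.mem_singleton_self y))
    refine ⟨x, ?_, rfl⟩
    have := ncard_cofaceVertices_map hf (singleton_mem_of_mem ht hx)
    rw [Finset.image_singleton] at this
    exact this.symm.trans hy
  · rintro ⟨x, hx, rfl⟩
    have := ncard_cofaceVertices_map hf (trivalentVertices_subset X hx)
    rw [Finset.image_singleton] at this
    exact this.trans hx

theorem ArcColoring.of_map {X : PreAbstractSimplicialComplex ℕ} {f : ℕ → ℕ} {j : ℕ}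
    {col : Finset ℕ → Finset ℕ} (hf : Set.InjOn f {v | {v} ∈ X})
    (h : ArcColoring (X.map f) col j) : ArcColoring X (fun σ => col (σ.image f)) j := by
  have hn : ∀ x, {x} ∈ X → cofaceVertices (X.map f) {f x} = f '' cofaceVertices X {x} :=
    fun x hx => by rw [← Finset.image_singleton, cofaceVertices_map hf hx]
  have hn' : ∀ x, {x} ∈ X →
      (cofaceVertices (X.map f) {f x}).ncard = (cofaceVertices X {x}).ncard :=
    fun x hx => by rw [← Finset.image_singleton, ncard_cofaceVertices_map hf hx]
  have hi : ∀ x y, ({y, x} : Finset ℕ).image f = {f y, f x} := fun x y => by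
    rw [Finset.image_insert, Finset.image_singleton]
  refine ⟨fun σ hσ => ?_, fun x hx => ?_, fun e he he2 => ?_, fun S hS e he e' he' h2 h2' hc => ?_⟩
  · rw [← card_image_of_mem hf hσ]; exact h.card_le _ (image_mem_map f hσ)
  · have hv := h.vertex (f x) (by simpa using image_mem_map f hx)
    rw [hn' x hx, hn x hx] at hv
    simp only [Set.forall_mem_image] at hv
    simp only [hi, Finset.image_singleton]
    refine hv.imp id fun hv => ⟨hv.1, fun y hy z hz hc => ?_⟩
    exact hf (cofaceVertices_subset X _ hy) (cofaceVertices_subset X _ hz) (hv.2 hy hz hc)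
  · have := h.ends _ (image_mem_map f he) ((card_image_of_mem hf he).trans he2)
    rw [← this, trivalentVertices_map hf]
    have hs : {x | x ∈ trivalentVertices X ∧
        ∃ y ∈ cofaceVertices X {x}, col (({y, x} : Finset ℕ).image f) = col (e.image f)} ⊆
        {v | {v} ∈ X} := fun x hx => trivalentVertices_subset X hx.1
    rw [← (hf.mono hs).ncard_image]
    congr 1
    ext z
    constructor
    · rintro ⟨x, ⟨hx, y, hy, hc⟩, rfl⟩
      refine ⟨⟨x, hx, rfl⟩, f y, ?_, by rw [← hc, hi]⟩
      rw [hn x (trivalentVertices_subset X hx)]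
      exact ⟨y, hy, rfl⟩
    · rintro ⟨⟨x, hx, rfl⟩, y, hy, hc⟩
      rw [hn x (trivalentVertices_subset X hx)] at hy
      obtain ⟨y, hy, rfl⟩ := hy
      exact ⟨x, ⟨hx, y, hy, by rw [hi, hc]⟩, rfl⟩
  · intro heS
    have key := h.conn {τ | ∃ σ ∈ X, σ.image f = τ ∧ σ ∈ S} ?_ _ (image_mem_map f he) _
      (image_mem_map f he') ((card_image_of_mem hf he).trans h2)
      ((card_image_of_mem hf he').trans h2') hc ⟨e, he, rfl, heS⟩
    · obtain ⟨σ, hσ, hσe, hσS⟩ := key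
      rwa [← image_injOn hf hσ he' hσe]
    · intro x' hx' y' hy'
      obtain ⟨t, ht, hte⟩ := hy'.2
      dsimp only at hte
      obtain ⟨x, hx, rfl⟩ := Finset.mem_image.1 (hte.superset (by simp : x' ∈ insert y' {x'}))
      have hxX := singleton_mem_of_mem ht hx
      rw [hn' x hxX] at hx'
      rw [hn x hxX] at hy'
      obtain ⟨y, hy, rfl⟩ := hy'
      have hyX := (mem_cofaceVertices_singleton.1 hy).2
      have := hS x hx' y hy
      constructor
      · rintro ⟨σ, hσ, hσe, hσS⟩
        rw [← Finset.image_singleton] at hσe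
        rw [image_injOn hf hσ hxX hσe, this] at hσS
        exact ⟨_, hyX, hi _ _, hσS⟩
      · rintro ⟨σ, hσ, hσe, hσS⟩
        rw [← hi] at hσe
        rw [image_injOn hf hσ hyX hσe, ← this] at hσS
        exact ⟨_, hxX, Finset.image_singleton _ _, hσS⟩

theorem IsArcGraph.of_map {X : PreAbstractSimplicialComplex ℕ} {f : ℕ → ℕ} {k j : ℕ}
    (hf : Set.InjOn f {v | {v} ∈ X}) (h : IsArcGraph (X.map f) k j) : IsArcGraph X k j := by
  obtain ⟨⟨_, s, hs, -⟩, hk, col, hcol, h0⟩ := h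
  refine ⟨⟨s, hs⟩, ?_, _, hcol.of_map hf, fun hk0 e he e' he' h2 h2' => ?_⟩
  · rw [← hk, trivalentVertices_map hf, (hf.mono (trivalentVertices_subset X)).ncard_image]
  · exact h0 hk0 _ (image_mem_map f he) _ (image_mem_map f he')
      ((card_image_of_mem hf he).trans h2) ((card_image_of_mem hf he').trans h2')

/-- The open star of a vertex is already the cone over its frontier, so coning from `a` only renames
the apex. For graphs this disposes of the subdivisions at a vertex. -/
theorem StellarAt.map_swap {X Y : PreAbstractSimplicialComplex ℕ} {p a : ℕ}
    (h : StellarAt X Y {p} a) : Y = X.map (Equiv.swap p a) := by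
  have hpa : p ≠ a := by
    rintro rfl
    exact h.notMem h.mem
  have hsw : ∀ σ ∈ X, p ∈ σ → σ.image (Equiv.swap p a) = insert a (σ.erase p) := by
    intro σ hσ hp
    have ha := h.notMem_of_mem hσ
    ext x
    simp only [Finset.mem_image, Finset.mem_insert, Finset.mem_erase]
    constructor
    · rintro ⟨y, hy, rfl⟩
      by_cases hyp : y = p
      · simp [hyp]
      · rw [Equiv.swap_apply_of_ne_of_ne hyp (by rintro rfl; exact ha hy)]
        exact Or.inr ⟨hyp, hy⟩
    · rintro (rfl | ⟨hxp, hx⟩)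
      · exact ⟨p, hp, Equiv.swap_apply_left _ _⟩
      · exact ⟨x, hx, Equiv.swap_apply_of_ne_of_ne hxp (by rintro rfl; exact ha hx)⟩
  have hsw' : ∀ σ ∈ X, p ∉ σ → σ.image (Equiv.swap p a) = σ := by
    intro σ hσ hp
    have ha := h.notMem_of_mem hσ
    conv_rhs => rw [← Finset.image_id (s := σ)]
    refine Finset.image_congr fun x hx => ?_
    exact Equiv.swap_apply_of_ne_of_ne (by rintro rfl; exact hp hx) (by rintro rfl; exact ha hx)
  refine SetLike.ext fun σ => ?_
  rw [h.mem_iff, mem_map_iff]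
  simp only [Finset.singleton_subset_iff]
  constructor
  · rintro (h' | ⟨ρ, rfl, h₁, h₂⟩)
    · exact ⟨σ, h'.1, hsw' σ h'.1 h'.2⟩
    · refine ⟨_, h₂, ?_⟩
      rw [hsw _ h₂ (by simp)]
      congr 1
      ext x; grind
  · rintro ⟨s, hs, rfl⟩
    by_cases hp : p ∈ s
    · refine Or.inr ⟨s.erase p, hsw s hs hp, by simp, ?_⟩
      convert hs using 1
      ext x; grind
    · rw [hsw' s hs hp]
      exact Or.inl ⟨hs, hp⟩

theorem StellarAt.eq_map_swap {X Y : PreAbstractSimplicialComplex ℕ} {p a : ℕ}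
    (h : StellarAt X Y {p} a) : X = Y.map (Equiv.swap p a) := by
  rw [h.map_swap]
  refine SetLike.ext fun σ => ?_
  have he : ∀ s : Finset ℕ, (s.image (Equiv.swap p a)).image (Equiv.swap p a) = s := fun s => by
    rw [Finset.image_image, ← Equiv.coe_trans, Equiv.swap_swap]
    exact Finset.image_id
  constructor
  · exact fun hσ => ⟨_, ⟨σ, hσ, rfl⟩, he σ⟩
  · rintro ⟨_, ⟨s, hs, rfl⟩, rfl⟩
    dsimp only
    rwa [he s]

end

/-! ### The arcs of a graph under subdivision of an edge -/

noncomputable section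

open PreAbstractSimplicialComplex

/-- `Y` is obtained from the graph `X` by subdividing the edge `{p, q}` at the new vertex `a`. -/
structure EdgeSubdivision (X Y : PreAbstractSimplicialComplex ℕ) (p q a : ℕ) : Prop where
  ne : p ≠ q
  mem : {p, q} ∈ X
  notMem : ∀ σ ∈ X, a ∉ σ
  card_le : ∀ σ ∈ X, σ.card ≤ 2
  card_le' : ∀ σ ∈ Y, σ.card ≤ 2
  mem_iff : ∀ σ, a ∉ σ → (σ ∈ Y ↔ σ ∈ X ∧ σ ≠ {p, q})
  pair_mem : ∀ y, {y, a} ∈ Y ↔ y = a ∨ y = p ∨ y = q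

/-- In a graph no simplex properly contains `{p, q}`, so the open star that is replaced is the open
edge alone. -/
theorem StellarAt.edgeSubdivision {X Y : PreAbstractSimplicialComplex ℕ} {p q a : ℕ}
    (h : StellarAt X Y {p, q} a) (hpq : p ≠ q) (hX : ∀ σ ∈ X, σ.card ≤ 2) :
    EdgeSubdivision X Y p q a := by
  have hpa : p ≠ a := by
    rintro rfl
    exact h.notMem_of_mem h.mem (by simp)
  have hqa : q ≠ a := by
    rintro rfl
    exact h.notMem_of_mem h.mem (by simp)
  refine ⟨hpq, h.mem, fun σ hσ => h.notMem_of_mem hσ, hX, (h.card_le_iff 2).1 hX,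
    fun σ ha => ?_, fun y => ?_⟩
  · rw [h.mem_iff_of_notMem ha]
    refine and_congr_right fun hσ => not_congr ⟨fun hs => ?_, fun hs => hs.superset⟩
    exact (Finset.eq_of_subset_of_card_le hs (by rw [Finset.card_pair hpq]; exact hX σ hσ)).symm
  · by_cases hya : y = a
    · have h0 := (h.insert_mem_iff (Finset.notMem_empty a)).2 ⟨by simp, by simpa using h.mem⟩
      simpa [hya] using h0
    · have hay : a ∉ ({y} : Finset ℕ) := by simpa using Ne.symm hya
      rw [Finset.pair_comm, h.insert_mem_iff hay]
      simp only [hya, false_or]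
      constructor
      · rintro ⟨-, h₂⟩
        by_contra hy
        have := hX _ h₂
        rw [Finset.singleton_union, Finset.card_insert_of_notMem (by simpa using hy),
          Finset.card_pair hpq] at this
        omega
      · rintro (rfl | rfl)
        · refine ⟨fun h' => hpq (Finset.mem_singleton.1 (h' (by simp : q ∈ _))).symm, ?_⟩
          simpa using h.mem
        · refine ⟨fun h' => hpq (Finset.mem_singleton.1 (h' (by simp : p ∈ _))), ?_⟩
          simpa using h.mem

namespace EdgeSubdivision

variable {X Y : PreAbstractSimplicialComplex ℕ} {p q a : ℕ}

theorem symm (h : EdgeSubdivision X Y p q a) : EdgeSubdivision X Y q p a where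
  ne := h.ne.symm
  mem := Finset.pair_comm p q ▸ h.mem
  notMem := h.notMem
  card_le := h.card_le
  card_le' := h.card_le'
  mem_iff := fun σ hσ => by rw [h.mem_iff σ hσ, Finset.pair_comm]
  pair_mem := fun y => by rw [h.pair_mem, or_comm (a := y = p)]

theorem left_ne (h : EdgeSubdivision X Y p q a) : p ≠ a := by
  rintro rfl
  exact h.notMem _ h.mem (by simp)

theorem right_ne (h : EdgeSubdivision X Y p q a) : q ≠ a := h.symm.left_ne

theorem notMem_cofaceVertices (h : EdgeSubdivision X Y p q a) (x : ℕ) :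
    a ∉ cofaceVertices X {x} := fun h' => h.notMem _ h'.2 (Finset.mem_insert_self _ _)

theorem cofaceVertices_new (h : EdgeSubdivision X Y p q a) :
    cofaceVertices Y {a} = {p, q} := by
  ext y
  rw [mem_cofaceVertices_singleton, h.pair_mem]
  have := h.left_ne
  have := h.right_ne
  simp only [Set.mem_insert_iff, Set.mem_singleton_iff]
  grind

theorem ncard_new (h : EdgeSubdivision X Y p q a) : (cofaceVertices Y {a}).ncard = 2 := by
  rw [h.cofaceVertices_new, Set.ncard_pair h.ne]

theorem cofaceVertices_left (h : EdgeSubdivision X Y p q a) :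
    cofaceVertices Y {p} = insert a (cofaceVertices X {p} \ {q}) := by
  ext y
  rw [Set.mem_insert_iff, Set.mem_sdiff, mem_cofaceVertices_singleton,
    mem_cofaceVertices_singleton, Set.mem_singleton_iff]
  by_cases hy : y = a
  · subst hy
    simp [h.left_ne.symm, Finset.pair_comm y p, h.pair_mem]
  · have ha : a ∉ ({y, p} : Finset ℕ) := by
      have := h.left_ne
      simp only [Finset.mem_insert, Finset.mem_singleton]; grind
    rw [h.mem_iff _ ha]
    simp only [hy, false_or, and_assoc]
    refine and_congr_right fun hyp => and_congr_right fun _ => not_congr ⟨fun he => ?_, ?_⟩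
    · have : y ∈ ({p, q} : Finset ℕ) := he ▸ Finset.mem_insert_self _ _
      simpa [hyp] using this
    · rintro rfl
      exact Finset.pair_comm _ _

theorem cofaceVertices_of_ne (h : EdgeSubdivision X Y p q a) {x : ℕ} (hxp : x ≠ p) (hxq : x ≠ q)
    (hxa : x ≠ a) : cofaceVertices Y {x} = cofaceVertices X {x} := by
  ext y
  rw [mem_cofaceVertices_singleton, mem_cofaceVertices_singleton]
  by_cases hy : y = a
  · subst hy
    have : {x, y} ∉ X := fun h' => h.notMem _ h' (by simp)
    simp [this, Finset.pair_comm y x, h.pair_mem, hxp, hxq, hxa]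
  · have ha : a ∉ ({y, x} : Finset ℕ) := by
      simp only [Finset.mem_insert, Finset.mem_singleton]; grind
    rw [h.mem_iff _ ha]
    refine and_congr_right fun hyx => and_iff_left_of_imp fun _ he => ?_
    have : x ∈ ({p, q} : Finset ℕ) := he ▸ by simp
    simp [hxp, hxq] at this

theorem right_mem (h : EdgeSubdivision X Y p q a) : q ∈ cofaceVertices X {p} := by
  rw [mem_cofaceVertices_singleton, Finset.pair_comm]
  exact ⟨h.ne.symm, h.mem⟩

/-- At `p` the neighbour `q` is exchanged for `a`, at `q` the neighbour `p`, and at the other old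
vertices nothing happens. -/
theorem ncard_of_ne (h : EdgeSubdivision X Y p q a) {x : ℕ} (hxa : x ≠ a) :
    (cofaceVertices Y {x}).ncard = (cofaceVertices X {x}).ncard := by
  by_cases hxp : x = p
  · rw [hxp, h.cofaceVertices_left, Set.ncard_exchange (h.notMem_cofaceVertices p) h.right_mem]
  by_cases hxq : x = q
  · rw [hxq, h.symm.cofaceVertices_left,
      Set.ncard_exchange (h.notMem_cofaceVertices q) h.symm.right_mem]
  rw [h.cofaceVertices_of_ne hxp hxq hxa]

theorem cofaceVertices_old (h : EdgeSubdivision X Y p q a) : cofaceVertices X {a} = ∅ := by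
  ext y
  simp only [Set.mem_empty_iff_false, iff_false]
  exact fun h' => h.notMem _ h'.2 (by simp)

theorem trivalentVertices_eq (h : EdgeSubdivision X Y p q a) :
    trivalentVertices Y = trivalentVertices X := by
  ext x
  change _ = 3 ↔ _ = 3
  by_cases hx : x = a
  · rw [hx, h.ncard_new, h.cofaceVertices_old]
    simp
  · rw [h.ncard_of_ne hx]

/-- A segment `{y, x}` of `Y` at an old vertex `x` is a part of the segment `{y', x}` of `X`. -/
theorem exists_old (h : EdgeSubdivision X Y p q a) {x y : ℕ} (hxa : x ≠ a)
    (hy : y ∈ cofaceVertices Y {x}) : ∃ y' ∈ cofaceVertices X {x},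
      (y = a ∧ ({y', x} : Finset ℕ) = {p, q}) ∨
      (y' = y ∧ y ≠ a ∧ ({y, x} : Finset ℕ) ≠ {p, q}) := by
  by_cases hya : y = a
  · rw [mem_cofaceVertices_comm, hya, h.cofaceVertices_new] at hy
    rcases hy with rfl | rfl
    · exact ⟨q, h.right_mem, Or.inl ⟨hya, Finset.pair_comm _ _⟩⟩
    · exact ⟨p, h.symm.right_mem, Or.inl ⟨hya, rfl⟩⟩
  · have ha : a ∉ ({y, x} : Finset ℕ) := by
      simp only [Finset.mem_insert, Finset.mem_singleton]; grind
    have h' := (h.mem_iff _ ha).1 (mem_cofaceVertices_singleton.1 hy).2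
    exact ⟨y, mem_cofaceVertices_singleton.2 ⟨(mem_cofaceVertices_singleton.1 hy).1, h'.1⟩,
      Or.inr ⟨rfl, hya, h'.2⟩⟩

/-- A segment `{y', x}` of `X` contains a segment `{y, x}` of `Y`. -/
theorem exists_new (h : EdgeSubdivision X Y p q a) {x y' : ℕ}
    (hy : y' ∈ cofaceVertices X {x}) : ∃ y ∈ cofaceVertices Y {x},
      (y = a ∧ ({y', x} : Finset ℕ) = {p, q}) ∨
      (y' = y ∧ y ≠ a ∧ ({y, x} : Finset ℕ) ≠ {p, q}) := by
  have hy' := mem_cofaceVertices_singleton.1 hy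
  have ha := h.notMem _ hy'.2
  by_cases he : ({y', x} : Finset ℕ) = {p, q}
  · refine ⟨a, ?_, Or.inl ⟨rfl, he⟩⟩
    rw [mem_cofaceVertices_comm, h.cofaceVertices_new]
    have : x ∈ ({p, q} : Finset ℕ) := he ▸ by simp
    simpa using this
  · refine ⟨y', mem_cofaceVertices_singleton.2 ⟨hy'.1, (h.mem_iff _ ha).2 ⟨hy'.2, he⟩⟩,
      Or.inr ⟨rfl, ?_, he⟩⟩
    rintro rfl
    simp at ha

/-- Colourings of `X` and of `Y` that correspond to each other. -/
structure Compatible (X Y : PreAbstractSimplicialComplex ℕ) (p q a : ℕ)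
    (cX cY : Finset ℕ → Finset ℕ) : Prop where
  old : ∀ σ, a ∉ σ → σ ≠ {p, q} → cX σ = cY σ
  new : cY {a} = cX {p, q}
  left : cY {a, p} = cX {p, q}
  right : cY {a, q} = cX {p, q}

variable {cX cY : Finset ℕ → Finset ℕ} {j : ℕ}

theorem Compatible.singleton (h : EdgeSubdivision X Y p q a) (hc : Compatible X Y p q a cX cY)
    {x : ℕ} (hxa : x ≠ a) : cX {x} = cY {x} := by
  refine hc.old _ (by simpa using hxa.symm) fun he => h.ne ?_
  have h1 : p ∈ ({x} : Finset ℕ) := he ▸ by simp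
  have h2 : q ∈ ({x} : Finset ℕ) := he ▸ by simp
  rw [Finset.mem_singleton] at h1 h2
  rw [h1, h2]

theorem Compatible.pair (hc : Compatible X Y p q a cX cY)
    {x y y' : ℕ} (hxa : x ≠ a) (hy : (y = a ∧ ({y', x} : Finset ℕ) = {p, q}) ∨
      (y' = y ∧ y ≠ a ∧ ({y, x} : Finset ℕ) ≠ {p, q})) : cX {y', x} = cY {y, x} := by
  rcases hy with ⟨rfl, he⟩ | ⟨rfl, hya, he⟩
  · rw [he]
    have : x ∈ ({p, q} : Finset ℕ) := he ▸ by simp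
    rcases Finset.mem_insert.1 this with rfl | hx
    · exact hc.left.symm
    · rw [Finset.mem_singleton] at hx
      subst hx
      exact hc.right.symm
  · refine hc.old _ ?_ he
    simp only [Finset.mem_insert, Finset.mem_singleton]; grind

/-- At an old vertex the correspondence between the segments of `X` and of `Y` is one-to-one. This
transports the condition that at a vertex of degree three distinct segments have distinct colours.
-/
theorem eq_of_corr {x y y' z z' : ℕ} (hxa : x ≠ a)
    (hy : (y = a ∧ ({y', x} : Finset ℕ) = {p, q}) ∨
      (y' = y ∧ y ≠ a ∧ ({y, x} : Finset ℕ) ≠ {p, q}))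
    (hz : (z = a ∧ ({z', x} : Finset ℕ) = {p, q}) ∨
      (z' = z ∧ z ≠ a ∧ ({z, x} : Finset ℕ) ≠ {p, q}))
    (hyx : y' ≠ x) (hzx : z' ≠ x) : y = z ↔ y' = z' := by
  rcases hy with ⟨rfl, he⟩ | ⟨rfl, hya, he⟩ <;> rcases hz with ⟨rfl, hf⟩ | ⟨rfl, hza, hf⟩
  · have : y' ∈ ({z', x} : Finset ℕ) := hf ▸ he ▸ by simp
    simp only [Finset.mem_insert, Finset.mem_singleton, hyx, or_false] at this
    simp [this]
  · refine ⟨fun h => absurd h.symm hza, ?_⟩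
    rintro rfl
    exact absurd he hf
  · refine ⟨fun h => absurd h hya, ?_⟩
    rintro rfl
    exact absurd hf he
  · rfl

theorem exists_old_edge (h : EdgeSubdivision X Y p q a) {e : Finset ℕ} (he : e ∈ Y)
    (he2 : e.card = 2) : ∃ x y y', x ≠ a ∧ e = {y, x} ∧ y ∈ cofaceVertices Y {x} ∧
      y' ∈ cofaceVertices X {x} ∧ ((y = a ∧ ({y', x} : Finset ℕ) = {p, q}) ∨
      (y' = y ∧ y ≠ a ∧ ({y, x} : Finset ℕ) ≠ {p, q})) := by
  obtain ⟨y, x, hyx, rfl⟩ := Finset.card_eq_two.1 he2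
  by_cases hxa : x = a
  · have hy : x ∈ cofaceVertices Y {y} := by
      rw [mem_cofaceVertices_singleton, Finset.pair_comm]; exact ⟨hyx.symm, he⟩
    obtain ⟨y', hy', h'⟩ := h.exists_old (hxa ▸ hyx) hy
    exact ⟨y, x, y', hxa ▸ hyx, Finset.pair_comm _ _, hy, hy', h'⟩
  · have hy : y ∈ cofaceVertices Y {x} := mem_cofaceVertices_singleton.2 ⟨hyx, he⟩
    obtain ⟨y', hy', h'⟩ := h.exists_old hxa hy
    exact ⟨x, y, y', hxa, rfl, hy, hy', h'⟩

theorem exists_new_edge (h : EdgeSubdivision X Y p q a) {e : Finset ℕ} (he : e ∈ X)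
    (he2 : e.card = 2) : ∃ x y y', x ≠ a ∧ e = {y', x} ∧ y ∈ cofaceVertices Y {x} ∧
      y' ∈ cofaceVertices X {x} ∧ ((y = a ∧ ({y', x} : Finset ℕ) = {p, q}) ∨
      (y' = y ∧ y ≠ a ∧ ({y, x} : Finset ℕ) ≠ {p, q})) := by
  obtain ⟨y', x, hyx, rfl⟩ := Finset.card_eq_two.1 he2
  have hy : y' ∈ cofaceVertices X {x} := mem_cofaceVertices_singleton.2 ⟨hyx, he⟩
  obtain ⟨y, hy', h'⟩ := h.exists_new hy
  exact ⟨x, y, y', fun hx => h.notMem _ he (by simp [hx]), rfl, hy', hy, h'⟩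

theorem mem_of_mem (h : EdgeSubdivision X Y p q a) {x : ℕ} (hxa : x ≠ a) :
    {x} ∈ X ↔ {x} ∈ Y := by
  rw [h.mem_iff _ (by simpa using hxa.symm), and_iff_left]
  intro he
  have := congrArg Finset.card he
  rw [Finset.card_singleton, Finset.card_pair h.ne] at this
  omega

theorem Compatible.ends_eq (h : EdgeSubdivision X Y p q a) (hc : Compatible X Y p q a cX cY)
    (c : Finset ℕ) :
    {x | x ∈ trivalentVertices Y ∧ ∃ y ∈ cofaceVertices Y {x}, cY {y, x} = c} =
    {x | x ∈ trivalentVertices X ∧ ∃ y ∈ cofaceVertices X {x}, cX {y, x} = c} := by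
  ext x
  simp only [Set.mem_ofPred_eq, h.trivalentVertices_eq]
  refine and_congr_right fun hx => ?_
  have hxa : x ≠ a := by
    rintro rfl
    rw [trivalentVertices, Set.mem_ofPred_eq, h.cofaceVertices_old] at hx
    simp at hx
  constructor
  · rintro ⟨y, hy, rfl⟩
    obtain ⟨y', hy', hh⟩ := h.exists_old hxa hy
    exact ⟨y', hy', hc.pair hxa hh⟩
  · rintro ⟨y', hy', rfl⟩
    obtain ⟨y, hy, hh⟩ := h.exists_new hy'
    exact ⟨y, hy, (hc.pair hxa hh).symm⟩

/-- At an old vertex corresponding segments have equal colours, so degrees, colour conditions and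
ends carry over, and at the new vertex both halves have the colour of the subdivided edge. Only
connectedness of the colour classes requires a construction. -/
theorem Compatible.forward (h : EdgeSubdivision X Y p q a) (hc : Compatible X Y p q a cX cY)
    (hX : ArcColoring X cX j) : ArcColoring Y cY j := by
  refine ⟨h.card_le', fun x hx => ?_, fun e he he2 => ?_, fun S hS e he e' he' h2 h2' hee heS => ?_⟩
  · by_cases hxa : x = a
    · subst hxa
      refine Or.inl ⟨h.ncard_new, ?_⟩
      rw [h.cofaceVertices_new, hc.new]
      rintro y (rfl | rfl)
      · rw [Finset.pair_comm, hc.left]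
      · rw [Finset.pair_comm, hc.right]
    · rw [h.ncard_of_ne hxa]
      refine (hX.vertex x ((h.mem_of_mem hxa).2 hx)).imp (fun hv => ⟨hv.1, fun y hy => ?_⟩)
        (fun hv => ⟨hv.1, fun y hy z hz hyz => ?_⟩)
      · obtain ⟨y', hy', hh⟩ := h.exists_old hxa hy
        rw [← hc.pair hxa hh, hv.2 y' hy', hc.singleton h hxa]
      · obtain ⟨y', hy', hh⟩ := h.exists_old hxa hy
        obtain ⟨z', hz', hg⟩ := h.exists_old hxa hz
        rw [← hc.pair hxa hh, ← hc.pair hxa hg] at hyz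
        exact (eq_of_corr hxa hh hg (mem_cofaceVertices_singleton.1 hy').1
          (mem_cofaceVertices_singleton.1 hz').1).2 (hv.2 _ hy' _ hz' hyz)
  · obtain ⟨x, y, y', hxa, rfl, hy, hy', hh⟩ := h.exists_old_edge he he2
    rw [hc.ends_eq h, ← hc.pair hxa hh]
    exact hX.ends _ (mem_cofaceVertices_singleton.1 hy').2
      (Finset.card_pair (mem_cofaceVertices_singleton.1 hy').1)
  -- A test set `S` for `Y` becomes one for `X` by letting `{p, q}` belong to it when `{a}` belongs
  -- to `S`. As `a` has degree two, this is also the condition that either half belongs to `S`.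
  · have hedge : ∀ x y y', x ≠ a → y ∈ cofaceVertices Y {x} →
        ((y = a ∧ ({y', x} : Finset ℕ) = {p, q}) ∨
        (y' = y ∧ y ≠ a ∧ ({y, x} : Finset ℕ) ≠ {p, q})) →
        (({y, x} ∈ S) ↔ {y', x} ∈ {σ | (σ = {p, q} ∧ {a} ∈ S) ∨ (σ ≠ {p, q} ∧ σ ∈ S)}) := by
      intro x y y' hxa hy hh
      rcases hh with ⟨rfl, hh⟩ | ⟨rfl, hya, hh⟩
      · have := hS y h.ncard_new x (mem_cofaceVertices_comm.1 hy)
        rw [Finset.pair_comm] at this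
        simp [hh, this]
      · simp [hh]
    obtain ⟨x, y, y', hxa, rfl, hy, hy', hh⟩ := h.exists_old_edge he h2
    obtain ⟨x₁, y₁, y₁', hxa₁, rfl, hy₁, hy₁', hh₁⟩ := h.exists_old_edge he' h2'
    rw [hedge _ _ _ hxa₁ hy₁ hh₁]
    rw [hedge _ _ _ hxa hy hh] at heS
    refine hX.conn _ (fun w hw z' hz' => ?_) _ (mem_cofaceVertices_singleton.1 hy').2 _
      (mem_cofaceVertices_singleton.1 hy₁').2 (Finset.card_pair (mem_cofaceVertices_singleton.1 hy').1)
      (Finset.card_pair (mem_cofaceVertices_singleton.1 hy₁').1) ?_ heS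
    · have hwa : w ≠ a := by
        rintro rfl
        rw [h.cofaceVertices_old] at hz'
        exact hz'
      obtain ⟨z, hz, hg⟩ := h.exists_new hz'
      rw [← hedge _ _ _ hwa hz hg, ← hS w (by rw [h.ncard_of_ne hwa, hw]) z hz]
      have : ({w} : Finset ℕ) ≠ {p, q} := fun he => by
        have := congrArg Finset.card he
        rw [Finset.card_singleton, Finset.card_pair h.ne] at this
        omega
      simp [this]
    · rw [hc.pair hxa hh, hc.pair hxa₁ hh₁, hee]

theorem Compatible.backward (h : EdgeSubdivision X Y p q a) (hc : Compatible X Y p q a cX cY)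
    (hY : ArcColoring Y cY j) : ArcColoring X cX j := by
  refine ⟨h.card_le, fun x hx => ?_, fun e he he2 => ?_, fun S hS e he e' he' h2 h2' hee heS => ?_⟩
  · have hxa : x ≠ a := by
      rintro rfl
      exact h.notMem _ hx (by simp)
    rw [← h.ncard_of_ne hxa]
    refine (hY.vertex x ((h.mem_of_mem hxa).1 hx)).imp (fun hv => ⟨hv.1, fun y hy => ?_⟩)
      (fun hv => ⟨hv.1, fun y' hy' z' hz' hyz => ?_⟩)
    · obtain ⟨y', hy', hh⟩ := h.exists_new hy
      rw [hc.pair hxa hh, hv.2 y' hy', hc.singleton h hxa]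
    · obtain ⟨y, hy, hh⟩ := h.exists_new hy'
      obtain ⟨z, hz, hg⟩ := h.exists_new hz'
      rw [hc.pair hxa hh, hc.pair hxa hg] at hyz
      exact (eq_of_corr hxa hh hg (mem_cofaceVertices_singleton.1 hy').1
        (mem_cofaceVertices_singleton.1 hz').1).1 (hv.2 _ hy _ hz hyz)
  · obtain ⟨x, y, y', hxa, rfl, hy, hy', hh⟩ := h.exists_new_edge he he2
    rw [← hc.ends_eq h, hc.pair hxa hh]
    exact hY.ends _ (mem_cofaceVertices_singleton.1 hy).2
      (Finset.card_pair (mem_cofaceVertices_singleton.1 hy).1)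
  -- A test set `S` for `X` becomes one for `Y` by letting every simplex through `a` belong to it
  -- exactly when `{p, q} ∈ S`, so the condition at the new vertex holds automatically.
  · have hedge : ∀ x y y', x ≠ a →
        ((y = a ∧ ({y', x} : Finset ℕ) = {p, q}) ∨
        (y' = y ∧ y ≠ a ∧ ({y, x} : Finset ℕ) ≠ {p, q})) →
        (({y', x} ∈ S) ↔ {y, x} ∈ {σ | (a ∈ σ ∧ {p, q} ∈ S) ∨ (a ∉ σ ∧ σ ∈ S)}) := by
      intro x y y' hxa hh
      rcases hh with ⟨rfl, hh⟩ | ⟨rfl, hya, hh⟩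
      · simp [hh]
      · simp [hya.symm, hxa.symm]
    obtain ⟨x, y, y', hxa, rfl, hy, hy', hh⟩ := h.exists_new_edge he h2
    obtain ⟨x₁, y₁, y₁', hxa₁, rfl, hy₁, hy₁', hh₁⟩ := h.exists_new_edge he' h2'
    rw [hedge _ _ _ hxa₁ hh₁]
    rw [hedge _ _ _ hxa hh] at heS
    refine hY.conn _ (fun w hw z hz => ?_) _ (mem_cofaceVertices_singleton.1 hy).2 _
      (mem_cofaceVertices_singleton.1 hy₁).2 (Finset.card_pair (mem_cofaceVertices_singleton.1 hy).1)
      (Finset.card_pair (mem_cofaceVertices_singleton.1 hy₁).1) ?_ heS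
    · by_cases hwa : w = a
      · simp [hwa]
      · obtain ⟨z', hz', hg⟩ := h.exists_old hwa hz
        rw [← hedge _ _ _ hwa hg, ← hS w (by rw [← h.ncard_of_ne hwa, hw]) z' hz']
        simp [Ne.symm hwa]
    · rw [← hc.pair hxa hh, ← hc.pair hxa₁ hh₁, hee]

theorem compatible_of_old (X Y : PreAbstractSimplicialComplex ℕ) (p q a : ℕ) (cX : Finset ℕ → Finset ℕ) :
    Compatible X Y p q a cX (fun σ => if a ∈ σ then cX {p, q} else cX σ) :=
  ⟨fun σ hσ _ => by simp [hσ], by simp, by simp, by simp⟩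

/-- The edge `{p, q}` gets the colour of the new vertex. As this has degree two, both halves of the
edge have that colour. -/
theorem compatible_of_new (h : EdgeSubdivision X Y p q a) (hY : ArcColoring Y cY j) :
    Compatible X Y p q a (fun σ => if σ = {p, q} then cY {a} else cY σ) cY := by
  have ha : {a} ∈ Y := by
    have := (h.pair_mem a).2 (Or.inl rfl)
    simpa using this
  have hv : ∀ y ∈ cofaceVertices Y {a}, cY {y, a} = cY {a} := by
    rcases hY.vertex a ha with hv | hv
    · exact hv.2
    · rw [h.ncard_new] at hv
      omega
  rw [h.cofaceVertices_new] at hv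
  refine ⟨fun σ _ hσ => by simp [hσ], by simp, ?_, ?_⟩
  · rw [Finset.pair_comm, hv p (by simp)]; simp
  · rw [Finset.pair_comm, hv q (by simp)]; simp

theorem isArcGraph_iff (h : EdgeSubdivision X Y p q a) (k j : ℕ) :
    IsArcGraph X k j ↔ IsArcGraph Y k j := by
  have hXn : X.faces.Nonempty := ⟨_, h.mem⟩
  have hYn : Y.faces.Nonempty := ⟨_, (h.pair_mem a).2 (Or.inl rfl)⟩
  rw [IsArcGraph, IsArcGraph, h.trivalentVertices_eq]
  simp only [hXn, hYn, true_and]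
  refine and_congr_right fun _ => ⟨?_, ?_⟩
  · rintro ⟨col, hcol, h0⟩
    have hc := compatible_of_old X Y p q a col
    refine ⟨_, hc.forward h hcol, fun hk e he e' he' h2 h2' => ?_⟩
    obtain ⟨x, y, y', hxa, rfl, hy, hy', hh⟩ := h.exists_old_edge he h2
    obtain ⟨x₁, y₁, y₁', hxa₁, rfl, hy₁, hy₁', hh₁⟩ := h.exists_old_edge he' h2'
    rw [← hc.pair hxa hh, ← hc.pair hxa₁ hh₁]
    exact h0 hk _ (mem_cofaceVertices_singleton.1 hy').2 _ (mem_cofaceVertices_singleton.1 hy₁').2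
      (Finset.card_pair (mem_cofaceVertices_singleton.1 hy').1)
      (Finset.card_pair (mem_cofaceVertices_singleton.1 hy₁').1)
  · rintro ⟨col, hcol, h0⟩
    have hc := h.compatible_of_new hcol
    refine ⟨_, hc.backward h hcol, fun hk e he e' he' h2 h2' => ?_⟩
    obtain ⟨x, y, y', hxa, rfl, hy, hy', hh⟩ := h.exists_new_edge he h2
    obtain ⟨x₁, y₁, y₁', hxa₁, rfl, hy₁, hy₁', hh₁⟩ := h.exists_new_edge he' h2'
    rw [hc.pair hxa hh, hc.pair hxa₁ hh₁]
    exact h0 hk _ (mem_cofaceVertices_singleton.1 hy).2 _ (mem_cofaceVertices_singleton.1 hy₁).2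
      (Finset.card_pair (mem_cofaceVertices_singleton.1 hy).1)
      (Finset.card_pair (mem_cofaceVertices_singleton.1 hy₁).1)

end EdgeSubdivision

theorem IsArcGraph.card_le {X : PreAbstractSimplicialComplex ℕ} {k j : ℕ} (h : IsArcGraph X k j) :
    ∀ σ ∈ X, σ.card ≤ 2 := by
  obtain ⟨-, -, col, h, -⟩ := h
  exact h.card_le

/-- A stellar move on a graph takes place at a vertex, which is a renaming, or at an edge. It
preserves the dimension, so that if `X` is not a graph both sides are false. -/
theorem StellarStep.isArcGraph_iff {X Y : PreAbstractSimplicialComplex ℕ}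
    (h : StellarStep X Y) (k j : ℕ) : IsArcGraph X k j ↔ IsArcGraph Y k j := by
  obtain ⟨A, a, h⟩ := h.exists_stellarAt
  by_cases hX : ∀ σ ∈ X, σ.card ≤ 2
  · have h1 : 0 < A.card := Finset.card_pos.2 (nonempty_of_mem h.mem)
    have h2 := hX A h.mem
    rcases (show A.card = 1 ∨ A.card = 2 by omega) with hA | hA
    · obtain ⟨p, rfl⟩ := Finset.card_eq_one.1 hA
      constructor
      · intro h'
        rw [h.eq_map_swap] at h'
        exact h'.of_map (Equiv.injective _).injOn
      · intro h'
        rw [h.map_swap] at h'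
        exact h'.of_map (Equiv.injective _).injOn
    · obtain ⟨p, q, hpq, rfl⟩ := Finset.card_eq_two.1 hA
      exact (h.edgeSubdivision hpq hX).isArcGraph_iff k j
  · exact iff_of_false (fun h' => hX h'.card_le)
      (fun h' => hX ((h.card_le_iff 2).2 h'.card_le))

theorem PLHomeomorphic.isArcGraph {X Y : PreAbstractSimplicialComplex ℕ} {k j : ℕ}
    (h : PLHomeomorphic X Y) (hY : IsArcGraph Y k j) : IsArcGraph X k j := by
  obtain ⟨f, hf, h⟩ := h
  exact ((iff_of_eqvGen_stellarStep (fun Z W hs => hs.isArcGraph_iff k j) h).2 hY).of_map hf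

end

/-! ### The model links -/

noncomputable section

open PreAbstractSimplicialComplex

/-- The neighbours of `x` in the graph with the set `F` of vertices and edges. -/
abbrev neighborFinset (F : Finset (Finset ℕ)) (m x : ℕ) : Finset ℕ :=
  (Finset.range m).filter fun y => y ≠ x ∧ {y, x} ∈ F

/-- Brings the conditions into a form that `decide` can settle on an explicit list of simplices. The
hypothesis `hc` stands in for connectedness: in the models two segments of the same colour coincide
or meet at a vertex of degree two. -/
theorem isArcGraph_of_finset {X : PreAbstractSimplicialComplex ℕ} {F : Finset (Finset ℕ)}
    {m k j : ℕ} (col : Finset ℕ → Finset ℕ) (hF : ∀ σ, σ ∈ X ↔ σ ∈ F)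
    (hm : ∀ σ ∈ F, σ ⊆ Finset.range m ∧ σ.card ≤ 2) (hne : F.Nonempty)
    (hv : ∀ x ∈ Finset.range m,
      ((neighborFinset F m x).card = 2 ∧ ∀ y ∈ neighborFinset F m x, col {y, x} = col {x}) ∨
      ((neighborFinset F m x).card = 3 ∧ ∀ y ∈ neighborFinset F m x,
        ∀ z ∈ neighborFinset F m x, col {y, x} = col {z, x} → y = z))
    (hk : ((Finset.range m).filter fun x => (neighborFinset F m x).card = 3).card = k)
    (he : ∀ e ∈ F, e.card = 2 → ((Finset.range m).filter fun x =>
      (neighborFinset F m x).card = 3 ∧ ∃ y ∈ neighborFinset F m x, col {y, x} = col e).card = j)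
    (hc : ∀ e ∈ F, ∀ e' ∈ F, e.card = 2 → e'.card = 2 → col e = col e' →
      e = e' ∨ ∃ x ∈ e, x ∈ e' ∧ (neighborFinset F m x).card = 2)
    (h0 : k = 0 → ∀ e ∈ F, ∀ e' ∈ F, e.card = 2 → e'.card = 2 → col e = col e') :
    IsArcGraph X k j := by
  have hN : ∀ x, cofaceVertices X {x} = neighborFinset F m x := fun x => by
    ext y
    rw [mem_cofaceVertices_singleton, hF, Finset.mem_coe, Finset.mem_filter]
    refine ⟨fun h => ⟨(hm _ h.2).1 (by simp), h⟩, fun h => h.2⟩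
  have hN' : ∀ x, (cofaceVertices X {x}).ncard = (neighborFinset F m x).card := fun x => by
    rw [hN, Set.ncard_coe_finset]
  have hmem : ∀ x, (neighborFinset F m x).card = 3 → x ∈ Finset.range m := fun x hx => by
    obtain ⟨y, hy⟩ : (neighborFinset F m x).Nonempty := Finset.card_pos.1 (by omega)
    exact (hm _ (Finset.mem_filter.1 hy).2.2).1 (by simp)
  refine ⟨hne.imp fun σ hσ => (hF σ).2 hσ, ?_, col,
    ⟨fun σ hσ => (hm σ ((hF σ).1 hσ)).2, fun x hx => ?_, fun e heX he2 => ?_,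
      fun S hS e heX e' heX' h2 h2' hee heS => ?_⟩, ?_⟩
  · rw [← hk, ← Set.ncard_coe_finset]
    congr 1
    ext x
    simp only [trivalentVertices, hN', Finset.coe_filter, Set.mem_ofPred_eq]
    exact ⟨fun h => ⟨hmem x h, h⟩, fun h => h.2⟩
  · simp only [hN, Set.ncard_coe_finset, Finset.mem_coe]
    exact hv x ((hm _ ((hF _).1 hx)).1 (by simp))
  · rw [← he e ((hF e).1 heX) he2, ← Set.ncard_coe_finset]
    congr 1
    ext x
    rw [Finset.mem_coe, Finset.mem_filter, Set.mem_ofPred_eq, trivalentVertices, Set.mem_ofPred_eq,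
      hN']
    simp only [hN, Finset.mem_coe]
    exact ⟨fun h => ⟨hmem x h.1, h⟩, fun h => h.2⟩
  · rcases hc e ((hF e).1 heX) e' ((hF e').1 heX') h2 h2' hee with rfl | ⟨x, hx, hx', hx2⟩
    · exact heS
    · have key : ∀ e ∈ X, e.card = 2 → x ∈ e → ({x} ∈ S ↔ e ∈ S) := by
        intro e heX h2 hx
        obtain ⟨y, hy⟩ : ∃ y, y ≠ x ∧ e = {y, x} := by
          obtain ⟨u, v, huv, rfl⟩ := Finset.card_eq_two.1 h2
          rcases Finset.mem_insert.1 hx with rfl | hx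
          · exact ⟨v, huv.symm, Finset.pair_comm _ _⟩
          · rw [Finset.mem_singleton] at hx
            subst hx
            exact ⟨u, huv, rfl⟩
        rw [hy.2]
        exact hS x ((hN' x).trans hx2) y (mem_cofaceVertices_singleton.2 ⟨hy.1, hy.2 ▸ heX⟩)
      exact (key _ heX' h2' hx').1 ((key _ heX h2 hx).2 heS)
  · simpa only [hF] using h0

theorem isArcGraph_stdSphereComplex : IsArcGraph (stdSphereComplex 1) 0 0 :=
  isArcGraph_of_finset (F := {{0}, {1}, {2}, {0, 1}, {0, 2}, {1, 2}}) (m := 3) (fun _ => ∅)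
    (fun σ => by
      have h : (Finset.range 3).powerset.filter (fun σ : Finset ℕ => σ.Nonempty ∧ σ ≠ Finset.range 3) =
          {{0}, {1}, {2}, {0, 1}, {0, 2}, {1, 2}} := by decide
      rw [← h, Finset.mem_filter, Finset.mem_powerset]
      change σ.Nonempty ∧ σ ⊂ Finset.range 3 ↔ _
      rw [Finset.ssubset_iff_subset_ne]
      tauto)
    (by decide) (by decide) (by decide) (by decide) (by decide) (by decide) (by simp)

theorem isArcGraph_thetaComplex : IsArcGraph thetaComplex 2 2 :=
  isArcGraph_of_finset (m := 5)
    (F := {{0}, {1}, {2}, {3}, {4}, {0, 2}, {0, 3}, {0, 4}, {1, 2}, {1, 3}, {1, 4}})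
    -- A segment is coloured by the middle vertex of its arc. The colour of the vertices `0` and
    -- `1`, which have degree three, does not matter.
    (fun σ => σ ∩ {2, 3, 4})
    (fun σ => by
      have h : (Finset.range 5).powerset.filter (fun σ : Finset ℕ => σ.Nonempty ∧
          ∃ i ∈ ({0, 1} : Finset ℕ), ∃ j ∈ ({2, 3, 4} : Finset ℕ), σ ⊆ {i, j}) =
          {{0}, {1}, {2}, {3}, {4}, {0, 2}, {0, 3}, {0, 4}, {1, 2}, {1, 3}, {1, 4}} := by decide
      rw [← h, Finset.mem_filter, Finset.mem_powerset]
      change σ.Nonempty ∧ (∃ i j : ℕ, i < 2 ∧ 2 ≤ j ∧ j < 5 ∧ σ ⊆ {i, j}) ↔ _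
      constructor
      · rintro ⟨h, i, j, hi, hj, hj', hs⟩
        refine ⟨hs.trans ?_, h, i, by simp; omega, j, by simp; omega, hs⟩
        intro x hx
        simp only [Finset.mem_insert, Finset.mem_singleton, Finset.mem_range] at *
        omega
      · rintro ⟨-, h, i, hi, j, hj, hs⟩
        simp only [Finset.mem_insert, Finset.mem_singleton] at hi hj
        exact ⟨h, i, j, by omega, by omega, by omega, hs⟩)
    (by decide) (by decide) (by decide) (by decide) (by decide) (by decide) (by simp)

/-- All four vertices have degree three, so each edge is an arc by itself and has a colour of its
own. -/
theorem isArcGraph_completeFourComplex : IsArcGraph completeFourComplex 4 2 :=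
  isArcGraph_of_finset (m := 4)
    (F := {{0}, {1}, {2}, {3}, {0, 1}, {0, 2}, {0, 3}, {1, 2}, {1, 3}, {2, 3}}) id
    (fun σ => by
      have h : (Finset.range 4).powerset.filter (fun σ : Finset ℕ => σ.Nonempty ∧ σ.card ≤ 2) =
          {{0}, {1}, {2}, {3}, {0, 1}, {0, 2}, {0, 3}, {1, 2}, {1, 3}, {2, 3}} := by decide
      rw [← h, Finset.mem_filter, Finset.mem_powerset]
      change σ.Nonempty ∧ σ ⊆ Finset.range 4 ∧ σ.card ≤ 2 ↔ _
      tauto)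
    (by decide) (by decide) (by decide) (by decide) (by decide)
    (fun _ _ _ _ _ _ h => Or.inl h) (by simp)

/-! ### Euler characteristics of balls and spheres -/

theorem eulerChar_stdSimplexComplex (n : ℕ) : eulerChar (stdSimplexComplex n).faces = 1 := by
  have h : (stdSimplexComplex n).faces = ↑((Finset.range (n + 1)).powerset.erase ∅) := by
    ext σ
    change σ.Nonempty ∧ _ ↔ _
    rw [Finset.mem_coe, Finset.mem_erase, Finset.mem_powerset, Finset.nonempty_iff_ne_empty]
  have h0 := Finset.sum_powerset_neg_one_pow_card_of_nonempty
    (x := Finset.range (n + 1)) (by simp)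
  rw [← Finset.sum_erase_add _ _ (Finset.empty_mem_powerset _)] at h0
  rw [eulerChar, h, finsum_mem_coe_finset]
  simp only [pow_succ, ← Finset.sum_mul]
  simp only [Finset.card_empty, pow_zero] at h0
  linarith

theorem stdSimplexComplex_finite (n : ℕ) : (stdSimplexComplex n).faces.Finite :=
  (Finset.range (n + 1)).powerset.finite_toSet.subset fun _ h => Finset.mem_powerset.2 h.2

theorem eulerChar_stdSphereComplex (n : ℕ) : eulerChar (stdSphereComplex n).faces =
    1 + (-1) ^ n := by
  have h : (stdSphereComplex n).faces =
      ↑(((Finset.range (n + 2)).powerset.erase ∅).erase (Finset.range (n + 2))) := by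
    ext σ
    change σ.Nonempty ∧ σ ⊂ Finset.range (n + 2) ↔ _
    rw [Finset.mem_coe, Finset.mem_erase, Finset.mem_erase, Finset.mem_powerset,
      Finset.nonempty_iff_ne_empty, Finset.ssubset_iff_subset_ne]
    tauto
  have h0 := Finset.sum_powerset_neg_one_pow_card_of_nonempty
    (x := Finset.range (n + 2)) (by simp)
  rw [← Finset.sum_erase_add _ _ (Finset.empty_mem_powerset _),
    ← Finset.sum_erase_add _ _ (a := Finset.range (n + 2)) (by simp)] at h0
  rw [eulerChar, h, finsum_mem_coe_finset]
  simp only [pow_succ, ← Finset.sum_mul]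
  simp only [Finset.card_empty, pow_zero, Finset.card_range, pow_succ] at h0
  linarith

end

noncomputable section

open PreAbstractSimplicialComplex

/-! ### Incidence numbers and the boundary map -/

theorem incidence_erase {τ : Finset ℕ} {v : ℕ} (hv : v ∈ τ) :
    incidence τ (τ.erase v) = (-1) ^ (τ.filter (· < v)).card := by
  unfold incidence
  rw [Finset.sum_eq_single v]
  · simp
  · intro w hw hwv
    rw [if_neg]
    intro h
    have : v ∈ τ.erase w := Finset.mem_erase.2 ⟨hwv.symm, hv⟩
    rw [h] at this
    exact Finset.notMem_erase v τ this
  · exact fun h => absurd hv h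

theorem exists_eq_erase_of_incidence_ne_zero {τ s : Finset ℕ} (h : incidence τ s ≠ 0) :
    ∃ v ∈ τ, τ.erase v = s := by
  by_contra! hc
  exact h (Finset.sum_eq_zero fun v hv => if_neg (hc v hv))

theorem incidence_ne_zero_iff {τ s : Finset ℕ} :
    incidence τ s ≠ 0 ↔ s ⊆ τ ∧ τ.card = s.card + 1 := by
  constructor
  · intro h
    obtain ⟨v, hv, rfl⟩ := exists_eq_erase_of_incidence_ne_zero h
    exact ⟨Finset.erase_subset _ _, (Finset.card_erase_add_one hv).symm⟩
  · rintro ⟨hs, hc⟩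
    obtain ⟨v, hv⟩ : ∃ v, τ \ s = {v} := Finset.card_eq_one.1 (by
      rw [Finset.card_sdiff_of_subset hs]; omega)
    have hvm : v ∈ τ \ s := by rw [hv]; simp
    have : τ.erase v = s := by
      rw [Finset.erase_eq, ← hv, Finset.sdiff_sdiff_eq_self hs]
    rw [← this, incidence_erase (Finset.mem_sdiff.1 hvm).1]
    exact pow_ne_zero _ (by norm_num)

theorem incidence_mul_self {τ s : Finset ℕ} (hs : s ⊆ τ) (hc : τ.card = s.card + 1) :
    incidence τ s * incidence τ s = 1 := by
  obtain ⟨v, hv, rfl⟩ :=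
    exists_eq_erase_of_incidence_ne_zero (incidence_ne_zero_iff.2 ⟨hs, hc⟩)
  rw [incidence_erase hv, ← pow_add, ← two_mul, pow_mul]
  norm_num

theorem incidence_eq_zero {τ s : Finset ℕ} (h : ¬ (s ⊆ τ ∧ τ.card = s.card + 1)) :
    incidence τ s = 0 := by
  by_contra h'
  exact h (incidence_ne_zero_iff.1 h')

theorem card_filter_erase_lt {τ : Finset ℕ} {v w : ℕ} (hvw : v < w) (hv : v ∈ τ) :
    ((τ.erase v).filter (· < w)).card + 1 = (τ.filter (· < w)).card := by
  rw [Finset.filter_erase, Finset.card_erase_add_one]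
  simp [hv, hvw]

theorem card_filter_erase_of_le {τ : Finset ℕ} {v w : ℕ} (hvw : w ≤ v) :
    ((τ.erase v).filter (· < w)).card = (τ.filter (· < w)).card := by
  congr 1
  ext x
  simp only [Finset.mem_filter, Finset.mem_erase]
  constructor
  · exact fun h => ⟨h.1.2, h.2⟩
  · exact fun h => ⟨⟨by omega, h.1⟩, h.2⟩

/-- The faces of codimension two are cancelled in the boundary of the boundary. -/
theorem sum_incidence_erase (τ s : Finset ℕ) :
    ∑ v ∈ τ, (-1) ^ (τ.filter (· < v)).card * incidence (τ.erase v) s = 0 := by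
  unfold incidence
  simp only [Finset.mul_sum]
  rw [Finset.sum_sigma']
  refine Finset.sum_involution (fun p _ => ⟨p.2, p.1⟩) ?_ ?_ ?_ ?_
  · rintro ⟨v, w⟩ h
    obtain ⟨hv, hwv, hw⟩ : v ∈ τ ∧ w ≠ v ∧ w ∈ τ := by simpa using h
    dsimp only
    rw [Finset.erase_right_comm]
    split_ifs with hs
    · rcases lt_or_gt_of_ne hwv with hlt | hlt
      · rw [card_filter_erase_of_le hlt.le, ← card_filter_erase_lt hlt hw, pow_succ]
        ring
      · rw [card_filter_erase_of_le hlt.le, ← card_filter_erase_lt hlt hv, pow_succ]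
        ring
    · ring
  · rintro ⟨v, w⟩ h _ h'
    have : w ≠ v := by
      have := h
      simp only [Finset.mem_sigma, Finset.mem_erase] at this
      exact this.2.1
    exact this (congrArg Sigma.fst h')
  · rintro ⟨v, w⟩ h
    simp only [Finset.mem_sigma, Finset.mem_erase] at h ⊢
    exact ⟨h.2.2, h.2.1.symm, h.1⟩
  · rintro ⟨v, w⟩ _
    rfl

/-- Nonemptiness of `s` is essential: `incidence` counts the empty set as a face of a vertex,
whereas `chainBoundary` does not. -/
theorem chainBoundary_apply (z : Finset ℕ →₀ ℚ) {s : Finset ℕ} (hs : s.Nonempty) :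
    chainBoundary z s = z.sum fun τ c => c * incidence τ s := by
  unfold chainBoundary
  rw [Finsupp.lsum_apply, Finsupp.sum_apply]
  refine Finsupp.sum_congr fun τ _ => ?_
  rw [LinearMap.toSpanSingleton_apply, Finsupp.smul_apply, Finsupp.finsetSum_apply, smul_eq_mul,
    incidence, Int.cast_sum, Finset.sum_filter]
  congr 1
  refine Finset.sum_congr rfl fun v _ => ?_
  by_cases h : τ.erase v = s
  · simp [h, hs]
  · rw [if_neg h]
    split_ifs
    · rw [Finsupp.single_apply, if_neg h]; simp
    · simp

theorem chainBoundary_apply_empty (z : Finset ℕ →₀ ℚ) : chainBoundary z ∅ = 0 := by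
  unfold chainBoundary
  rw [Finsupp.lsum_apply, Finsupp.sum_apply]
  refine Finset.sum_eq_zero fun τ _ => ?_
  dsimp only
  rw [LinearMap.toSpanSingleton_apply, Finsupp.smul_apply, Finsupp.finsetSum_apply]
  rw [Finset.sum_eq_zero, smul_zero]
  intro v hv
  rw [Finsupp.single_apply, if_neg]
  exact (Finset.mem_filter.1 hv).2.ne_empty

theorem chainBoundary_single_apply (τ : Finset ℕ) (c : ℚ) {s : Finset ℕ} (hs : s.Nonempty) :
    chainBoundary (Finsupp.single τ c) s = c * incidence τ s := by
  rw [chainBoundary_apply _ hs, Finsupp.sum_single_index (by simp)]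

theorem chainBoundary_single (τ : Finset ℕ) (c : ℚ) : chainBoundary (Finsupp.single τ c) =
    c • ∑ v ∈ τ with (τ.erase v).Nonempty,
      Finsupp.single (τ.erase v) ((-1 : ℚ) ^ (τ.filter (· < v)).card) := by
  unfold chainBoundary
  rw [Finsupp.lsum_single, LinearMap.toSpanSingleton_apply]

theorem chainBoundary_chainBoundary (z : Finset ℕ →₀ ℚ) :
    chainBoundary (chainBoundary z) = 0 := by
  induction z using Finsupp.induction_linear with
  | zero => simp
  | add f g hf hg => rw [map_add, map_add, hf, hg, add_zero]
  | single τ c =>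
    ext s
    rcases s.eq_empty_or_nonempty with rfl | hs
    · rw [chainBoundary_apply_empty]; rfl
    rw [chainBoundary_single, map_smul, map_sum, Finsupp.smul_apply, Finsupp.finsetSum_apply]
    have : ∑ v ∈ τ with (τ.erase v).Nonempty, chainBoundary (Finsupp.single (τ.erase v)
        ((-1 : ℚ) ^ (τ.filter (· < v)).card)) s =
        ∑ v ∈ τ, (-1 : ℚ) ^ (τ.filter (· < v)).card * incidence (τ.erase v) s := by
      rw [Finset.sum_filter]
      refine Finset.sum_congr rfl fun v _ => ?_
      split_ifs with h
      · rw [chainBoundary_single_apply _ _ hs]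
      -- Here `τ` is a single vertex. The empty face, which the boundary leaves out, would
      -- contribute nothing to the right-hand side either, as `incidence ∅ s = 0`.
      · rw [Finset.not_nonempty_iff_eq_empty.1 h]
        simp [incidence]
    rw [this]
    have := congrArg (fun n : ℤ => (n : ℚ)) (sum_incidence_erase τ s)
    push_cast at this
    rw [this, smul_zero]; rfl

/-! ### Chains, cycles and boundaries -/

theorem mem_simplicialChains {K : PreAbstractSimplicialComplex ℕ} {k : ℕ} {z : Finset ℕ →₀ ℚ} :
    z ∈ simplicialChains K k ↔ ∀ σ, z σ ≠ 0 → σ ∈ K ∧ σ.card = k + 1 := by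
  rw [simplicialChains, Finsupp.mem_supported]
  simp only [Set.subset_def, Finset.mem_coe, Finsupp.mem_support_iff, Set.mem_ofPred_eq]

theorem chainBoundary_mem {K : PreAbstractSimplicialComplex ℕ} {k : ℕ} {z : Finset ℕ →₀ ℚ}
    (hz : z ∈ simplicialChains K (k + 1)) : chainBoundary z ∈ simplicialChains K k := by
  rw [mem_simplicialChains] at hz ⊢
  intro s hs
  have hsn : s.Nonempty := by
    rw [Finset.nonempty_iff_ne_empty]
    rintro rfl
    exact hs (chainBoundary_apply_empty z)
  rw [chainBoundary_apply z hsn] at hs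
  obtain ⟨τ, hτ, h⟩ := Finset.exists_ne_zero_of_sum_ne_zero hs
  have hi : incidence τ s ≠ 0 := fun h' => h (by simp [h'])
  have hzτ := hz τ (Finsupp.mem_support_iff.1 hτ)
  have := incidence_ne_zero_iff.1 hi
  exact ⟨mem_of_subset hzτ.1 this.1 hsn, by omega⟩

theorem chainBoundary_eq_zero_of_mem_zero {K : PreAbstractSimplicialComplex ℕ}
    {z : Finset ℕ →₀ ℚ} (hz : z ∈ simplicialChains K 0) : chainBoundary z = 0 := by
  rw [mem_simplicialChains] at hz
  ext s
  rcases s.eq_empty_or_nonempty with rfl | hs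
  · rw [chainBoundary_apply_empty]; rfl
  rw [chainBoundary_apply z hs]
  refine Finset.sum_eq_zero fun τ hτ => ?_
  have := (hz τ (Finsupp.mem_support_iff.1 hτ)).2
  have := hs.card_pos
  dsimp only
  rw [incidence_eq_zero (by omega), Int.cast_zero, mul_zero]

theorem simplicialBoundaries_le (K : PreAbstractSimplicialComplex ℕ) (k : ℕ) :
    simplicialBoundaries K k ≤ simplicialCycles K k := by
  rintro _ ⟨y, hy, rfl⟩
  exact ⟨chainBoundary_mem hy, chainBoundary_chainBoundary y⟩

section finrank

variable {K : PreAbstractSimplicialComplex ℕ}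

theorem finite_simplicialChains (hK : K.faces.Finite) (k : ℕ) :
    Module.Finite ℚ (simplicialChains K k) := by
  have : Finite {σ | σ ∈ K ∧ σ.card = k + 1} := (hK.subset fun _ h => h.1).to_subtype
  exact Module.Finite.equiv (Finsupp.supportedEquivFinsupp (M := ℚ) (R := ℚ)
    {σ | σ ∈ K ∧ σ.card = k + 1}).symm

theorem finrank_simplicialChains (hK : K.faces.Finite) (k : ℕ) :
    Module.finrank ℚ (simplicialChains K k) = {σ | σ ∈ K ∧ σ.card = k + 1}.ncard := by
  have hf : Finite {σ | σ ∈ K ∧ σ.card = k + 1} := (hK.subset fun _ h => h.1).to_subtype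
  have := Fintype.ofFinite {σ | σ ∈ K ∧ σ.card = k + 1}
  rw [simplicialChains, (Finsupp.supportedEquivFinsupp (M := ℚ) (R := ℚ)
    {σ | σ ∈ K ∧ σ.card = k + 1}).finrank_eq, Module.finrank_finsupp_self,
    ← Nat.card_eq_fintype_card, Nat.card_coe_set_eq]

theorem finite_simplicialCycles (hK : K.faces.Finite) (k : ℕ) :
    Module.Finite ℚ (simplicialCycles K k) :=
  have := finite_simplicialChains hK k
  Submodule.finiteDimensional_of_le (inf_le_left : simplicialCycles K k ≤ simplicialChains K k)

/-- Rank-nullity for the boundary map restricted to the chains of one degree. -/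
theorem finrank_chains_succ (hK : K.faces.Finite) (k : ℕ) :
    Module.finrank ℚ (simplicialChains K (k + 1)) =
      Module.finrank ℚ (simplicialCycles K (k + 1)) +
        Module.finrank ℚ (simplicialBoundaries K k) := by
  have := finite_simplicialChains hK (k + 1)
  have h := LinearMap.finrank_range_add_finrank_ker
    (chainBoundary.domRestrict (simplicialChains K (k + 1)))
  rw [LinearMap.range_domRestrict] at h
  have e : LinearMap.ker (chainBoundary.domRestrict (simplicialChains K (k + 1))) =
      (simplicialCycles K (k + 1)).submoduleOf (simplicialChains K (k + 1)) := by
    ext z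
    simp [Submodule.submoduleOf, simplicialCycles, LinearMap.domRestrict_apply]
  have hle : simplicialCycles K (k + 1) ≤ simplicialChains K (k + 1) := inf_le_left
  rw [e, (Submodule.submoduleOfEquivOfLe hle).finrank_eq] at h
  rw [← h, add_comm]; rfl

theorem finrank_simplicialHomology (hK : K.faces.Finite) (k : ℕ) :
    Module.finrank ℚ (SimplicialHomology K k) + Module.finrank ℚ (simplicialBoundaries K k) =
      Module.finrank ℚ (simplicialCycles K k) := by
  have := finite_simplicialCycles hK k
  rw [← Submodule.finrank_quotient_add_finrank
    ((simplicialBoundaries K k).submoduleOf (simplicialCycles K k)),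
    (Submodule.submoduleOfEquivOfLe (simplicialBoundaries_le K k)).finrank_eq]

theorem simplicialCycles_zero : simplicialCycles K 0 = simplicialChains K 0 :=
  inf_eq_left.2 fun _ hz => chainBoundary_eq_zero_of_mem_zero hz

theorem simplicialChains_eq_bot {n : ℕ} (hn : ∀ σ ∈ K, σ.card ≤ n) {k : ℕ} (hk : n ≤ k) :
    simplicialChains K k = ⊥ := by
  rw [eq_bot_iff]
  intro z hz
  rw [mem_simplicialChains] at hz
  rw [Submodule.mem_bot]
  ext σ
  by_contra h
  have := hz σ h
  have := hn σ this.1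
  omega

theorem finrank_homology_eq_zero {n : ℕ} (hn : ∀ σ ∈ K, σ.card ≤ n) {k : ℕ} (hk : n ≤ k)
    (hK : K.faces.Finite) : Module.finrank ℚ (SimplicialHomology K k) = 0 := by
  have h := finrank_simplicialHomology hK k
  have : Module.finrank ℚ (simplicialCycles K k) = 0 := by
    rw [simplicialCycles, simplicialChains_eq_bot hn hk, bot_inf_eq, finrank_bot]
  omega

theorem finrank_boundaries_eq_zero {n : ℕ} (hn : ∀ σ ∈ K, σ.card ≤ n) {k : ℕ} (hk : n ≤ k + 1) :
    Module.finrank ℚ (simplicialBoundaries K k) = 0 := by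
  rw [simplicialBoundaries, simplicialChains_eq_bot hn hk, Submodule.map_bot, finrank_bot]

end finrank

theorem eulerChar_eq_sum_range {S : Set (Finset ℕ)} (hS : S.Finite) {n : ℕ}
    (hn : ∀ σ ∈ S, σ.Nonempty ∧ σ.card ≤ n) :
    eulerChar S = ∑ k ∈ Finset.range n, (-1) ^ k * ({σ | σ ∈ S ∧ σ.card = k + 1}.ncard : ℤ) := by
  classical
  rw [eulerChar, finsum_mem_eq_finite_toFinset_sum _ hS,
    ← Finset.sum_fiberwise_of_maps_to (g := fun σ => σ.card - 1) (t := Finset.range n)]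
  · refine Finset.sum_congr rfl fun k _ => ?_
    have : {σ | σ ∈ S ∧ σ.card = k + 1} =
        ((hS.toFinset.filter fun σ => σ.card - 1 = k : Finset (Finset ℕ)) : Set (Finset ℕ)) := by
      ext σ
      simp only [Set.mem_ofPred_eq, Finset.coe_filter, Set.Finite.mem_toFinset]
      refine and_congr_right fun h => ?_
      have := (hn σ h).1.card_pos
      omega
    rw [this, Set.ncard_coe_finset, Finset.sum_congr rfl (g := fun _ => (-1 : ℤ) ^ k)]
    · rw [Finset.sum_const, nsmul_eq_mul, mul_comm]
    · intro σ hσ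
      rw [Finset.mem_filter, hS.mem_toFinset] at hσ
      have := (hn σ hσ.1).1.card_pos
      rw [show σ.card + 1 = k + 2 by omega, pow_add]
      ring
  · intro σ hσ
    have := hn σ (hS.mem_toFinset.1 hσ)
    have := this.1.card_pos
    rw [Finset.mem_range]
    omega

/-- The Euler-Poincaré formula in dimension three. -/
theorem eulerChar_eq_betti {K : PreAbstractSimplicialComplex ℕ} (hK : K.faces.Finite)
    (h4 : ∀ σ ∈ K, σ.card ≤ 4) :
    eulerChar K.faces = Module.finrank ℚ (SimplicialHomology K 0) -
      Module.finrank ℚ (SimplicialHomology K 1) + Module.finrank ℚ (SimplicialHomology K 2) -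
      Module.finrank ℚ (SimplicialHomology K 3) := by
  rw [eulerChar_eq_sum_range hK fun σ h => ⟨nonempty_of_mem h, h4 σ h⟩]
  simp only [Finset.sum_range_succ, Finset.sum_range_zero]
  change 0 + (-1) ^ 0 * ({σ | σ ∈ K ∧ σ.card = 0 + 1}.ncard : ℤ) +
    (-1) ^ 1 * ({σ | σ ∈ K ∧ σ.card = 1 + 1}.ncard : ℤ) +
    (-1) ^ 2 * ({σ | σ ∈ K ∧ σ.card = 2 + 1}.ncard : ℤ) +
    (-1) ^ 3 * ({σ | σ ∈ K ∧ σ.card = 3 + 1}.ncard : ℤ) = _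
  rw [← finrank_simplicialChains hK 0, ← finrank_simplicialChains hK 1,
    ← finrank_simplicialChains hK 2, ← finrank_simplicialChains hK 3]
  have h0 := finrank_simplicialHomology hK 0
  have h1 := finrank_simplicialHomology hK 1
  have h2 := finrank_simplicialHomology hK 2
  have h3 := finrank_simplicialHomology hK 3
  have c1 := finrank_chains_succ hK 0
  have c2 := finrank_chains_succ hK 1
  have c3 := finrank_chains_succ hK 2
  have b3 := finrank_boundaries_eq_zero h4 (k := 3) le_rfl
  have c0 : Module.finrank ℚ (simplicialCycles K 0) = Module.finrank ℚ (simplicialChains K 0) := by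
    rw [simplicialCycles_zero]
  simp only [Nat.reduceAdd] at c1 c2 c3
  push_cast
  omega

end

/-! ### Chains with prescribed coefficients -/

noncomputable section

open PreAbstractSimplicialComplex

theorem chainBoundary_apply_of_subset (z : Finset ℕ →₀ ℚ) {s : Finset ℕ} (hs : s.Nonempty)
    {F : Finset (Finset ℕ)} (hF : z.support ⊆ F) :
    chainBoundary z s = ∑ τ ∈ F, z τ * incidence τ s := by
  rw [chainBoundary_apply z hs]
  exact Finsupp.sum_of_support_subset _ hF _ (by simp)

open scoped Classical in
/-- The chain supported on the finite set `S` with the coefficients `g`. -/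
def chainOn {S : Set (Finset ℕ)} (hS : S.Finite) (g : Finset ℕ → ℚ) : Finset ℕ →₀ ℚ :=
  Finsupp.onFinset hS.toFinset (fun σ => if σ ∈ S then g σ else 0) fun σ h => by
    rw [Set.Finite.mem_toFinset]
    by_contra h'
    exact h (if_neg h')

theorem chainOn_apply_of_mem {S : Set (Finset ℕ)} (hS : S.Finite) (g : Finset ℕ → ℚ)
    {σ : Finset ℕ} (h : σ ∈ S) : chainOn hS g σ = g σ := by
  simp [chainOn, h]

theorem chainOn_apply_of_notMem {S : Set (Finset ℕ)} (hS : S.Finite) (g : Finset ℕ → ℚ)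
    {σ : Finset ℕ} (h : σ ∉ S) : chainOn hS g σ = 0 := by
  simp [chainOn, h]

theorem chainBoundary_chainOn_apply {S : Set (Finset ℕ)} (hS : S.Finite) (g : Finset ℕ → ℚ)
    {s : Finset ℕ} (hs : s.Nonempty) :
    chainBoundary (chainOn hS g) s = ∑ τ ∈ hS.toFinset, g τ * incidence τ s := by
  have hsub : (chainOn hS g).support ⊆ hS.toFinset := Finsupp.support_onFinset_subset
  rw [chainBoundary_apply_of_subset _ hs hsub]
  refine Finset.sum_congr rfl fun τ hτ => ?_
  rw [chainOn_apply_of_mem hS g (hS.mem_toFinset.1 hτ)]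

/-! ### Links and counting -/

theorem erase_mem_vertexLink {K : PreAbstractSimplicialComplex ℕ} {v : ℕ} {σ : Finset ℕ}
    (hσ : σ ∈ K) (hv : v ∈ σ) (h2 : 2 ≤ σ.card) : σ.erase v ∈ vertexLink K v := by
  refine ⟨Finset.card_pos.1 ?_, Finset.notMem_erase v σ, (Finset.insert_erase hv).symm ▸ hσ⟩
  have := Finset.card_erase_add_one hv
  omega

/-- Cofaces of `s` can be counted in the link of any vertex of `s`. This is how the hypotheses on
links give information about the complex itself. -/
theorem cofaceVertices_vertexLink {K : PreAbstractSimplicialComplex ℕ} {v : ℕ} {s : Finset ℕ}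
    (hv : v ∈ s) : cofaceVertices (vertexLink K v) (s.erase v) = cofaceVertices K s := by
  ext x
  change x ∉ s.erase v ∧ (_ ∧ v ∉ insert x (s.erase v) ∧ insert v (insert x (s.erase v)) ∈ K) ↔
    x ∉ s ∧ insert x s ∈ K
  rw [Finset.insert_comm, Finset.insert_erase hv]
  constructor
  · rintro ⟨h1, -, h2, h3⟩
    refine ⟨fun hx => h1 (Finset.mem_erase.2 ⟨?_, hx⟩), h3⟩
    rintro rfl
    exact h2 (Finset.mem_insert_self _ _)
  · rintro ⟨h1, h2⟩
    refine ⟨fun h => h1 (Finset.mem_of_mem_erase h), Finset.insert_nonempty _ _, ?_, h2⟩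
    rw [Finset.mem_insert]
    rintro (rfl | h)
    · exact h1 hv
    · exact Finset.notMem_erase v s h

theorem ncard_vertexLink_card {K : PreAbstractSimplicialComplex ℕ} (v k : ℕ) (hk : 0 < k) :
    {τ | τ ∈ vertexLink K v ∧ τ.card = k}.ncard =
      {σ | (σ ∈ K ∧ σ.card = k + 1) ∧ v ∈ σ}.ncard := by
  have hinj : Set.InjOn (fun τ => insert v τ) {τ | τ ∈ vertexLink K v ∧ τ.card = k} := by
    intro τ hτ τ' hτ' h
    have := congrArg (fun t => t.erase v) h
    simpa [Finset.erase_insert hτ.1.2.1, Finset.erase_insert hτ'.1.2.1] using this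
  rw [← hinj.ncard_image]
  congr 1
  ext σ
  constructor
  · rintro ⟨τ, ⟨hτ, hc⟩, rfl⟩
    exact ⟨⟨hτ.2.2, by rw [Finset.card_insert_of_notMem hτ.2.1, hc]⟩, Finset.mem_insert_self _ _⟩
  · rintro ⟨⟨hσ, hc⟩, hv⟩
    have := Finset.card_erase_add_one hv
    exact ⟨σ.erase v, ⟨erase_mem_vertexLink hσ hv (by omega), by omega⟩, Finset.insert_erase hv⟩

/-- Double counting of the incident pairs of a vertex and a simplex. -/
theorem sum_ncard_mem {S : Set (Finset ℕ)} (hS : S.Finite) {m : ℕ} (hm : ∀ σ ∈ S, σ.card = m)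
    {V : Finset ℕ} (hV : ∀ σ ∈ S, σ ⊆ V) :
    ∑ v ∈ V, {σ | σ ∈ S ∧ v ∈ σ}.ncard = m * S.ncard := by
  classical
  have h := Finset.sum_card_bipartiteAbove_eq_sum_card_bipartiteBelow (s := V) (t := hS.toFinset)
    (fun v σ => v ∈ σ)
  rw [Set.ncard_eq_toFinset_card _ hS]
  calc _ = ∑ v ∈ V, ((hS.toFinset).bipartiteAbove (fun v σ => v ∈ σ) v).card := by
        refine Finset.sum_congr rfl fun v _ => ?_
        rw [← Set.ncard_coe_finset]
        congr 1
        ext σ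
        simp [Finset.bipartiteAbove]
    _ = ∑ σ ∈ hS.toFinset, (V.bipartiteBelow (fun v σ => v ∈ σ) σ).card := h
    _ = ∑ σ ∈ hS.toFinset, m := by
        refine Finset.sum_congr rfl fun σ hσ => ?_
        rw [hS.mem_toFinset] at hσ
        rw [← hm σ hσ]
        congr 1
        ext v
        simp only [Finset.bipartiteBelow, Finset.mem_filter]
        exact and_iff_right_of_imp fun h => hV σ hσ h
    _ = _ := by simp [mul_comm]

/-- Double counting of the incident pairs of two simplices of consecutive dimensions. -/
theorem sum_ncard_cofaceVertices {K : PreAbstractSimplicialComplex ℕ} (hK : K.faces.Finite)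
    {d n : ℕ} (hd : 0 < d)
    (h : ∀ s ∈ K, s.card = d → (cofaceVertices K s).ncard = n) :
    {s | s ∈ K ∧ s.card = d}.ncard * n = {t | t ∈ K ∧ t.card = d + 1}.ncard * (d + 1) := by
  classical
  have hfs : {s | s ∈ K ∧ s.card = d}.Finite := hK.subset fun _ h => h.1
  have hft : {t | t ∈ K ∧ t.card = d + 1}.Finite := hK.subset fun _ h => h.1
  rw [Set.ncard_eq_toFinset_card _ hfs, Set.ncard_eq_toFinset_card _ hft]
  refine Finset.card_mul_eq_card_mul (fun s t => s ⊆ t) (fun s hs => ?_) fun t ht => ?_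
  · rw [hfs.mem_toFinset] at hs
    rw [← h s hs.1 hs.2, ← Set.ncard_coe_finset]
    have hinj : Set.InjOn (fun x => insert x s) (cofaceVertices K s) := by
      intro x hx y hy hxy
      have : x ∈ insert y s := by
        dsimp only at hxy
        exact hxy ▸ Finset.mem_insert_self x s
      exact (Finset.mem_insert.1 this).resolve_right hx.1
    rw [← hinj.ncard_image]
    congr 1
    ext t
    simp only [Finset.bipartiteAbove, Finset.coe_filter, Set.Finite.mem_toFinset, Set.mem_ofPred_eq,
      Set.mem_image]
    constructor
    · rintro ⟨⟨ht, hc⟩, hst⟩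
      obtain ⟨x, hx⟩ : ∃ x, t \ s = {x} := Finset.card_eq_one.1 (by
        have := hs.2
        rw [Finset.card_sdiff_of_subset hst]; omega)
      have hxm : x ∈ t \ s := by rw [hx]; simp
      have : insert x s = t := by
        rw [Finset.insert_eq, ← hx, Finset.sdiff_union_of_subset hst]
      exact ⟨x, ⟨(Finset.mem_sdiff.1 hxm).2, this ▸ ht⟩, this⟩
    · rintro ⟨x, hx, rfl⟩
      exact ⟨⟨hx.2, by rw [Finset.card_insert_of_notMem hx.1, hs.2]⟩, Finset.subset_insert _ _⟩
  · rw [hft.mem_toFinset] at ht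
    rw [← ht.2, ← Finset.card_image_of_injOn (s := t) (f := fun v => t.erase v)]
    · congr 1
      ext s
      simp only [Finset.bipartiteBelow, Finset.mem_filter, Set.Finite.mem_toFinset,
        Set.mem_ofPred_eq, Finset.mem_image]
      constructor
      · rintro ⟨⟨hs, hc⟩, hst⟩
        exact exists_eq_erase_of_incidence_ne_zero
          (incidence_ne_zero_iff.2 ⟨hst, by rw [ht.2, hc]⟩)
      · rintro ⟨v, hv, rfl⟩
        have hc := Finset.card_erase_add_one hv
        have := ht.2
        refine ⟨⟨mem_of_subset ht.1 (Finset.erase_subset _ _) (Finset.card_pos.1 ?_), ?_⟩,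
          Finset.erase_subset _ _⟩ <;> omega
    · intro v hv w _ h
      by_contra hne
      have : v ∈ t.erase w := Finset.mem_erase.2 ⟨hne, hv⟩
      dsimp only at h
      rw [← h] at this
      exact Finset.notMem_erase v t this

/-! ### Closed 3-manifolds: Euler characteristic and fundamental cycle -/

namespace IsClosedOrientableThreeManifold

variable {K : PreAbstractSimplicialComplex ℕ}

theorem card_le (hK : IsClosedOrientableThreeManifold K) : ∀ σ ∈ K, σ.card ≤ 4 := by
  intro σ hσ
  by_cases h2 : 2 ≤ σ.card
  · obtain ⟨v, hv⟩ := nonempty_of_mem hσ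
    have := ((hK.link_sphere v (singleton_mem_of_mem hσ hv)).isClosedPseudomanifold
      (isClosedPseudomanifold_stdSphereComplex 2)).1 _ (erase_mem_vertexLink hσ hv h2)
    have := Finset.card_erase_add_one hv
    omega
  · omega

theorem ncard_cofaceVertices (hK : IsClosedOrientableThreeManifold K) {s : Finset ℕ} (hs : s ∈ K)
    (h3 : s.card = 3) : (cofaceVertices K s).ncard = 2 := by
  obtain ⟨v, hv⟩ := nonempty_of_mem hs
  have hc := Finset.card_erase_add_one hv
  rw [← cofaceVertices_vertexLink hv]
  exact ((hK.link_sphere v (singleton_mem_of_mem hs hv)).isClosedPseudomanifold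
    (isClosedPseudomanifold_stdSphereComplex 2)).2 _ (erase_mem_vertexLink hs hv (by omega))
    (by omega)

/-- Let `F k` be the number of simplices with `k` vertices. Every link has Euler characteristic `2`,
and summing over the vertices gives `2 F 1 = 2 F 2 - 3 F 3 + 4 F 4`. Every triangle lies in two
tetrahedra, so `2 F 3 = 4 F 4`. Together these give `F 1 - F 2 + F 3 - F 4 = 0`. -/
theorem eulerChar_eq_zero (hK : IsClosedOrientableThreeManifold K) : eulerChar K.faces = 0 := by
  classical
  have hf := hK.finite
  set V : Finset ℕ := hf.toFinset.biUnion id with hV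
  have hsub : ∀ σ ∈ K, σ ⊆ V := fun σ hσ =>
    Finset.subset_biUnion_of_mem (u := id) (hf.mem_toFinset.2 hσ)
  have hVm : ∀ v ∈ V, {v} ∈ K := by
    intro v hv
    obtain ⟨σ, hσ, hvσ⟩ := Finset.mem_biUnion.1 hv
    exact singleton_mem_of_mem (hf.mem_toFinset.1 hσ) hvσ
  set F : ℕ → ℕ := fun k => {σ | σ ∈ K ∧ σ.card = k}.ncard with hF
  have hff : ∀ k, {σ | σ ∈ K ∧ σ.card = k}.Finite := fun k => hf.subset fun _ h => h.1
  have hcount : ∀ k : ℕ, ∑ v ∈ V, ({σ | (σ ∈ K ∧ σ.card = k) ∧ v ∈ σ}.ncard : ℤ) =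
      (k : ℤ) * (F k : ℤ) := fun k => by
    rw [← Nat.cast_mul, ← sum_ncard_mem (hff k) (fun σ h => h.2) fun σ h => hsub σ h.1,
      Nat.cast_sum]
    rfl
  have hlink : ∀ v ∈ V, (2 : ℤ) = ({σ | (σ ∈ K ∧ σ.card = 2) ∧ v ∈ σ}.ncard : ℤ) -
      {σ | (σ ∈ K ∧ σ.card = 3) ∧ v ∈ σ}.ncard + {σ | (σ ∈ K ∧ σ.card = 4) ∧ v ∈ σ}.ncard := by
    intro v hv
    obtain ⟨h1, h2⟩ := (hK.link_sphere v (hVm v hv)).finite_and_eulerChar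
      (stdSphereComplex_finite 2)
    rw [eulerChar_stdSphereComplex, eulerChar_eq_sum_range h1 (n := 3)] at h2
    · simp only [Finset.sum_range_succ, Finset.sum_range_zero] at h2
      rw [← ncard_vertexLink_card v 1 (by omega), ← ncard_vertexLink_card v 2 (by omega),
        ← ncard_vertexLink_card v 3 (by omega)]
      change 0 + (-1) ^ 0 * ({σ | σ ∈ vertexLink K v ∧ σ.card = 1}.ncard : ℤ) +
        (-1) ^ 1 * ({σ | σ ∈ vertexLink K v ∧ σ.card = 2}.ncard : ℤ) +
        (-1) ^ 2 * ({σ | σ ∈ vertexLink K v ∧ σ.card = 3}.ncard : ℤ) = _ at h2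
      linarith
    · intro τ hτ
      refine ⟨hτ.1, ?_⟩
      have := hK.card_le _ hτ.2.2
      rw [Finset.card_insert_of_notMem hτ.2.1] at this
      omega
  have hsum := Finset.sum_congr rfl hlink
  rw [Finset.sum_add_distrib, Finset.sum_sub_distrib, Finset.sum_const] at hsum
  have hVc : V.card = F 1 := by
    rw [hF, ← Set.ncard_coe_finset, ← Set.InjOn.ncard_image (f := fun v : ℕ => ({v} : Finset ℕ))
      Finset.singleton_injective.injOn]
    congr 1
    ext σ
    constructor
    · rintro ⟨v, hv, rfl⟩
      exact ⟨hVm v hv, Finset.card_singleton v⟩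
    · rintro ⟨hσ, hc⟩
      obtain ⟨v, rfl⟩ := Finset.card_eq_one.1 hc
      exact ⟨v, hsub _ hσ (Finset.mem_singleton_self v), rfl⟩
  have h34 := sum_ncard_cofaceVertices hf (d := 3) (n := 2) (by omega)
    fun s hs h3 => hK.ncard_cofaceVertices hs h3
  rw [eulerChar_eq_sum_range hf fun σ h => ⟨nonempty_of_mem h, hK.card_le σ h⟩]
  simp only [Finset.sum_range_succ, Finset.sum_range_zero]
  change 0 + (-1) ^ 0 * (F 1 : ℤ) + (-1) ^ 1 * (F 2 : ℤ) + (-1) ^ 2 * (F 3 : ℤ) +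
    (-1) ^ 3 * (F 4 : ℤ) = 0
  change F 3 * 2 = F 4 * 4 at h34
  zify at h34
  rw [hcount, hcount, hcount, hVc] at hsum
  simp only [nsmul_eq_mul, Nat.cast_ofNat] at hsum
  linarith

/-- The fundamental cycle. -/
theorem exists_cycle (hK : IsClosedOrientableThreeManifold K) :
    ∃ z ∈ simplicialCycles K 3, ∀ t ∈ K, t.card = 4 → z t ≠ 0 := by
  classical
  obtain ⟨o, ho⟩ := hK.orientable
  have hf : {t | t ∈ K ∧ t.card = 4}.Finite := hK.finite.subset fun _ h => h.1
  refine ⟨chainOn hf fun t => ((o t : ℤ) : ℚ), ⟨?_, ?_⟩, fun t ht h4 => ?_⟩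
  · rw [SetLike.mem_coe, mem_simplicialChains]
    intro σ hσ
    by_contra h
    exact hσ (chainOn_apply_of_notMem hf _ h)
  · rw [SetLike.mem_coe, LinearMap.mem_ker]
    ext s
    rcases s.eq_empty_or_nonempty with rfl | hs
    · exact chainBoundary_apply_empty _
    rw [chainBoundary_chainOn_apply hf _ hs]
    by_cases h : s ∈ K ∧ s.card = 3
    · obtain ⟨x, y, hxy, he⟩ := Set.ncard_eq_two.1 (hK.ncard_cofaceVertices h.1 h.2)
      have hx : x ∈ cofaceVertices K s := he ▸ by simp
      have hy : y ∈ cofaceVertices K s := he ▸ by simp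
      have hcx : (insert x s).card = 4 := by rw [Finset.card_insert_of_notMem hx.1, h.2]
      have hcy : (insert y s).card = 4 := by rw [Finset.card_insert_of_notMem hy.1, h.2]
      have hne : insert x s ≠ insert y s := fun h' => by
        have : x ∈ insert y s := h' ▸ Finset.mem_insert_self x s
        rcases Finset.mem_insert.1 this with h' | h'
        · exact hxy h'
        · exact hx.1 h'
      have := ho s h.1 h.2 _ hx.2 _ hy.2 hcx hcy (Finset.subset_insert _ _)
        (Finset.subset_insert _ _) hne
      rw [← Finset.sum_subset (s₁ := {insert x s, insert y s}), Finset.sum_pair hne]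
      · rw [Finsupp.zero_apply]
        exact_mod_cast this
      · intro t ht
        rw [hf.mem_toFinset]
        rcases Finset.mem_insert.1 ht with rfl | ht
        · exact ⟨hx.2, hcx⟩
        · rw [Finset.mem_singleton] at ht
          exact ht ▸ ⟨hy.2, hcy⟩
      · intro t ht htn
        rw [hf.mem_toFinset] at ht
        by_contra hz
        have hi : incidence t s ≠ 0 := fun h' => hz (by simp [h'])
        obtain ⟨v, hv, rfl⟩ := exists_eq_erase_of_incidence_ne_zero hi
        have hvc : v ∈ cofaceVertices K (t.erase v) :=
          ⟨Finset.notMem_erase _ _, (Finset.insert_erase hv).symm ▸ ht.1⟩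
        rw [he] at hvc
        apply htn
        rw [← Finset.insert_erase hv]
        rcases hvc with rfl | rfl
        · simp
        · simp
    · refine Finset.sum_eq_zero fun t ht => ?_
      rw [hf.mem_toFinset] at ht
      rw [incidence_eq_zero, Int.cast_zero, mul_zero]
      rintro ⟨h1, h2⟩
      exact h ⟨mem_of_subset ht.1 h1 hs, by have := ht.2; omega⟩
  · rw [chainOn_apply_of_mem hf _ ⟨ht, h4⟩]
    simp

end IsClosedOrientableThreeManifold

end

noncomputable section

open PreAbstractSimplicialComplex

/-! ### Homology in degree zero -/

/-- The augmentation vanishes on boundaries. -/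
theorem linearCombination_one_chainBoundary {K : PreAbstractSimplicialComplex ℕ}
    {y : Finset ℕ →₀ ℚ} (hy : y ∈ simplicialChains K 1) :
    Finsupp.linearCombination ℚ (fun _ : Finset ℕ => (1 : ℚ)) (chainBoundary y) = 0 := by
  rw [mem_simplicialChains] at hy
  rw [← Finsupp.sum_single y, Finsupp.sum, map_sum, map_sum]
  refine Finset.sum_eq_zero fun e he => ?_
  obtain ⟨u, v, huv, rfl⟩ := Finset.card_eq_two.1 (hy e (Finsupp.mem_support_iff.1 he)).2
  have key : ∀ u v : ℕ, u < v → ∀ c : ℚ, Finsupp.linearCombination ℚ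
      (fun _ : Finset ℕ => (1 : ℚ)) (chainBoundary (Finsupp.single {u, v} c)) = 0 := by
    intro u v huv c
    have e1 : ({u, v} : Finset ℕ).erase u = {v} := by ext x; simp; grind
    have e2 : ({u, v} : Finset ℕ).erase v = {u} := by ext x; simp; grind
    have f1 : ({u, v} : Finset ℕ).filter (· < u) = ∅ := by ext x; simp; grind
    have f2 : ({u, v} : Finset ℕ).filter (· < v) = {u} := by ext x; simp; grind
    rw [chainBoundary_single, Finset.filter_true_of_mem, Finset.sum_pair huv.ne, e1, e2, f1, f2]
    · simp
    · intro x hx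
      rcases Finset.mem_insert.1 hx with rfl | hx
      · rw [e1]; exact Finset.singleton_nonempty v
      · rw [Finset.mem_singleton.1 hx, e2]; exact Finset.singleton_nonempty u
  rcases lt_or_gt_of_ne huv with h | h
  · exact key u v h _
  · rw [Finset.pair_comm]
    exact key v u h _

theorem single_sub_single_mem_simplicialBoundaries {K : PreAbstractSimplicialComplex ℕ} {u v : ℕ}
    (h : {u, v} ∈ K) :
    Finsupp.single {u} (1 : ℚ) - Finsupp.single {v} 1 ∈ simplicialBoundaries K 0 := by
  rcases eq_or_ne u v with rfl | huv
  · rw [sub_self]; exact Submodule.zero_mem _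
  have key : ∀ u v : ℕ, u < v → {u, v} ∈ K →
      Finsupp.single {v} (1 : ℚ) - Finsupp.single {u} 1 ∈ simplicialBoundaries K 0 := by
    intro u v huv h
    refine ⟨Finsupp.single {u, v} 1, ?_, ?_⟩
    · rw [SetLike.mem_coe, mem_simplicialChains]
      intro σ hσ
      have : {u, v} = σ := by
        by_contra hne
        exact hσ (by rw [Finsupp.single_apply, if_neg hne])
      rw [← this]
      exact ⟨h, Finset.card_pair huv.ne⟩
    · have e1 : ({u, v} : Finset ℕ).erase u = {v} := by ext x; simp; grind
      have e2 : ({u, v} : Finset ℕ).erase v = {u} := by ext x; simp; grind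
      have f1 : ({u, v} : Finset ℕ).filter (· < u) = ∅ := by ext x; simp; grind
      have f2 : ({u, v} : Finset ℕ).filter (· < v) = {u} := by ext x; simp; grind
      rw [chainBoundary_single, Finset.filter_true_of_mem, Finset.sum_pair huv.ne, e1, e2, f1, f2]
      · simp [sub_eq_add_neg]
      · intro x hx
        rcases Finset.mem_insert.1 hx with rfl | hx
        · rw [e1]; exact Finset.singleton_nonempty v
        · rw [Finset.mem_singleton.1 hx, e2]; exact Finset.singleton_nonempty u
  rcases lt_or_gt_of_ne huv with hlt | hlt
  · have := Submodule.neg_mem _ (key u v hlt h)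
    rwa [neg_sub] at this
  · rw [Finset.pair_comm] at h
    exact key v u hlt h

/-- A property of simplices that is passed on along the face relation holds on all of a connected
complex. -/
theorem forall_of_subsingleton_pieces {α : Type} {U : Set (Finset α)}
    (hU : Subsingleton (Pieces U)) {P : Finset α → Prop}
    (hP : ∀ σ ∈ U, ∀ τ ∈ U, σ ⊆ τ → (P σ ↔ P τ)) {σ τ : Finset α} (hσ : σ ∈ U) (hτ : τ ∈ U)
    (h : P σ) : P τ := by
  have he : (Quot.mk _ ⟨σ, hσ⟩ : Pieces U) = Quot.mk _ ⟨τ, hτ⟩ := hU.elim _ _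
  have := congrArg (Quot.lift (fun a : U => P a) fun a b hab =>
    propext (hP a a.2 b b.2 hab)) he
  exact this.mp h

/-- The end points of a segment are homologous, so by connectedness all vertices are, and any one of
them spans the homology. Its class is not zero because the augmentation vanishes on boundaries. -/
theorem finrank_homology_zero {K : PreAbstractSimplicialComplex ℕ} (hne : K.faces.Nonempty)
    (hconn : Subsingleton (Pieces K.faces)) :
    Module.finrank ℚ (SimplicialHomology K 0) = 1 := by
  classical
  obtain ⟨σ₀, hσ₀⟩ := hne
  obtain ⟨v₀, hv₀⟩ := nonempty_of_mem hσ₀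
  have hv₀K := singleton_mem_of_mem hσ₀ hv₀
  have hmem : ∀ v, {v} ∈ K →
      Finsupp.single {v} (1 : ℚ) - Finsupp.single {v₀} 1 ∈ simplicialBoundaries K 0 := by
    intro v hv
    have := forall_of_subsingleton_pieces hconn
      (P := fun σ => ∀ w ∈ σ,
        Finsupp.single {w} (1 : ℚ) - Finsupp.single {v₀} 1 ∈ simplicialBoundaries K 0)
      (fun σ hσ τ hτ hst => ⟨fun h w hw => ?_, fun h w hw => h w (hst hw)⟩) hv₀K hv
      (fun w hw => by rw [Finset.mem_singleton.1 hw, sub_self]; exact Submodule.zero_mem _)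
    · exact this v (Finset.mem_singleton_self v)
    · obtain ⟨u, hu⟩ := nonempty_of_mem hσ
      have h1 : {w, u} ∈ K := mem_of_subset hτ (by
        intro x hx
        rcases Finset.mem_insert.1 hx with rfl | hx
        · exact hw
        · rw [Finset.mem_singleton.1 hx]; exact hst hu) (Finset.insert_nonempty _ _)
      have := Submodule.add_mem _ (single_sub_single_mem_simplicialBoundaries h1) (h u hu)
      rwa [sub_add_sub_cancel] at this
  have hcyc : ∀ v, {v} ∈ K → Finsupp.single {v} (1 : ℚ) ∈ simplicialCycles K 0 := by
    intro v hv
    rw [simplicialCycles_zero, mem_simplicialChains]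
    intro σ hσ
    have : {v} = σ := by
      by_contra hne
      exact hσ (by rw [Finsupp.single_apply, if_neg hne])
    rw [← this]
    exact ⟨hv, Finset.card_singleton v⟩
  set N := (simplicialBoundaries K 0).submoduleOf (simplicialCycles K 0)
  rw [finrank_eq_one_iff']
  refine ⟨N.mkQ ⟨_, hcyc v₀ hv₀K⟩, ?_, fun w => ?_⟩
  · rw [Submodule.mkQ_apply, ne_eq, Submodule.Quotient.mk_eq_zero]
    rintro ⟨y, hy, hyb⟩
    have := linearCombination_one_chainBoundary hy
    rw [hyb] at this
    simp at this
  · obtain ⟨⟨z, hz⟩, rfl⟩ := N.mkQ_surjective w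
    refine ⟨Finsupp.linearCombination ℚ (fun _ : Finset ℕ => (1 : ℚ)) z, ?_⟩
    rw [← map_smul, eq_comm, ← sub_eq_zero, ← map_sub, Submodule.mkQ_apply,
      Submodule.Quotient.mk_eq_zero]
    change z - _ • Finsupp.single {v₀} (1 : ℚ) ∈ simplicialBoundaries K 0
    rw [simplicialCycles_zero, mem_simplicialChains] at hz
    have : z - (Finsupp.linearCombination ℚ (fun _ : Finset ℕ => (1 : ℚ)) z) •
        Finsupp.single {v₀} (1 : ℚ) =
        ∑ σ ∈ z.support, z σ • (Finsupp.single σ (1 : ℚ) - Finsupp.single {v₀} 1) := by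
      simp only [smul_sub, Finset.sum_sub_distrib, ← Finset.sum_smul]
      congr 1
      · conv_lhs => rw [← Finsupp.sum_single z, Finsupp.sum]
        simp
      · simp [Finsupp.linearCombination_apply, Finsupp.sum]
    rw [this]
    refine Submodule.sum_mem _ fun σ hσ => Submodule.smul_mem _ _ ?_
    have h := hz σ (Finsupp.mem_support_iff.1 hσ)
    obtain ⟨v, rfl⟩ := Finset.card_eq_one.1 h.2
    exact hmem v h.1

/-! ### Second homology and collapses -/

/-- Every 2-cycle in `S` is a boundary in `S`. -/
def SecondHomologyVanishes (S : Set (Finset ℕ)) : Prop :=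
  ∀ z : Finset ℕ →₀ ℚ, (∀ σ, z σ ≠ 0 → σ ∈ S ∧ σ.card = 3) → chainBoundary z = 0 →
    ∃ y : Finset ℕ →₀ ℚ, (∀ σ, y σ ≠ 0 → σ ∈ S ∧ σ.card = 4) ∧ chainBoundary y = z

/-- The Euler-Poincaré formula reads `0 = 1 - b_1 + b_2 - b_3`, and `b_3 ≥ 1` by the fundamental
cycle, which is nonzero because a tetrahedron exists. If `b_2 = 0`, then `b_1 + b_3 = 1`, which
leaves only `b_1 = 0` and `b_3 = 1`. -/
theorem isRationalHomologyThreeSphere_iff {K : PreAbstractSimplicialComplex ℕ}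
    (hK : IsClosedOrientableThreeManifold K) (h4 : ∃ B ∈ K, B.card = 4) :
    IsRationalHomologyThreeSphere K ↔ SecondHomologyVanishes K.faces := by
  have hf := hK.finite
  have hc2 : SecondHomologyVanishes K.faces ↔
      simplicialCycles K 2 ≤ simplicialBoundaries K 2 := by
    constructor
    · rintro h z ⟨hz, hz0⟩
      obtain ⟨y, hy, hyz⟩ := h z (mem_simplicialChains.1 hz) hz0
      exact ⟨y, mem_simplicialChains.2 hy, hyz⟩
    · intro h z hz hz0
      obtain ⟨y, hy, hyz⟩ := h ⟨mem_simplicialChains.2 hz, hz0⟩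
      exact ⟨y, mem_simplicialChains.1 hy, hyz⟩
  have hb2 : Module.finrank ℚ (SimplicialHomology K 2) = 0 ↔
      simplicialCycles K 2 ≤ simplicialBoundaries K 2 := by
    have := finite_simplicialCycles hf 2
    rw [Module.finrank_eq_zero_iff_of_free, Submodule.Quotient.subsingleton_iff,
      Submodule.submoduleOf, Submodule.comap_subtype_eq_top]
  rw [hc2, ← hb2]
  constructor
  · intro h
    simpa using h 2
  · intro h k
    have he := eulerChar_eq_betti hf hK.card_le
    rw [hK.eulerChar_eq_zero, finrank_homology_zero hK.nonempty hK.connected, h] at he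
    have h3 : 0 < Module.finrank ℚ (SimplicialHomology K 3) := by
      have h1 := finrank_simplicialHomology hf 3
      rw [finrank_boundaries_eq_zero hK.card_le (by omega), add_zero] at h1
      have := finite_simplicialCycles hf 3
      rw [h1, Module.finrank_pos_iff_exists_ne_zero]
      obtain ⟨z, hz, hz0⟩ := hK.exists_cycle
      obtain ⟨B, hB, hB4⟩ := h4
      refine ⟨⟨z, hz⟩, fun h0 => hz0 B hB hB4 ?_⟩
      rw [Subtype.ext_iff] at h0
      change z = 0 at h0
      rw [h0]; rfl
    match k with
    | 0 => simpa using finrank_homology_zero hK.nonempty hK.connected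
    | 1 =>
      simp only [one_ne_zero, false_or, OfNat.one_ne_ofNat, if_false]
      omega
    | 2 => simpa using h
    | 3 =>
      simp only [OfNat.ofNat_ne_zero, false_or, if_true]
      omega
    | k + 4 =>
      rw [if_neg (by omega)]
      exact finrank_homology_eq_zero hK.card_le (by omega) hf

/-- Removing a tetrahedron does not change the second homology of a closed 3-manifold. -/
theorem secondHomologyVanishes_diff_iff {K : PreAbstractSimplicialComplex ℕ}
    (hK : IsClosedOrientableThreeManifold K) {B : Finset ℕ} (hB : B ∈ K) (hB4 : B.card = 4) :
    SecondHomologyVanishes (K.faces \ {B}) ↔ SecondHomologyVanishes K.faces := by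
  constructor
  · intro h z hz hz0
    have hne : ∀ σ, z σ ≠ 0 → σ ≠ B := by
      rintro σ hσ rfl
      have := (hz _ hσ).2
      omega
    obtain ⟨y, hy, hyz⟩ := h z (fun σ hσ => ⟨⟨(hz σ hσ).1, hne σ hσ⟩, (hz σ hσ).2⟩) hz0
    exact ⟨y, fun σ hσ => ⟨(hy σ hσ).1.1, (hy σ hσ).2⟩, hyz⟩
  · intro h z hz hz0
    obtain ⟨y, hy, hyz⟩ := h z (fun σ hσ => ⟨(hz σ hσ).1.1, (hz σ hσ).2⟩) hz0
    obtain ⟨w, ⟨hw, hw0⟩, hwB⟩ := hK.exists_cycle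
    have hwB := hwB B hB hB4
    rw [SetLike.mem_coe, mem_simplicialChains] at hw
    -- Subtracting the right multiple of the fundamental cycle clears the coefficient at `B` and
    -- leaves the boundary unchanged.
    refine ⟨y - (y B / w B) • w, fun σ hσ => ?_, ?_⟩
    · rw [Finsupp.sub_apply, Finsupp.smul_apply, smul_eq_mul] at hσ
      have hσB : σ ≠ B := by
        rintro rfl
        apply hσ
        field_simp
        ring
      by_cases hyσ : y σ = 0
      · have := hw σ (fun h' => hσ (by rw [hyσ, h']; ring))
        exact ⟨⟨this.1, hσB⟩, this.2⟩
      · exact ⟨⟨(hy σ hyσ).1, hσB⟩, (hy σ hyσ).2⟩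
    · rw [map_sub, map_smul, hyz, LinearMap.mem_ker.1 hw0]
      simp

/-- The sets of open simplices between a spine and the punctured manifold. -/
structure IsFiniteComplex (X : Set (Finset ℕ)) : Prop where
  finite : X.Finite
  nonempty : ∀ σ ∈ X, σ.Nonempty
  mem_of_subset : ∀ σ ∈ X, ∀ τ, τ ⊆ σ → τ.Nonempty → τ ∈ X
  card_le : ∀ σ ∈ X, σ.card ≤ 4

/-- Closure under faces survives because the only simplices that contain `τ` are `τ` and `σ`, and
both are removed. -/
theorem ElementaryCollapse.isFiniteComplex {X Y : Set (Finset ℕ)} (h : ElementaryCollapse X Y)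
    (hX : IsFiniteComplex X) : IsFiniteComplex Y := by
  obtain ⟨σ, hσ, τ, hτ, hτσ, hc, hfree, rfl⟩ := h
  refine ⟨hX.finite.sdiff, fun ρ h => hX.nonempty ρ h.1, fun ρ hρ μ hμ hμn => ?_,
    fun ρ h => hX.card_le ρ h.1⟩
  refine ⟨hX.mem_of_subset ρ hρ.1 μ hμ hμn, fun h => hρ.2 ?_⟩
  rcases h with rfl | rfl
  · exact (hfree ρ hρ.1 hμ).imp id id
  · rcases hfree ρ hρ.1 (hτσ.trans hμ) with rfl | rfl
    · exact Or.inl rfl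
    · exact Or.inr rfl

theorem ElementaryCollapse.eulerChar_eq {X Y : Set (Finset ℕ)} (h : ElementaryCollapse X Y)
    (hX : X.Finite) : eulerChar Y = eulerChar X := by
  obtain ⟨σ, hσ, τ, hτ, hτσ, hc, hfree, rfl⟩ := h
  have hne : τ ≠ σ := by
    rintro rfl
    omega
  have hsub : ({τ, σ} : Set (Finset ℕ)) ⊆ X := by
    rintro _ (rfl | rfl) <;> assumption
  have := finsum_mem_add_sdiff (f := fun σ : Finset ℕ => (-1 : ℤ) ^ (σ.card + 1)) hsub hX
  rw [finsum_mem_pair hne, hc, pow_succ (-1 : ℤ) (τ.card + 1)] at this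
  unfold eulerChar
  linarith

/-- As `τ` is free, the coefficient at `τ` of the boundary of any chain is its coefficient at `σ`
times `[σ : τ]`, which is not zero. So a chain whose boundary avoids `τ` does not involve `σ`: a
filling of a 2-cycle in `Y` stays in `Y`, and a 2-cycle in `X` avoids `σ`. If `τ` is a triangle, it
is cleared from a 2-cycle by subtracting a multiple of the boundary of the tetrahedron `σ`. -/
theorem ElementaryCollapse.secondHomologyVanishes_iff {X Y : Set (Finset ℕ)}
    (h : ElementaryCollapse X Y) (hX : IsFiniteComplex X) :
    SecondHomologyVanishes X ↔ SecondHomologyVanishes Y := by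
  obtain ⟨σ, hσ, τ, hτ, hτσ, hc, hfree, rfl⟩ := h
  have hτn := hX.nonempty τ hτ
  have hi : (incidence σ τ : ℚ) ≠ 0 :=
    Int.cast_ne_zero.2 (incidence_ne_zero_iff.2 ⟨hτσ, hc⟩)
  have hb : ∀ z : Finset ℕ →₀ ℚ, (∀ ρ, z ρ ≠ 0 → ρ ∈ X) →
      chainBoundary z τ = z σ * incidence σ τ := by
    intro z hz
    rw [chainBoundary_apply z hτn, Finsupp.sum, Finset.sum_eq_single σ]
    · intro ρ hρ hne
      rw [incidence_eq_zero, Int.cast_zero, mul_zero]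
      rintro ⟨h1, h2⟩
      rcases hfree ρ (hz ρ (Finsupp.mem_support_iff.1 hρ)) h1 with rfl | rfl
      · omega
      · exact hne rfl
    · intro h
      rw [Finsupp.notMem_support_iff.1 h, zero_mul]
  have h4 := hX.card_le σ hσ
  constructor
  · intro h z hz hz0
    obtain ⟨y, hy, hyz⟩ := h z (fun ρ hρ => ⟨(hz ρ hρ).1.1, (hz ρ hρ).2⟩) hz0
    refine ⟨y, fun ρ hρ => ⟨⟨(hy ρ hρ).1, ?_⟩, (hy ρ hρ).2⟩, hyz⟩
    have h1 := hb y fun ρ hρ => (hy ρ hρ).1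
    have hzτ : z τ = 0 := by
      by_contra h'
      exact (hz τ h').1.2 (by simp)
    rw [hyz, hzτ] at h1
    have hyσ : y σ = 0 := (mul_eq_zero.1 h1.symm).resolve_right hi
    rintro (rfl | rfl)
    · have := (hy _ hρ).2
      omega
    · exact hρ hyσ
  · intro h z hz hz0
    have hzσ : z σ = 0 := by
      have h1 := hb z fun ρ hρ => (hz ρ hρ).1
      rw [hz0] at h1
      exact (mul_eq_zero.1 h1.symm).resolve_right hi
    -- The multiple of `∂σ` that agrees with `z` at `τ`. It is zero unless `τ` is a triangle,
    -- because `z` is supported on triangles, so one formula covers collapses of all dimensions.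
    set k : ℚ := z τ / incidence σ τ with hk
    have hz' : ∀ ρ, (z - chainBoundary (Finsupp.single σ k)) ρ ≠ 0 →
        ρ ∈ X \ {τ, σ} ∧ ρ.card = 3 := by
      intro ρ hρ
      rw [Finsupp.sub_apply] at hρ
      have hρτ : ρ ≠ τ := by
        rintro rfl
        rw [chainBoundary_single_apply _ _ hτn, hk] at hρ
        apply hρ
        field_simp
        ring
      by_cases hτ3 : τ.card = 3
      · rcases ρ.eq_empty_or_nonempty with rfl | hρn
        · rw [chainBoundary_apply_empty, sub_zero] at hρ
          have := (hz _ hρ).2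
          simp at this
        rw [chainBoundary_single_apply _ _ hρn] at hρ
        have h3 : ρ ∈ X ∧ ρ.card = 3 := by
          by_cases h0 : z ρ = 0
          · have hi' : incidence σ ρ ≠ 0 := fun h' => hρ (by rw [h0, h']; simp)
            rw [incidence_ne_zero_iff] at hi'
            exact ⟨hX.mem_of_subset σ hσ ρ hi'.1 hρn, by omega⟩
          · exact hz ρ h0
        refine ⟨⟨h3.1, ?_⟩, h3.2⟩
        rintro (rfl | rfl)
        · exact hρτ rfl
        · omega
      · have hk0 : k = 0 := by
          rw [hk]
          by_contra h'
          exact hτ3 (hz τ fun h'' => h' (by rw [h'', zero_div])).2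
        rw [hk0, Finsupp.single_zero, map_zero, Finsupp.zero_apply, sub_zero] at hρ
        refine ⟨⟨(hz ρ hρ).1, ?_⟩, (hz ρ hρ).2⟩
        rintro (rfl | rfl)
        · exact hρτ rfl
        · exact hρ hzσ
    obtain ⟨y, hy, hyz⟩ := h _ hz' (by rw [map_sub, hz0, chainBoundary_chainBoundary, sub_zero])
    by_cases hτ3 : τ.card = 3
    · refine ⟨y + Finsupp.single σ k, fun ρ hρ => ?_, by rw [map_add, hyz, sub_add_cancel]⟩
      by_cases hρσ : ρ = σ
      · rw [hρσ]
        exact ⟨hσ, by omega⟩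
      · rw [Finsupp.add_apply, Finsupp.single_apply, if_neg (Ne.symm hρσ), add_zero] at hρ
        exact ⟨(hy ρ hρ).1.1, (hy ρ hρ).2⟩
    · refine ⟨y, fun ρ hρ => ⟨(hy ρ hρ).1.1, (hy ρ hρ).2⟩, ?_⟩
      have hk0 : k = 0 := by
        rw [hk]
        by_contra h'
        exact hτ3 (hz τ fun h'' => h' (by rw [h'', zero_div])).2
      rw [hyz, hk0, Finsupp.single_zero, map_zero, sub_zero]

/-- The removed tetrahedron contributes `-1`, so the punctured manifold has Euler characteristic `0
+ 1`. Each collapse keeps both this number and the vanishing of the second homology. -/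
theorem IsSpine.eulerChar_and_secondHomologyVanishes {K L : PreAbstractSimplicialComplex ℕ}
    (hK : IsClosedOrientableThreeManifold K) (h : IsSpine K L) : eulerChar L.faces = 1 ∧
    (IsRationalHomologyThreeSphere K ↔ SecondHomologyVanishes L.faces) := by
  obtain ⟨B, hB, hB4, h⟩ := h
  rw [isRationalHomologyThreeSphere_iff hK ⟨B, hB, hB4⟩,
    ← secondHomologyVanishes_diff_iff hK hB hB4]
  have h0 : IsFiniteComplex (K.faces \ {B}) := by
    refine ⟨hK.finite.sdiff, fun σ h => nonempty_of_mem h.1,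
      fun σ hσ τ hτ hn => ⟨mem_of_subset hσ.1 hτ hn, ?_⟩, fun σ h => hK.card_le σ h.1⟩
    rintro rfl
    apply hσ.2
    refine (Finset.eq_of_subset_of_card_le hτ ?_).symm
    rw [hB4]
    exact hK.card_le σ hσ.1
  have h1 : eulerChar (K.faces \ {B}) = 1 := by
    have := finsum_mem_add_sdiff (f := fun σ : Finset ℕ => (-1 : ℤ) ^ (σ.card + 1))
      (Set.singleton_subset_iff.2 (show B ∈ K.faces from hB)) hK.finite
    have h0 := hK.eulerChar_eq_zero
    unfold eulerChar at h0 ⊢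
    rw [finsum_mem_singleton, hB4, h0] at this
    norm_num at this ⊢
    linarith
  -- The intermediate stages of the collapse are sets of simplices, over which the induction has to
  -- run.
  generalize L.faces = S at h ⊢
  have key : IsFiniteComplex S ∧ eulerChar S = 1 ∧
      (SecondHomologyVanishes (K.faces \ {B}) ↔ SecondHomologyVanishes S) := by
    induction h with
    | refl => exact ⟨h0, h1, Iff.rfl⟩
    | tail _ hs ih =>
      exact ⟨hs.isFiniteComplex ih.1, (hs.eulerChar_eq ih.1.finite).trans ih.2.1,
        ih.2.2.trans (hs.secondHomologyVanishes_iff ih.1)⟩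
  exact key.2

end

noncomputable section

open PreAbstractSimplicialComplex

/-! ### Pieces -/

namespace Pieces

variable {α : Type} {U : Set (Finset α)} {σ τ : Finset α}

/-- The component that contains the open simplex `σ`. -/
def of (h : σ ∈ U) : Pieces U := Quot.mk _ ⟨σ, h⟩

theorem mem_simplices_of (h : σ ∈ U) : σ ∈ (of h).simplices := ⟨h, rfl⟩

theorem simplices_subset (c : Pieces U) : c.simplices ⊆ U := fun _ h => h.1

theorem eq_of_mem {c : Pieces U} (h : σ ∈ c.simplices) : of (c.simplices_subset h) = c := h.2

theorem eq_of_mem_of_mem {c c' : Pieces U} (h : σ ∈ c.simplices) (h' : σ ∈ c'.simplices) :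
    c = c' := (eq_of_mem h).symm.trans (eq_of_mem h')

theorem of_eq_of_subset (hσ : σ ∈ U) (hτ : τ ∈ U) (h : σ ⊆ τ) : of hσ = of hτ :=
  Quot.sound h

theorem mem_simplices_iff_of_subset {c : Pieces U} (hσ : σ ∈ U) (hτ : τ ∈ U) (h : σ ⊆ τ) :
    σ ∈ c.simplices ↔ τ ∈ c.simplices := by
  have := of_eq_of_subset hσ hτ h
  exact ⟨fun h => ⟨hτ, this.symm.trans h.2⟩, fun h => ⟨hσ, this.trans h.2⟩⟩

theorem exists_mem_simplices (c : Pieces U) : ∃ σ, σ ∈ c.simplices := by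
  induction c using Quot.ind with
  | mk a => exact ⟨a.1, a.2, rfl⟩

/-- A property that is passed on along the face relation is shared by the simplices of a piece. -/
theorem iff_of_mem {P : Finset α → Prop}
    (hP : ∀ σ ∈ U, ∀ τ ∈ U, σ ⊆ τ → (P σ ↔ P τ)) {c : Pieces U} (hσ : σ ∈ c.simplices)
    (hτ : τ ∈ c.simplices) : P σ ↔ P τ := by
  have he : of hσ.1 = of hτ.1 := hσ.2.trans hτ.2.symm
  have := congrArg (Quot.lift (fun a : U => P a) fun a b hab =>
    propext (hP a a.2 b b.2 hab)) he
  exact iff_of_eq this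

/-- A function that is constant along the face relation is constant on each piece. -/
theorem eq_of_forall_subset {β : Type*} {f : Finset α → β}
    (hf : ∀ σ ∈ U, ∀ τ ∈ U, σ ⊆ τ → f σ = f τ) {c : Pieces U} (hσ : σ ∈ c.simplices)
    (hτ : τ ∈ c.simplices) : f σ = f τ :=
  (iff_of_mem (P := fun ρ => f σ = f ρ) (fun ρ hρ μ hμ h => by rw [hf ρ hρ μ hμ h]) hσ hτ).1 rfl

theorem finite (hU : U.Finite) : Finite (Pieces U) :=
  have := hU.to_subtype
  Quot.finite _

theorem pairwise_disjoint : Pairwise (Function.onFun Disjoint fun c : Pieces U => c.simplices) :=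
  fun _ _ hne => Set.disjoint_left.2 fun _ h h' => hne (eq_of_mem_of_mem h h')

theorem iUnion_simplices : ⋃ c : Pieces U, c.simplices = U := by
  ext σ
  rw [Set.mem_iUnion]
  exact ⟨fun ⟨c, h⟩ => c.simplices_subset h, fun h => ⟨of h, mem_simplices_of h⟩⟩

theorem finsum_simplices {M : Type*} [AddCommMonoid M] (hU : U.Finite) (f : Finset α → M) :
    ∑ᶠ c : Pieces U, ∑ᶠ σ ∈ c.simplices, f σ = ∑ᶠ σ ∈ U, f σ := by
  have := finite hU
  conv_rhs => rw [← iUnion_simplices (U := U)]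
  exact (finsum_mem_iUnion pairwise_disjoint fun c => hU.subset c.simplices_subset).symm

end Pieces

/-! ### The local structure of a simple polyhedron -/

/-- The open simplices which are not in the singular set. -/
abbrev regularSet (L : PreAbstractSimplicialComplex ℕ) : Set (Finset ℕ) :=
  {σ | σ ∈ L ∧ σ ∉ singularSet L}

theorem trianglesAt_eq_image {L : PreAbstractSimplicialComplex ℕ} {s : Finset ℕ}
    (h2 : s.card = 2) : trianglesAt L s = (fun x => insert x s) '' cofaceVertices L s := by
  ext t
  constructor
  · rintro ⟨ht, h3, hst⟩
    obtain ⟨x, hx⟩ : ∃ x, t \ s = {x} := Finset.card_eq_one.1 (by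
      rw [Finset.card_sdiff_of_subset hst]; omega)
    have hxm : x ∈ t \ s := by rw [hx]; simp
    have : insert x s = t := by
      rw [Finset.insert_eq, ← hx, Finset.sdiff_union_of_subset hst]
    exact ⟨x, ⟨(Finset.mem_sdiff.1 hxm).2, this ▸ ht⟩, this⟩
  · rintro ⟨x, hx, rfl⟩
    exact ⟨hx.2, by rw [Finset.card_insert_of_notMem hx.1, h2], Finset.subset_insert _ _⟩

theorem ncard_trianglesAt {L : PreAbstractSimplicialComplex ℕ} {s : Finset ℕ}
    (h2 : s.card = 2) : (trianglesAt L s).ncard = (cofaceVertices L s).ncard := by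
  have hinj : Set.InjOn (fun x => insert x s) (cofaceVertices L s) := by
    intro x hx y hy hxy
    have : x ∈ insert y s := by
      dsimp only at hxy
      exact hxy ▸ Finset.mem_insert_self x s
    exact (Finset.mem_insert.1 this).resolve_right hx.1
  rw [trianglesAt_eq_image h2, hinj.ncard_image]

/-- Translates between the polyhedron and its links: the segment `{v, x}` is singular when `x` has
degree three in the link of `v`. -/
theorem ncard_trianglesAt_pair {L : PreAbstractSimplicialComplex ℕ} {v x : ℕ} (hvx : v ≠ x) :
    (trianglesAt L {v, x}).ncard = (cofaceVertices (vertexLink L v) {x}).ncard := by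
  rw [ncard_trianglesAt (Finset.card_pair hvx),
    ← cofaceVertices_vertexLink (Finset.mem_insert_self v {x}),
    Finset.erase_insert (by simpa using hvx)]

theorem eq_pair_of_mem {s : Finset ℕ} (h2 : s.card = 2) {v : ℕ} (hv : v ∈ s) :
    ∃ x, v ≠ x ∧ s = {v, x} := by
  obtain ⟨a, b, hab, rfl⟩ := Finset.card_eq_two.1 h2
  rcases Finset.mem_insert.1 hv with rfl | hv
  · exact ⟨b, hab, rfl⟩
  · rw [Finset.mem_singleton] at hv
    exact ⟨a, hv ▸ hab.symm, hv ▸ Finset.pair_comm _ _⟩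

theorem IsSurfaceVertex.isArcGraph {L : PreAbstractSimplicialComplex ℕ} {v : ℕ}
    (h : IsSurfaceVertex L v) : IsArcGraph (vertexLink L v) 0 0 :=
  h.2.isArcGraph isArcGraph_stdSphereComplex

theorem IsTripleVertex.isArcGraph {L : PreAbstractSimplicialComplex ℕ} {v : ℕ}
    (h : IsTripleVertex L v) : IsArcGraph (vertexLink L v) 2 2 :=
  h.2.isArcGraph isArcGraph_thetaComplex

theorem IsTrueVertex.isArcGraph {L : PreAbstractSimplicialComplex ℕ} {v : ℕ}
    (h : IsTrueVertex L v) : IsArcGraph (vertexLink L v) 4 2 :=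
  h.2.isArcGraph isArcGraph_completeFourComplex

theorem IsTripleVertex.not_isTrueVertex {L : PreAbstractSimplicialComplex ℕ} {v : ℕ}
    (h : IsTripleVertex L v) : ¬ IsTrueVertex L v := fun h' => by
  have h1 := h.isArcGraph.2.1
  have h2 := h'.isArcGraph.2.1
  omega

/-- A vertex of the singular set. -/
def IsSingularVertex (L : PreAbstractSimplicialComplex ℕ) (v : ℕ) : Prop :=
  IsTripleVertex L v ∨ IsTrueVertex L v

theorem IsSingularVertex.isArcGraph {L : PreAbstractSimplicialComplex ℕ} {v : ℕ}
    (h : IsSingularVertex L v) : ∃ k, 0 < k ∧ IsArcGraph (vertexLink L v) k 2 := by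
  rcases h with h | h
  · exact ⟨2, by omega, h.isArcGraph⟩
  · exact ⟨4, by omega, h.isArcGraph⟩

theorem singleton_mem_singularSet {L : PreAbstractSimplicialComplex ℕ} {v : ℕ} :
    {v} ∈ singularSet L ↔ IsSingularVertex L v := by
  constructor
  · rintro ⟨-, ⟨w, hw, h⟩ | ⟨h, -⟩⟩
    · rw [Finset.singleton_injective hw]; exact h
    · simp at h
  · intro h
    exact ⟨h.elim (fun h => h.1) (fun h => h.1), Or.inl ⟨v, rfl, h⟩⟩

theorem mem_singularSet_of_card_two {L : PreAbstractSimplicialComplex ℕ} {s : Finset ℕ}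
    (h2 : s.card = 2) : s ∈ singularSet L ↔ s ∈ L ∧ (trianglesAt L s).ncard = 3 := by
  refine and_congr_right fun _ => ⟨?_, fun h => Or.inr ⟨h2, h⟩⟩
  rintro (⟨v, rfl, -⟩ | ⟨-, h⟩)
  · simp at h2
  · exact h

theorem card_of_mem_singularSet {L : PreAbstractSimplicialComplex ℕ} {s : Finset ℕ}
    (h : s ∈ singularSet L) : s.card = 1 ∨ s.card = 2 := by
  obtain ⟨-, ⟨v, rfl, -⟩ | ⟨h, -⟩⟩ := h
  · exact Or.inl (Finset.card_singleton v)
  · exact Or.inr h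

theorem mem_trivalentVertices_vertexLink {L : PreAbstractSimplicialComplex ℕ} {v x : ℕ} :
    x ∈ trivalentVertices (vertexLink L v) ↔ v ≠ x ∧ {v, x} ∈ singularSet L := by
  constructor
  · intro h
    have hx := trivalentVertices_subset _ h
    have hvx : v ≠ x := fun h => hx.2.1 (by simp [h])
    refine ⟨hvx, (mem_singularSet_of_card_two (Finset.card_pair hvx)).2 ⟨hx.2.2, ?_⟩⟩
    rw [ncard_trianglesAt_pair hvx]
    exact h
  · rintro ⟨hvx, h⟩
    have := ((mem_singularSet_of_card_two (Finset.card_pair hvx)).1 h).2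
    rwa [ncard_trianglesAt_pair hvx] at this

namespace IsSimplePolyhedron

variable {L : PreAbstractSimplicialComplex ℕ}

theorem exists_isArcGraph (hL : IsSimplePolyhedron L) {v : ℕ} (hv : {v} ∈ L) :
    ∃ k j, IsArcGraph (vertexLink L v) k j := by
  rcases hL.2 v hv with h | h | h
  · exact ⟨_, _, h.isArcGraph⟩
  · exact ⟨_, _, h.isArcGraph⟩
  · exact ⟨_, _, h.isArcGraph⟩

theorem card_le (hL : IsSimplePolyhedron L) : ∀ σ ∈ L, σ.card ≤ 3 := by
  intro σ hσ
  by_cases h2 : 2 ≤ σ.card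
  · obtain ⟨v, hv⟩ := nonempty_of_mem hσ
    obtain ⟨k, j, h⟩ := hL.exists_isArcGraph (singleton_mem_of_mem hσ hv)
    have := h.card_le _ (erase_mem_vertexLink hσ hv h2)
    have := Finset.card_erase_add_one hv
    omega
  · omega

theorem ncard_trianglesAt (hL : IsSimplePolyhedron L) {s : Finset ℕ} (hs : s ∈ L)
    (h2 : s.card = 2) : (trianglesAt L s).ncard = 2 ∨ (trianglesAt L s).ncard = 3 := by
  obtain ⟨v, hv⟩ := nonempty_of_mem hs
  obtain ⟨x, hvx, rfl⟩ := eq_pair_of_mem h2 hv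
  obtain ⟨k, j, -, -, col, hcol, -⟩ := hL.exists_isArcGraph (singleton_mem_of_mem hs hv)
  rw [ncard_trianglesAt_pair hvx]
  have hx : {x} ∈ vertexLink L v :=
    ⟨Finset.singleton_nonempty x, by simpa using hvx, hs⟩
  exact (hcol.vertex x hx).imp And.left And.left

theorem ncard_trianglesAt_of_notMem (hL : IsSimplePolyhedron L) {s : Finset ℕ} (hs : s ∈ L)
    (h2 : s.card = 2) (h : s ∉ singularSet L) : (trianglesAt L s).ncard = 2 :=
  (hL.ncard_trianglesAt hs h2).resolve_right fun h3 =>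
    h ((mem_singularSet_of_card_two h2).2 ⟨hs, h3⟩)

/-- A surface vertex has a circle as its link, with no vertex of degree three, so no singular
segment ends there. -/
theorem isSingularVertex_of_mem (hL : IsSimplePolyhedron L) {s : Finset ℕ}
    (hs : s ∈ singularSet L) {v : ℕ} (hv : v ∈ s) : IsSingularVertex L v := by
  rcases card_of_mem_singularSet hs with h1 | h2
  · obtain ⟨w, rfl⟩ := Finset.card_eq_one.1 h1
    rw [Finset.mem_singleton.1 hv]
    exact singleton_mem_singularSet.1 hs
  · obtain ⟨x, hvx, rfl⟩ := eq_pair_of_mem h2 hv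
    rcases hL.2 v (singleton_mem_of_mem hs.1 hv) with h | h
    · exfalso
      have h0 := h.isArcGraph.2.1
      have hx := mem_trivalentVertices_vertexLink.2 ⟨hvx, hs⟩
      -- `Set.ncard` is also `0` for infinite sets, so finiteness has to be known before the set can
      -- be called empty.
      have hfin : (trivalentVertices (vertexLink L v)).Finite := by
        refine ((hL.1.toFinset.biUnion id).finite_toSet).subset fun y hy => ?_
        have := (trivalentVertices_subset _ hy).2.2
        exact Finset.mem_biUnion.2 ⟨_, hL.1.mem_toFinset.2 this, by simp⟩
      rw [Set.ncard_eq_zero hfin] at h0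
      rw [h0] at hx
      exact hx
    · exact h

theorem isSurfaceVertex (hL : IsSimplePolyhedron L) {v : ℕ} (hv : {v} ∈ regularSet L) :
    IsSurfaceVertex L v :=
  (hL.2 v hv.1).resolve_right fun h => hv.2 (singleton_mem_singularSet.2 h)

theorem mem_regularSet_of_card_three {t : Finset ℕ} (ht : t ∈ L) (h3 : t.card = 3) :
    t ∈ regularSet L :=
  ⟨ht, fun h => by have := card_of_mem_singularSet h; omega⟩

/-- A coface of a regular simplex is regular. -/
theorem mem_regularSet_of_subset (hL : IsSimplePolyhedron L) {σ τ : Finset ℕ}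
    (hσ : σ ∈ regularSet L) (hτ : τ ∈ L) (h : σ ⊆ τ) : τ ∈ regularSet L := by
  refine ⟨hτ, fun hs => hσ.2 ?_⟩
  have hn := nonempty_of_mem hσ.1
  rcases (show σ.card = 1 ∨ 2 ≤ σ.card by have := hn.card_pos; omega) with h1 | h2
  · obtain ⟨v, rfl⟩ := Finset.card_eq_one.1 h1
    exact singleton_mem_singularSet.2 (hL.isSingularVertex_of_mem hs (by simpa using h))
  · have := Finset.card_le_card h
    have := card_of_mem_singularSet hs
    rwa [Finset.eq_of_subset_of_card_le h (by omega)]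

theorem exists_triangle_of_card_two (hL : IsSimplePolyhedron L) {s : Finset ℕ} (hs : s ∈ L)
    (h2 : s.card = 2) : ∃ t ∈ L, t.card = 3 ∧ s ⊆ t := by
  have : (trianglesAt L s).Nonempty := by
    rw [Set.nonempty_iff_ne_empty]
    intro h
    have := hL.ncard_trianglesAt hs h2
    rw [h, Set.ncard_empty] at this
    omega
  exact this

theorem exists_segment (hL : IsSimplePolyhedron L) {v : ℕ} (hv : {v} ∈ L) :
    ∃ x, v ≠ x ∧ {v, x} ∈ L := by
  obtain ⟨k, j, ⟨σ, hσ⟩, -⟩ := hL.exists_isArcGraph hv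
  obtain ⟨x, hx⟩ := hσ.1
  refine ⟨x, ?_, mem_of_subset hσ.2.2 (Finset.insert_subset_insert v (by simpa using hx))
    (Finset.insert_nonempty _ _)⟩
  rintro rfl
  exact hσ.2.1 hx

/-- Every simplex is contained in a triangle. -/
theorem exists_triangle (hL : IsSimplePolyhedron L) {σ : Finset ℕ} (hσ : σ ∈ L) :
    ∃ t ∈ L, t.card = 3 ∧ σ ⊆ t := by
  have hn := (nonempty_of_mem hσ).card_pos
  have h3 := hL.card_le σ hσ
  rcases (show σ.card = 1 ∨ σ.card = 2 ∨ σ.card = 3 by omega) with h | h | h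
  · obtain ⟨v, rfl⟩ := Finset.card_eq_one.1 h
    obtain ⟨x, hvx, hx⟩ := hL.exists_segment hσ
    obtain ⟨t, ht, h3, hst⟩ := hL.exists_triangle_of_card_two hx (Finset.card_pair hvx)
    exact ⟨t, ht, h3, fun y hy => hst (by rw [Finset.mem_singleton.1 hy]; simp)⟩
  · exact hL.exists_triangle_of_card_two hσ h
  · exact ⟨σ, hσ, h, Finset.Subset.refl _⟩

/-- Along the regular simplices around a vertex the colour of the link is constant. -/
theorem col_erase_eq (_hL : IsSimplePolyhedron L) {v j : ℕ} {col : Finset ℕ → Finset ℕ}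
    (hcol : ArcColoring (vertexLink L v) col j) {σ τ : Finset ℕ} (hσ : σ ∈ regularSet L)
    (hτ : τ ∈ regularSet L) (hv : v ∈ σ) (hσv : σ ≠ {v}) (h : σ ⊆ τ) :
    col (σ.erase v) = col (τ.erase v) := by
  by_cases he : σ = τ
  · rw [he]
  have hlt : σ.card < τ.card := Finset.card_lt_card (h.ssubset_of_ne he)
  have h2 : 2 ≤ σ.card := by
    have : 1 ≤ σ.card := Finset.card_pos.2 ⟨v, hv⟩
    by_contra h'
    obtain ⟨w, rfl⟩ := Finset.card_eq_one.1 (show σ.card = 1 by omega)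
    rw [Finset.mem_singleton] at hv
    exact hσv (by rw [hv])
  have h3 := hcol.card_le _ (erase_mem_vertexLink hτ.1 (h hv) (by omega))
  have hce := Finset.card_erase_add_one (h hv)
  have hs2 : σ.card = 2 := by omega
  obtain ⟨x, hvx, rfl⟩ := eq_pair_of_mem hs2 hv
  have hxτ : x ∈ τ := h (by simp)
  obtain ⟨y, hxy, hy⟩ := eq_pair_of_mem (show (τ.erase v).card = 2 by omega)
    (Finset.mem_erase.2 ⟨hvx.symm, hxτ⟩)
  have hxl : {x} ∈ vertexLink L v := ⟨Finset.singleton_nonempty x, by simpa using hvx, hσ.1⟩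
  have hyl : y ∈ cofaceVertices (vertexLink L v) {x} := by
    rw [mem_cofaceVertices_singleton, Finset.pair_comm, ← hy]
    exact ⟨hxy.symm, erase_mem_vertexLink hτ.1 (h hv) (by omega)⟩
  rw [hy, Finset.erase_insert (by simpa using hvx)]
  -- At degree two the colour continues from the vertex `x` of the link to the segment `{x, y}`.
  -- Degree three would make `{v, x}` singular.
  rcases hcol.vertex x hxl with hx | hx
  · rw [Finset.pair_comm, hx.2 y hyl]
  · exfalso
    refine hσ.2 ((mem_singularSet_of_card_two hs2).2 ⟨hσ.1, ?_⟩)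
    rw [ncard_trianglesAt_pair hvx, hx.1]

/-- Regular simplices around a vertex with the same colour are connected with each other. -/
theorem mem_of_col_erase_eq (hL : IsSimplePolyhedron L) {v j : ℕ} {col : Finset ℕ → Finset ℕ}
    (hcol : ArcColoring (vertexLink L v) col j) {S : Set (Finset ℕ)}
    (hS : ∀ σ ∈ regularSet L, ∀ τ ∈ regularSet L, v ∈ σ → σ ≠ {v} → σ ⊆ τ → (σ ∈ S ↔ τ ∈ S))
    {σ τ : Finset ℕ} (hσ : σ ∈ regularSet L) (hτ : τ ∈ regularSet L) (hvσ : v ∈ σ) (hvτ : v ∈ τ)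
    (hσv : σ ≠ {v}) (hτv : τ ≠ {v}) (hc : col (σ.erase v) = col (τ.erase v)) (h : σ ∈ S) :
    τ ∈ S := by
  obtain ⟨σ', hσ', h3, hs⟩ := hL.exists_triangle hσ.1
  obtain ⟨τ', hτ', h3', ht⟩ := hL.exists_triangle hτ.1
  have hσr := mem_regularSet_of_card_three hσ' h3
  have hτr := mem_regularSet_of_card_three hτ' h3'
  rw [hL.col_erase_eq hcol hσ hσr hvσ hσv hs, hL.col_erase_eq hcol hτ hτr hvτ hτv ht] at hc
  rw [hS σ hσ σ' hσr hvσ hσv hs] at h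
  rw [hS τ hτ τ' hτr hvτ hτv ht]
  have hce := Finset.card_erase_add_one (hs hvσ)
  have hce' := Finset.card_erase_add_one (ht hvτ)
  -- A simplex at `v` is recorded by its face opposite to `v`, which moves the test set into the
  -- link.
  have key := hcol.conn {ρ | insert v ρ ∈ S} ?_ _ (erase_mem_vertexLink hσ' (hs hvσ) (by omega))
    _ (erase_mem_vertexLink hτ' (ht hvτ) (by omega)) (by omega) (by omega) hc ?_
  · rwa [Set.mem_ofPred_eq, Finset.insert_erase (ht hvτ)] at key
  · intro x hx y hy
    have hy' := mem_cofaceVertices_singleton.1 hy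
    have hvx : v ≠ x := fun h => hy'.2.2.1 (by simp [h])
    have hvy : v ≠ y := fun h => hy'.2.2.1 (by simp [h])
    have hxL : {v, x} ∈ L := mem_of_subset hy'.2.2.2
      (Finset.insert_subset_insert v (by simp)) (Finset.insert_nonempty _ _)
    refine hS {v, x} ⟨hxL, fun h => ?_⟩ _ (mem_regularSet_of_card_three hy'.2.2.2 ?_) (by simp)
      (fun h => ?_) (Finset.insert_subset_insert v (by simp))
    · have := ((mem_singularSet_of_card_two (Finset.card_pair hvx)).1 h).2
      rw [ncard_trianglesAt_pair hvx] at this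
      omega
    · rw [Finset.card_insert_of_notMem hy'.2.2.1, Finset.card_pair hy'.1]
    · have := congrArg Finset.card h
      rw [Finset.card_pair hvx, Finset.card_singleton] at this
      omega
  · rwa [Set.mem_ofPred_eq, Finset.insert_erase (hs hvσ)]

/-- A function on the triangles that does not change across the regular segments is constant on
the triangles around a regular simplex. -/
theorem eq_of_subset_of_subset (hL : IsSimplePolyhedron L) {β : Type*} {g : Finset ℕ → β}
    (hg : ∀ s ∈ regularSet L, s.card = 2 → ∀ t₁ ∈ trianglesAt L s, ∀ t₂ ∈ trianglesAt L s,
      g t₁ = g t₂) {σ : Finset ℕ} (hσ : σ ∈ regularSet L) {t₁ t₂ : Finset ℕ} (h₁ : t₁ ∈ L)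
    (h₂ : t₂ ∈ L) (hc₁ : t₁.card = 3) (hc₂ : t₂.card = 3) (hs₁ : σ ⊆ t₁) (hs₂ : σ ⊆ t₂) :
    g t₁ = g t₂ := by
  have hn := (nonempty_of_mem hσ.1).card_pos
  have h3 := Finset.card_le_card hs₁
  rcases (show σ.card = 1 ∨ σ.card = 2 ∨ σ.card = 3 by omega) with h | h | h
  · obtain ⟨v, rfl⟩ := Finset.card_eq_one.1 h
    have hv₁ : v ∈ t₁ := by simpa using hs₁
    have hv₂ : v ∈ t₂ := by simpa using hs₂
    obtain ⟨-, -, col, hcol, h0⟩ := (hL.isSurfaceVertex hσ).isArcGraph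
    have hce := Finset.card_erase_add_one hv₁
    have hce' := Finset.card_erase_add_one hv₂
    have hne : ∀ t : Finset ℕ, t.card = 3 → t ≠ {v} := by
      rintro _ h rfl
      simp at h
    -- The test set consists of the simplices for which `g` has the value `g t₁` on all triangles
    -- around them. The link of `v` is a circle, so all its segments have one colour and every
    -- triangle at `v` is reached.
    refine (hL.mem_of_col_erase_eq hcol
      (S := {σ | ∀ t ∈ L, t.card = 3 → σ ⊆ t → g t₁ = g t}) ?_
      (mem_regularSet_of_card_three h₁ hc₁)
      (mem_regularSet_of_card_three h₂ hc₂) hv₁ hv₂ (hne _ hc₁) (hne _ hc₂) ?_ ?_) t₂ h₂ hc₂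
      (Finset.Subset.refl _)
    · intro σ hσ τ hτ hvσ hσv hst
      refine ⟨fun h t ht h3 hτt => h t ht h3 (hst.trans hτt), fun h t ht h3 hσt => ?_⟩
      obtain ⟨t', ht', h3', hτt'⟩ := hL.exists_triangle hτ.1
      rw [h t' ht' h3' hτt']
      have hσc : 2 ≤ σ.card := by
        have : 1 ≤ σ.card := Finset.card_pos.2 ⟨v, hvσ⟩
        by_contra h'
        obtain ⟨w, rfl⟩ := Finset.card_eq_one.1 (show σ.card = 1 by omega)
        rw [Finset.mem_singleton] at hvσ
        exact hσv (by rw [hvσ])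
      have := Finset.card_le_card hσt
      rcases (show σ.card = 2 ∨ σ.card = 3 by omega) with h' | h'
      · exact hg σ hσ h' _ ⟨ht', h3', hst.trans hτt'⟩ _ ⟨ht, h3, hσt⟩
      · rw [← Finset.eq_of_subset_of_card_le hσt (by omega),
          ← Finset.eq_of_subset_of_card_le (hst.trans hτt') (by omega)]
    · exact h0 rfl _ (erase_mem_vertexLink h₁ hv₁ (by omega)) _
        (erase_mem_vertexLink h₂ hv₂ (by omega)) (by omega) (by omega)
    · intro t ht h3 hs
      rw [Finset.eq_of_subset_of_card_le hs (by omega)]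
  · exact hg σ hσ h _ ⟨h₁, hc₁, hs₁⟩ _ ⟨h₂, hc₂, hs₂⟩
  · rw [← Finset.eq_of_subset_of_card_le hs₁ (by omega),
      ← Finset.eq_of_subset_of_card_le hs₂ (by omega)]

/-- A function on the triangles that does not change across the regular segments is constant on
each region. -/
theorem eq_of_mem_region (hL : IsSimplePolyhedron L) {β : Type*} {g : Finset ℕ → β}
    (hg : ∀ s ∈ regularSet L, s.card = 2 → ∀ t₁ ∈ trianglesAt L s, ∀ t₂ ∈ trianglesAt L s,
      g t₁ = g t₂) {R : Region L} {t₁ t₂ : Finset ℕ} (h₁ : t₁ ∈ R.simplices)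
    (h₂ : t₂ ∈ R.simplices) (hc₁ : t₁.card = 3) (hc₂ : t₂.card = 3) : g t₁ = g t₂ := by
  refine (Pieces.iff_of_mem (P := fun σ => ∀ t ∈ L, t.card = 3 → σ ⊆ t → g t₁ = g t) ?_ h₁ h₂).1 ?_
    t₂ h₂.1.1 hc₂ (Finset.Subset.refl _)
  · intro σ hσ τ hτ hst
    refine ⟨fun h t ht h3 hτt => h t ht h3 (hst.trans hτt), fun h t ht h3 hσt => ?_⟩
    obtain ⟨t', ht', h3', hτt'⟩ := hL.exists_triangle hτ.1
    rw [h t' ht' h3' hτt']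
    exact hL.eq_of_subset_of_subset hg hσ ht' ht h3' h3 (hst.trans hτt') hσt
  · intro t ht h3 hs
    rw [Finset.eq_of_subset_of_card_le hs (by omega)]

theorem exists_triangle_mem_region (hL : IsSimplePolyhedron L) (R : Region L) :
    ∃ t ∈ R.simplices, t.card = 3 := by
  obtain ⟨σ, hσ⟩ := R.exists_mem_simplices
  obtain ⟨t, ht, h3, hst⟩ := hL.exists_triangle hσ.1.1
  exact ⟨t, (Pieces.mem_simplices_iff_of_subset hσ.1
    (mem_regularSet_of_card_three ht h3) hst).1 hσ, h3⟩

/-- Two segments of the singular set meet at a triple vertex. -/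
theorem ncard_segments_of_isTripleVertex {v : ℕ} (hv : IsTripleVertex L v) :
    {s | s ∈ singularSet L ∧ s.card = 2 ∧ v ∈ s}.ncard = 2 := by
  refine Eq.trans ?_ hv.isArcGraph.2.1
  rw [← Set.InjOn.ncard_image (f := fun x : ℕ => ({v, x} : Finset ℕ))
    (s := trivalentVertices (vertexLink L v))]
  · congr 1
    ext s
    constructor
    · rintro ⟨hs, h2, hvs⟩
      obtain ⟨x, hvx, rfl⟩ := eq_pair_of_mem h2 hvs
      exact ⟨x, mem_trivalentVertices_vertexLink.2 ⟨hvx, hs⟩, rfl⟩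
    · rintro ⟨x, hx, rfl⟩
      rw [mem_trivalentVertices_vertexLink] at hx
      exact ⟨hx.2, Finset.card_pair hx.1, by simp⟩
  · intro x hx y _ hxy
    have hvx := (mem_trivalentVertices_vertexLink.1 hx).1
    have : x ∈ ({v, y} : Finset ℕ) := by
      dsimp only at hxy
      rw [← hxy]; simp
    simpa [hvx.symm] using this

end IsSimplePolyhedron

end

noncomputable section

open PreAbstractSimplicialComplex

/-! ### Completions -/

section completion

variable {U : Set (Finset ℕ)}

/-- The point of the completion over `v` that is a vertex of the simplex over `σ`. -/
def localPiece {σ : Finset ℕ} (hσ : σ ∈ U) {v : ℕ} (hv : v ∈ σ) : LocalPieces U v :=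
  Pieces.of (U := {σ | σ ∈ U ∧ v ∈ σ}) ⟨hσ, hv⟩

theorem localPiece_eq_of_subset {σ τ : Finset ℕ} (hσ : σ ∈ U) (hτ : τ ∈ U) (h : σ ⊆ τ) {v : ℕ}
    (hv : v ∈ σ) : localPiece hσ hv = localPiece hτ (h hv) :=
  Pieces.of_eq_of_subset _ _ h

theorem mem_completionSimplex {σ : Finset ℕ} {hσ : σ ∈ U} {x : Σ v : ℕ, LocalPieces U v} :
    x ∈ completionSimplex U ⟨σ, hσ⟩ ↔ ∃ hv : x.1 ∈ σ, localPiece hσ hv = x.2 := by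
  obtain ⟨v, p⟩ := x
  unfold completionSimplex
  simp only [Finset.mem_image, Finset.mem_attach, true_and]
  constructor
  · rintro ⟨⟨w, hw⟩, h⟩
    obtain ⟨rfl, h⟩ := Sigma.mk.inj_iff.1 h
    exact ⟨hw, eq_of_heq h⟩
  · rintro ⟨hv, hp⟩
    exact ⟨⟨v, hv⟩, Sigma.ext rfl (heq_of_eq hp)⟩

/-- The simplex over which a simplex of the completion lies. -/
def baseSimplex (ρ : Finset (Σ v : ℕ, LocalPieces U v)) : Finset ℕ := ρ.image Sigma.fst

theorem mem_baseSimplex {ρ : Finset (Σ v : ℕ, LocalPieces U v)} {v : ℕ} :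
    v ∈ baseSimplex ρ ↔ ∃ p, ⟨v, p⟩ ∈ ρ := by
  unfold baseSimplex
  simp

theorem mem_completion {ρ : Finset (Σ v : ℕ, LocalPieces U v)} :
    ρ ∈ completion U ↔ ρ.Nonempty ∧ ∃ σ, ∃ hσ : σ ∈ U, ρ ⊆ completionSimplex U ⟨σ, hσ⟩ := by
  change ρ.Nonempty ∧ (∃ σ : U, ρ ⊆ completionSimplex U σ) ↔ _
  simp

variable {ρ ρ' : Finset (Σ v : ℕ, LocalPieces U v)} {σ τ : Finset ℕ}

theorem baseSimplex_subset {hσ : σ ∈ U} (h : ρ ⊆ completionSimplex U ⟨σ, hσ⟩) :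
    baseSimplex ρ ⊆ σ := by
  intro v hv
  obtain ⟨p, hp⟩ := mem_baseSimplex.1 hv
  exact (mem_completionSimplex.1 (h hp)).1

theorem mem_iff_of_subset {hσ : σ ∈ U} (h : ρ ⊆ completionSimplex U ⟨σ, hσ⟩)
    {x : Σ v : ℕ, LocalPieces U v} :
    x ∈ ρ ↔ x.1 ∈ baseSimplex ρ ∧ ∃ hv : x.1 ∈ σ, localPiece hσ hv = x.2 := by
  constructor
  · exact fun hx => ⟨mem_baseSimplex.2 ⟨x.2, hx⟩, mem_completionSimplex.1 (h hx)⟩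
  · rintro ⟨hx, hv, hp⟩
    obtain ⟨p, hxp⟩ := mem_baseSimplex.1 hx
    obtain ⟨hv', hp'⟩ := mem_completionSimplex.1 (h hxp)
    have : (⟨x.1, p⟩ : Σ v : ℕ, LocalPieces U v) = x :=
      Sigma.ext rfl (heq_of_eq (hp'.symm.trans hp))
    rwa [← this]

theorem card_baseSimplex (h : ρ ∈ completion U) : (baseSimplex ρ).card = ρ.card := by
  obtain ⟨-, σ, hσ, h⟩ := mem_completion.1 h
  refine Finset.card_image_of_injOn fun x hx y hy hxy => ?_
  obtain ⟨v, p⟩ := x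
  obtain ⟨w, q⟩ := y
  dsimp only at hxy
  subst hxy
  obtain ⟨hv, hp⟩ := mem_completionSimplex.1 (h hx)
  obtain ⟨hw, hq⟩ := mem_completionSimplex.1 (h hy)
  exact Sigma.ext rfl (heq_of_eq (hp.symm.trans hq))

theorem eq_of_baseSimplex_eq {hσ : σ ∈ U} (h : ρ ⊆ completionSimplex U ⟨σ, hσ⟩)
    (h' : ρ' ⊆ completionSimplex U ⟨σ, hσ⟩) (he : baseSimplex ρ = baseSimplex ρ') : ρ = ρ' := by
  ext x
  rw [mem_iff_of_subset h, mem_iff_of_subset h', he]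

theorem exists_baseSimplex_eq (hσ : σ ∈ U) {s : Finset ℕ} (hs : s ⊆ σ) (hn : s.Nonempty) :
    ∃ ρ ∈ completion U, baseSimplex ρ = s ∧ ρ ⊆ completionSimplex U ⟨σ, hσ⟩ := by
  classical
  have hsub := Finset.filter_subset (fun x => x.1 ∈ s) (completionSimplex U ⟨σ, hσ⟩)
  have hb : baseSimplex ((completionSimplex U ⟨σ, hσ⟩).filter fun x => x.1 ∈ s) = s := by
    ext v
    rw [mem_baseSimplex]
    constructor
    · rintro ⟨p, hp⟩
      exact (Finset.mem_filter.1 hp).2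
    · exact fun hv => ⟨localPiece hσ (hs hv),
        Finset.mem_filter.2 ⟨mem_completionSimplex.2 ⟨hs hv, rfl⟩, hv⟩⟩
  refine ⟨_, mem_completion.2 ⟨?_, σ, hσ, hsub⟩, hb, hsub⟩
  obtain ⟨v, hv⟩ := hn
  rw [← hb] at hv
  obtain ⟨p, hp⟩ := mem_baseSimplex.1 hv
  exact ⟨_, hp⟩

/-- The simplices of the completion which do not lie over `U`. -/
def completionBoundary (U : Set (Finset ℕ)) : Set (Finset (Σ v : ℕ, LocalPieces U v)) :=
  {ρ | ρ ∈ completion U ∧ baseSimplex ρ ∉ U}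

/-- Completing adds only boundary: a simplex of the completion that lies over a member of `U` is
determined by that member, because its vertices are the local pieces of that member itself. So this
part of the completion is a copy of `U`. -/
theorem eulerChar_completion (hne : ∀ σ ∈ U, σ.Nonempty) (hf : (completion U).faces.Finite) :
    eulerChar (completion U).faces = eulerChar U + eulerChar (completionBoundary U) := by
  set I : Set (Finset (Σ v : ℕ, LocalPieces U v)) := {ρ | ρ ∈ completion U ∧ baseSimplex ρ ∈ U}
  have hun : (completion U).faces = I ∪ completionBoundary U := by
    ext ρ
    change ρ ∈ completion U ↔ (ρ ∈ completion U ∧ _) ∨ (ρ ∈ completion U ∧ _)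
    tauto
  have hinj : Set.InjOn baseSimplex I := by
    rintro ρ ⟨hρ, hb⟩ ρ' ⟨hρ', hb'⟩ he
    obtain ⟨-, σ, hσ, h⟩ := mem_completion.1 hρ
    obtain ⟨-, σ', hσ', h'⟩ := mem_completion.1 hρ'
    ext x
    rw [mem_iff_of_subset h, mem_iff_of_subset h', ← he]
    refine and_congr_right fun hx => ?_
    have e1 := localPiece_eq_of_subset hb hσ (baseSimplex_subset h) hx
    have hs' : baseSimplex ρ ⊆ σ' := he ▸ baseSimplex_subset h'
    have e2 := localPiece_eq_of_subset hb hσ' hs' hx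
    constructor
    · rintro ⟨hv, hp⟩
      exact ⟨hs' hx, by rw [← hp, ← e1, ← e2]⟩
    · rintro ⟨hv, hp⟩
      exact ⟨baseSimplex_subset h hx, by rw [← hp, ← e1, ← e2]⟩
  have him : baseSimplex '' I = U := by
    ext s
    constructor
    · rintro ⟨ρ, hρ, rfl⟩
      exact hρ.2
    · intro hs
      obtain ⟨ρ, hρ, hb, -⟩ := exists_baseSimplex_eq hs (Finset.Subset.refl s) (hne s hs)
      exact ⟨ρ, ⟨hρ, hb.symm ▸ hs⟩, hb⟩
  have hI := eulerChar_image hinj fun ρ hρ => card_baseSimplex hρ.1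
  rw [him] at hI
  rw [hun, eulerChar_union, hI]
  · exact Set.disjoint_left.2 fun ρ h h' => h'.2 h.2
  · exact hf.subset fun ρ h => h.1
  · exact hf.subset fun ρ h => h.1

end completion

/-! ### The boundary of the completion of a region -/

namespace IsSimplePolyhedron

variable {L : PreAbstractSimplicialComplex ℕ}

/-- The boundary vertices of the completion of a region are singular. -/
theorem isSingularVertex_of_region {R : Region L} {σ : Finset ℕ} (hσ : σ ∈ R.simplices) {v : ℕ}
    (hv : v ∈ σ) (hvR : {v} ∉ R.simplices) : IsSingularVertex L v := by
  have hvL := singleton_mem_of_mem hσ.1.1 hv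
  by_contra h
  have hr : {v} ∈ regularSet L := ⟨hvL, fun h' => h (singleton_mem_singularSet.1 h')⟩
  exact hvR ((Pieces.mem_simplices_iff_of_subset hr hσ.1 (by simpa using hv)).2 hσ)

theorem mem_singularSet_of_region {R : Region L} {σ s : Finset ℕ} (hσ : σ ∈ R.simplices)
    (hs : s ⊆ σ) (hn : s.Nonempty) (hsR : s ∉ R.simplices) : s ∈ singularSet L := by
  by_contra h
  have hr : s ∈ regularSet L := ⟨mem_of_subset hσ.1.1 hs hn, h⟩
  exact hsR ((Pieces.mem_simplices_iff_of_subset hr hσ.1 hs).2 hσ)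

/-- Simplices of a region which are connected near the singular vertex `v` lie on the same arc of
its link. -/
theorem col_eq_of_localPiece_eq (hL : IsSimplePolyhedron L) {R : Region L} {v j : ℕ}
    {col : Finset ℕ → Finset ℕ} (hcol : ArcColoring (vertexLink L v) col j)
    (hvR : {v} ∉ R.simplices) {σ τ : Finset ℕ} (hσ : σ ∈ R.simplices) (hτ : τ ∈ R.simplices)
    (hvσ : v ∈ σ) (hvτ : v ∈ τ) (h : localPiece hσ hvσ = localPiece hτ hvτ) :
    col (σ.erase v) = col (τ.erase v) := by
  refine Pieces.eq_of_forall_subset (U := {σ | σ ∈ R.simplices ∧ v ∈ σ})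
    (f := fun σ => col (σ.erase v)) (c := localPiece hσ hvσ) ?_ ⟨⟨hσ, hvσ⟩, rfl⟩
    ⟨⟨hτ, hvτ⟩, h.symm⟩
  intro σ hσ τ hτ hst
  refine hL.col_erase_eq hcol hσ.1.1 hτ.1.1 hσ.2 ?_ hst
  rintro rfl
  exact hvR hσ.1

/-- Going along an arc of the link through vertices of degree two never leaves the region or the
local piece. With `col_eq_of_localPiece_eq` this identifies the points of the completion over `v`
with the arcs of the link that lie in the region. -/
theorem localPiece_eq_of_col_eq (hL : IsSimplePolyhedron L) {R : Region L} {v j : ℕ}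
    {col : Finset ℕ → Finset ℕ} (hcol : ArcColoring (vertexLink L v) col j)
    (hvR : {v} ∉ R.simplices) {σ τ : Finset ℕ} (hσ : σ ∈ R.simplices) (hτ : τ ∈ regularSet L)
    (hvσ : v ∈ σ) (hvτ : v ∈ τ) (hτv : τ ≠ {v}) (h : col (σ.erase v) = col (τ.erase v)) :
    ∃ hτR : τ ∈ R.simplices, localPiece hτR hvτ = localPiece hσ hvσ := by
  have hσv : σ ≠ {v} := by
    rintro rfl
    exact hvR hσ
  suffices key : τ ∈ {τ | ∃ hτ : τ ∈ R.simplices, ∃ hv : v ∈ τ,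
      localPiece hτ hv = localPiece hσ hvσ} by
    obtain ⟨h₁, _, h₂⟩ := key
    exact ⟨h₁, h₂⟩
  refine hL.mem_of_col_erase_eq hcol ?_ hσ.1 hτ hvσ hvτ hσv hτv h
    ⟨hσ, hvσ, rfl⟩
  intro μ hμ ν hν hvμ hμv hμν
  have hm := Pieces.mem_simplices_iff_of_subset (c := R) hμ hν hμν
  constructor
  · rintro ⟨hμR, hv, he⟩
    refine ⟨hm.1 hμR, hμν hv, ?_⟩
    rw [← he]
    exact (localPiece_eq_of_subset hμR (hm.1 hμR) hμν hv).symm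
  · rintro ⟨hνR, hv, he⟩
    refine ⟨hm.2 hνR, hvμ, ?_⟩
    rw [← he]
    exact localPiece_eq_of_subset (hm.2 hνR) hνR hμν hvμ

/-- A boundary vertex of the completion of a region lies on two boundary edges. -/
theorem ncard_boundary_edges (hL : IsSimplePolyhedron L) {R : Region L}
    {ρ : Finset (Σ v : ℕ, LocalPieces R.simplices v)} (hρ : ρ ∈ completionBoundary R.simplices)
    (h1 : ρ.card = 1) :
    {ρ' | (ρ' ∈ completionBoundary R.simplices ∧ ρ'.card = 2) ∧ ρ ⊆ ρ'}.ncard = 2 := by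
  obtain ⟨⟨v, p⟩, rfl⟩ := Finset.card_eq_one.1 h1
  have hvR : {v} ∉ R.simplices := by
    have := hρ.2
    rwa [baseSimplex, Finset.image_singleton] at this
  obtain ⟨-, σ, hσ, hsub⟩ := mem_completion.1 hρ.1
  obtain ⟨hvσ, hp⟩ := mem_completionSimplex.1 (hsub (Finset.mem_singleton_self _))
  dsimp only at hvσ hp
  have hv := isSingularVertex_of_region hσ hvσ hvR
  obtain ⟨k, -, -, -, col, hcol, -⟩ := hv.isArcGraph
  obtain ⟨t₀, ht₀, h3, hst⟩ := hL.exists_triangle hσ.1.1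
  have ht₀R : t₀ ∈ R.simplices := (Pieces.mem_simplices_iff_of_subset hσ.1
    (mem_regularSet_of_card_three ht₀ h3) hst).1 hσ
  have hp₀ : localPiece ht₀R (hst hvσ) = p := by
    rw [← hp]
    exact (localPiece_eq_of_subset hσ ht₀R hst hvσ).symm
  have hce := Finset.card_erase_add_one (hst hvσ)
  -- The arc of the link that belongs to the point `p` has two ends. The boundary edges at that
  -- point are going to be matched with them through their base simplices.
  have hends := hcol.ends _ (erase_mem_vertexLink ht₀ (hst hvσ) (by omega)) (by omega)
  set E := {x | x ∈ trivalentVertices (vertexLink L v) ∧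
    ∃ y ∈ cofaceVertices (vertexLink L v) {x}, col {y, x} = col (t₀.erase v)}
  set B := {ρ' | (ρ' ∈ completionBoundary R.simplices ∧ ρ'.card = 2) ∧
    {(⟨v, p⟩ : Σ v : ℕ, LocalPieces R.simplices v)} ⊆ ρ'}
  -- the triangle to which a boundary edge belongs
  have key : ∀ ρ' ∈ B, ∃ x y, ∃ ht : {v, y, x} ∈ R.simplices, x ∈ trivalentVertices (vertexLink L v) ∧
      y ∈ cofaceVertices (vertexLink L v) {x} ∧ col {y, x} = col (t₀.erase v) ∧
      baseSimplex ρ' = {v, x} ∧ ρ' ⊆ completionSimplex _ ⟨_, ht⟩ := by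
    rintro ρ' ⟨⟨⟨hρ', hb⟩, h2⟩, hvρ⟩
    obtain ⟨-, τ, hτ, hτs⟩ := mem_completion.1 hρ'
    have hbc : (baseSimplex ρ').card = 2 := (card_baseSimplex hρ').trans h2
    have hvb : v ∈ baseSimplex ρ' := mem_baseSimplex.2 ⟨p, hvρ (by simp)⟩
    have hbτ := baseSimplex_subset hτs
    have hbs := mem_singularSet_of_region hτ hbτ ⟨v, hvb⟩ hb
    have hτ3 : τ.card = 3 := by
      have h1 := hL.card_le τ hτ.1.1
      have h2 := Finset.card_le_card hbτ
      by_contra h'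
      exact hb ((Finset.eq_of_subset_of_card_le hbτ (by omega)) ▸ hτ)
    obtain ⟨x, hvx, hbx⟩ := eq_pair_of_mem hbc hvb
    have hvτ := hbτ hvb
    have hxτ : x ∈ τ.erase v := Finset.mem_erase.2 ⟨hvx.symm, hbτ (by rw [hbx]; simp)⟩
    have hτe := Finset.card_erase_add_one hvτ
    obtain ⟨y, hxy, hy⟩ := eq_pair_of_mem (by omega) hxτ
    rw [Finset.pair_comm] at hy
    have hτv : {v, y, x} = τ := by rw [← hy, Finset.insert_erase hvτ]
    subst hτv
    refine ⟨x, y, hτ, mem_trivalentVertices_vertexLink.2 ⟨hvx, hbx ▸ hbs⟩, ?_, ?_, hbx, hτs⟩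
    · rw [mem_cofaceVertices_singleton, ← hy]
      exact ⟨hxy.symm, erase_mem_vertexLink hτ.1.1 hvτ (by omega)⟩
    · obtain ⟨hv', hp'⟩ := mem_completionSimplex.1 (hτs (hvρ (Finset.mem_singleton_self _)))
      rw [← hy]
      exact hL.col_eq_of_localPiece_eq hcol hvR hτ ht₀R hvτ (hst hvσ) (hp'.trans hp₀.symm)
  have hinj : Set.InjOn baseSimplex B := by
    intro ρ₁ h₁ ρ₂ h₂ he
    obtain ⟨x, y, ht, hx, hy, hc, hb, hs⟩ := key ρ₁ h₁
    obtain ⟨x', y', ht', hx', hy', hc', hb', hs'⟩ := key ρ₂ h₂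
    have hxx : x = x' := by
      have hvx := (mem_trivalentVertices_vertexLink.1 hx).1
      have : x ∈ ({v, x'} : Finset ℕ) := by rw [← hb', ← he, hb]; simp
      simpa [hvx.symm] using this
    subst hxx
    have hyy : y = y' := by
      -- At a vertex of degree three distinct segments have distinct colours, so the end `x` and the
      -- colour of the arc determine the triangle over which the boundary edge lies.
      rcases hcol.vertex x (trivalentVertices_subset _ hx) with h | h
      · have : (cofaceVertices (vertexLink L v) {x}).ncard = 3 := hx
        omega
      · exact h.2 y hy y' hy' (hc.trans hc'.symm)
    subst hyy
    exact eq_of_baseSimplex_eq hs hs' he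
  have him : baseSimplex '' B = (fun x => ({v, x} : Finset ℕ)) '' E := by
    ext s
    constructor
    · rintro ⟨ρ', h', rfl⟩
      obtain ⟨x, y, ht, hx, hy, hc, hb, hs⟩ := key ρ' h'
      exact ⟨x, ⟨hx, y, hy, hc⟩, hb.symm⟩
    · rintro ⟨x, ⟨hx, y, hy, hc⟩, rfl⟩
      have hx' := mem_trivalentVertices_vertexLink.1 hx
      have hy' := mem_cofaceVertices_singleton.1 hy
      have hc3 : ({v, y, x} : Finset ℕ).card = 3 := by
        rw [Finset.card_insert_of_notMem hy'.2.2.1, Finset.card_pair hy'.1]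
      have hreg := mem_regularSet_of_card_three hy'.2.2.2 hc3
      obtain ⟨htR, hte⟩ := hL.localPiece_eq_of_col_eq hcol hvR ht₀R hreg (hst hvσ)
        (Finset.mem_insert_self v _) (fun h => by rw [h] at hc3; simp at hc3)
        (by rw [Finset.erase_insert hy'.2.2.1, hc])
      obtain ⟨ρ', hρ', hb, hs⟩ := exists_baseSimplex_eq htR (s := {v, x})
        (Finset.insert_subset_insert v (by simp)) (Finset.insert_nonempty _ _)
      refine ⟨ρ', ⟨⟨⟨hρ', ?_⟩, ?_⟩, ?_⟩, hb⟩
      · rw [hb]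
        exact fun h => h.1.2 hx'.2
      · rw [← card_baseSimplex hρ', hb, Finset.card_pair hx'.1]
      · rw [Finset.singleton_subset_iff, mem_iff_of_subset hs, hb]
        exact ⟨by simp, by simp, hte.trans hp₀⟩
  rw [← hinj.ncard_image, him, Set.InjOn.ncard_image, hends]
  intro x hx x' _ he
  have hvx := (mem_trivalentVertices_vertexLink.1 hx.1).1
  have : x ∈ ({v, x'} : Finset ℕ) := by
    dsimp only at he
    rw [← he]; simp
  simpa [hvx.symm] using this

/-- The boundary is a graph in which every vertex lies on two edges, so it has as many vertices as
edges. -/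
theorem eulerChar_completionBoundary (hL : IsSimplePolyhedron L) (R : Region L)
    (hf : (completion R.simplices).faces.Finite) :
    eulerChar (completionBoundary R.simplices) = 0 := by
  classical
  set D := completionBoundary R.simplices with hD
  have hDf : D.Finite := hf.subset fun ρ h => h.1
  set D₁ := {ρ | ρ ∈ D ∧ ρ.card = 1}
  set D₂ := {ρ | ρ ∈ D ∧ ρ.card = 2}
  have hf₁ : D₁.Finite := hDf.subset fun ρ h => h.1
  have hf₂ : D₂.Finite := hDf.subset fun ρ h => h.1
  have hun : D = D₁ ∪ D₂ := by
    ext ρ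
    refine ⟨fun h => ?_, fun h => h.elim And.left And.left⟩
    have hc := card_baseSimplex h.1
    obtain ⟨hn, σ, hσ, hs⟩ := mem_completion.1 h.1
    have h1 := hL.card_le σ hσ.1.1
    have hbs := baseSimplex_subset hs
    have h2 := Finset.card_le_card hbs
    have h3 := hn.card_pos
    by_cases h' : ρ.card = 3
    · exact absurd ((Finset.eq_of_subset_of_card_le hbs (by omega)) ▸ hσ) h.2
    · rcases (show ρ.card = 1 ∨ ρ.card = 2 by omega) with h' | h'
      · exact Or.inl ⟨h, h'⟩
      · exact Or.inr ⟨h, h'⟩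
  have hdisj : Disjoint D₁ D₂ := Set.disjoint_left.2 fun ρ h h' => by
    have h1 := h.2
    have h2 := h'.2
    omega
  have hcount : hf₁.toFinset.card * 2 = hf₂.toFinset.card * 2 := by
    refine Finset.card_mul_eq_card_mul (fun ρ ρ' => ρ ⊆ ρ') (fun ρ hρ => ?_) fun ρ' hρ' => ?_
    · rw [hf₁.mem_toFinset] at hρ
      rw [← hL.ncard_boundary_edges hρ.1 hρ.2, ← Set.ncard_coe_finset]
      congr 1
      ext ρ'
      simp only [Finset.bipartiteAbove, Finset.coe_filter, Set.Finite.mem_toFinset,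
        Set.mem_ofPred_eq]
      rfl
    · rw [hf₂.mem_toFinset] at hρ'
      rw [← hρ'.2, ← Finset.card_map (s := ρ')
        ⟨fun x => ({x} : Finset _), Finset.singleton_injective⟩]
      refine congrArg Finset.card (Finset.ext fun ρ => ?_)
      simp only [Finset.bipartiteBelow, Finset.mem_filter, Set.Finite.mem_toFinset,
        Finset.mem_map, Function.Embedding.coeFn_mk]
      constructor
      · rintro ⟨⟨-, h1⟩, hs⟩
        obtain ⟨x, rfl⟩ := Finset.card_eq_one.1 h1
        exact ⟨x, by simpa using hs, rfl⟩
      · rintro ⟨x, hx, rfl⟩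
        have hs : {x} ⊆ ρ' := by simpa using hx
        have hρc := mem_completion.1 hρ'.1.1
        obtain ⟨-, σ, hσ, hσs⟩ := hρc
        refine ⟨⟨⟨mem_completion.2 ⟨Finset.singleton_nonempty x, σ, hσ, hs.trans hσs⟩, ?_⟩,
          Finset.card_singleton x⟩, hs⟩
        have hxb : x.1 ∈ baseSimplex ρ' := mem_baseSimplex.2 ⟨x.2, hx⟩
        have hsing := mem_singularSet_of_region hσ (baseSimplex_subset hσs) ⟨x.1, hxb⟩ hρ'.1.2
        have hxs := singleton_mem_singularSet.2 (hL.isSingularVertex_of_mem hsing hxb)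
        rw [baseSimplex, Finset.image_singleton]
        exact fun h => h.1.2 hxs
  rw [hun, eulerChar_union hdisj hf₁ hf₂, eulerChar_of_card hf₁ (k := 1) fun ρ h => h.2,
    eulerChar_of_card hf₂ (k := 2) fun ρ h => h.2, Set.ncard_eq_toFinset_card _ hf₁,
    Set.ncard_eq_toFinset_card _ hf₂]
  have : hf₁.toFinset.card = hf₂.toFinset.card := by omega
  rw [this]
  ring

end IsSimplePolyhedron

/-- The closed disk has Euler characteristic `1`, of which its boundary contributes `0`. -/
theorem IsSpecialPolyhedron.eulerChar_region {L : PreAbstractSimplicialComplex ℕ}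
    (hL : IsSpecialPolyhedron L) (R : Region L) : eulerChar R.simplices = 1 := by
  obtain ⟨hf, h⟩ := (hL.region_disk R).finite_and_eulerChar (stdSimplexComplex_finite 2)
  rw [eulerChar_stdSimplexComplex, eulerChar_completion (fun σ h => nonempty_of_mem h.1.1) hf,
    hL.simple.eulerChar_completionBoundary R hf, add_zero] at h
  exact h

end

noncomputable section

open PreAbstractSimplicialComplex

/-! ### Edges -/

/-- The simplices of the edges. -/
abbrev edgeSet (L : PreAbstractSimplicialComplex ℕ) : Set (Finset ℕ) :=
  {σ | σ ∈ singularSet L ∧ ¬ ∃ v, σ = {v} ∧ IsTrueVertex L v}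

variable {L : PreAbstractSimplicialComplex ℕ}

theorem mem_edgeSet_of_card_two {s : Finset ℕ} (hs : s ∈ singularSet L) (h2 : s.card = 2) :
    s ∈ edgeSet L :=
  ⟨hs, by rintro ⟨v, rfl, -⟩; simp at h2⟩

theorem singleton_mem_edgeSet {v : ℕ} : {v} ∈ edgeSet L ↔ IsTripleVertex L v := by
  constructor
  · rintro ⟨h, h'⟩
    exact (singleton_mem_singularSet.1 h).resolve_right fun h => h' ⟨v, rfl, h⟩
  · intro h
    refine ⟨singleton_mem_singularSet.2 (Or.inl h), ?_⟩
    rintro ⟨w, hw, h'⟩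
    rw [← Finset.singleton_injective hw] at h'
    exact h.not_isTrueVertex h'

/-- The segments on an edge. -/
def Edge.segments (e : Edge L) : Set (Finset ℕ) := {s | s ∈ e.simplices ∧ s.card = 2}

/-- The vertices in the interior of an edge. -/
def Edge.vertices (e : Edge L) : Set (Finset ℕ) := {s | s ∈ e.simplices ∧ s.card = 1}

theorem Edge.singleton_mem_iff {e : Edge L} {s : Finset ℕ} (hs : s ∈ e.simplices) {v : ℕ}
    (hv : v ∈ s) : {v} ∈ e.simplices ↔ IsTripleVertex L v := by
  refine ⟨fun h => singleton_mem_edgeSet.1 h.1, fun h => ?_⟩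
  have hv' := singleton_mem_edgeSet.2 h
  exact (Pieces.mem_simplices_iff_of_subset hv' hs.1 (by simpa using hv)).2 hs

namespace IsSimplePolyhedron

theorem ncard_segments_edge {e : Edge L} {v : ℕ} (hv : {v} ∈ e.simplices) :
    {s | s ∈ e.segments ∧ v ∈ s}.ncard = 2 := by
  have ht := singleton_mem_edgeSet.1 hv.1
  rw [← ncard_segments_of_isTripleVertex ht]
  congr 1
  ext s
  constructor
  · rintro ⟨⟨hs, h2⟩, hvs⟩
    exact ⟨hs.1.1, h2, hvs⟩
  · rintro ⟨hs, h2, hvs⟩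
    exact ⟨⟨(Pieces.mem_simplices_iff_of_subset hv.1 (mem_edgeSet_of_card_two hs h2)
      (by simpa using hvs)).1 hv, h2⟩, hvs⟩

theorem edge_simplices_eq (e : Edge L) : e.simplices = e.vertices ∪ e.segments := by
  ext σ
  constructor
  · intro h
    exact (card_of_mem_singularSet h.1.1).imp (fun h' => ⟨h, h'⟩) fun h' => ⟨h, h'⟩
  · rintro (h | h) <;> exact h.1

theorem edgeSet_finite (hL : IsSimplePolyhedron L) : (edgeSet L).Finite :=
  hL.1.subset fun _ h => h.1.1

theorem edge_finite (hL : IsSimplePolyhedron L) (e : Edge L) : e.simplices.Finite :=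
  hL.edgeSet_finite.subset e.simplices_subset

/-- Near an end of an edge the edge consists of a single segment. -/
theorem eq_of_localPiece_eq_edge {e : Edge L} {v : ℕ}
    (hv : {v} ∉ e.simplices) {s t : Finset ℕ} (hs : s ∈ e.simplices) (ht : t ∈ e.simplices)
    (hvs : v ∈ s) (hvt : v ∈ t) (h : localPiece hs hvs = localPiece ht hvt) : s = t := by
  have h2 : ∀ s ∈ e.simplices, v ∈ s → s.card = 2 := fun s hs hvs =>
    (card_of_mem_singularSet hs.1.1).resolve_left fun h1 => by
      obtain ⟨x, rfl⟩ := Finset.card_eq_one.1 h1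
      rw [Finset.mem_singleton] at hvs
      exact hv (hvs ▸ hs)
  refine Pieces.eq_of_forall_subset (U := {σ | σ ∈ e.simplices ∧ v ∈ σ}) (f := id)
    (c := localPiece hs hvs) ?_ ⟨⟨hs, hvs⟩, rfl⟩ ⟨⟨ht, hvt⟩, h.symm⟩
  rintro s ⟨hs, hvs⟩ t ⟨ht, hvt⟩ hst
  exact Finset.eq_of_subset_of_card_le hst ((h2 t ht hvt).trans (h2 s hs hvs).symm).le

/-- Count the pairs of a segment of the edge and an end of it: two at each interior vertex, and one
at each boundary point of the completion, because near such a point the edge is a single segment. -/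
theorem two_mul_ncard_segments (hL : IsSimplePolyhedron L) (e : Edge L) :
    2 * e.segments.ncard = 2 * e.vertices.ncard + (completionBoundary e.simplices).ncard := by
  classical
  have hfs : e.segments.Finite := (hL.edge_finite e).subset fun _ h => h.1
  have hfv : e.vertices.Finite := (hL.edge_finite e).subset fun _ h => h.1
  set P : Finset (Σ _ : Finset ℕ, ℕ) := hfs.toFinset.sigma fun s => s with hPdef
  have hmem : ∀ x, x ∈ P ↔ (x.1 ∈ e.simplices ∧ x.1.card = 2) ∧ x.2 ∈ x.1 := fun x => by
    rw [hPdef, Finset.mem_sigma, Set.Finite.mem_toFinset]; rfl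
  have hP : P.card = 2 * e.segments.ncard := by
    rw [hPdef, Finset.card_sigma, Finset.sum_congr rfl fun s hs => (hfs.mem_toFinset.1 hs).2,
      Finset.sum_const, smul_eq_mul, mul_comm, Set.ncard_eq_toFinset_card _ hfs]
  have hsplit := Finset.card_filter_add_card_filter_not (s := P) fun x => {x.2} ∈ e.simplices
  have hin : (P.filter fun x => {x.2} ∈ e.simplices).card = 2 * e.vertices.ncard := by
    rw [Finset.card_eq_sum_card_fiberwise (f := fun x => ({x.2} : Finset ℕ)) (t := hfv.toFinset),
      Finset.sum_congr rfl (g := fun _ => 2), Finset.sum_const, smul_eq_mul, mul_comm,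
      Set.ncard_eq_toFinset_card _ hfv]
    · intro σ hσ
      obtain ⟨hσ, h1⟩ := hfv.mem_toFinset.1 hσ
      obtain ⟨v, rfl⟩ := Finset.card_eq_one.1 h1
      rw [← ncard_segments_edge hσ, ← Set.ncard_coe_finset]
      rw [← Set.InjOn.ncard_image (f := Sigma.fst)]
      · congr 1
        ext s
        simp only [Finset.coe_filter, Finset.mem_filter, hmem, Set.mem_image, Set.mem_ofPred_eq,
          Finset.singleton_inj]
        constructor
        · rintro ⟨⟨s, w⟩, ⟨⟨h, h'⟩, rfl⟩, rfl⟩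
          exact h
        · intro h
          exact ⟨⟨s, v⟩, ⟨⟨h, hσ⟩, rfl⟩, rfl⟩
      · rintro ⟨s, w⟩ h ⟨s', w'⟩ h' he
        simp only [Finset.coe_filter, Set.mem_ofPred_eq, Finset.singleton_inj] at h h'
        obtain rfl : s = s' := he
        rw [h.2, h'.2]
    · intro x hx
      rw [Finset.mem_coe, Finset.mem_filter] at hx
      exact hfv.mem_toFinset.2 ⟨hx.2, Finset.card_singleton _⟩
  have hout : (P.filter fun x => {x.2} ∉ e.simplices).card =
      (completionBoundary e.simplices).ncard := by
    rw [← Set.ncard_coe_finset]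
    refine Set.ncard_congr (fun x hx =>
      {⟨x.2, localPiece ((hmem x).1 (Finset.mem_filter.1 hx).1).1.1
        ((hmem x).1 (Finset.mem_filter.1 hx).1).2⟩}) ?_ ?_ ?_
    · rintro ⟨s, v⟩ hx
      obtain ⟨hs, hv⟩ := Finset.mem_filter.1 hx
      obtain ⟨⟨hs, h2⟩, hvs⟩ := (hmem _).1 hs
      refine ⟨mem_completion.2 ⟨Finset.singleton_nonempty _, s, hs, ?_⟩, ?_⟩
      · rw [Finset.singleton_subset_iff]
        exact mem_completionSimplex.2 ⟨hvs, rfl⟩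
      · rw [baseSimplex, Finset.image_singleton]
        exact hv
    · rintro ⟨s, v⟩ ⟨t, w⟩ hx hy he
      obtain ⟨hs, hv⟩ := Finset.mem_filter.1 hx
      obtain ⟨⟨hs, h2⟩, hvs⟩ := (hmem _).1 hs
      obtain ⟨ht, hw⟩ := Finset.mem_filter.1 hy
      obtain ⟨⟨ht, h2'⟩, hwt⟩ := (hmem _).1 ht
      obtain ⟨hvw, he⟩ := Sigma.mk.inj_iff.1 (Finset.singleton_injective he)
      dsimp only at hvw
      subst hvw
      obtain rfl := eq_of_localPiece_eq_edge hv hs ht hvs hwt (eq_of_heq he)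
      rfl
    · rintro ρ ⟨hρ, hb⟩
      obtain ⟨hn, s, hs, hsub⟩ := mem_completion.1 hρ
      have hbs := baseSimplex_subset hsub
      have hcb := card_baseSimplex hρ
      have hpos := hn.card_pos
      have hle := Finset.card_le_card hbs
      have hs2 : s.card = 2 := (card_of_mem_singularSet hs.1.1).resolve_left fun h1 =>
        hb ((Finset.eq_of_subset_of_card_le hbs (by omega)) ▸ hs)
      have hρ1 : ρ.card = 1 := by
        by_contra h
        exact hb ((Finset.eq_of_subset_of_card_le hbs (by omega)) ▸ hs)
      obtain ⟨⟨v, p⟩, rfl⟩ := Finset.card_eq_one.1 hρ1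
      rw [baseSimplex, Finset.image_singleton] at hb
      obtain ⟨hv, hp⟩ := mem_completionSimplex.1 (hsub (Finset.mem_singleton_self _))
      refine ⟨⟨s, v⟩, Finset.mem_filter.2 ⟨(hmem _).2 ⟨⟨hs, hs2⟩, hv⟩, hb⟩, ?_⟩
      rw [Finset.singleton_inj]
      exact Sigma.ext rfl (heq_of_eq hp)
  rw [← hP, ← hsplit, hin, hout]

end IsSimplePolyhedron

/-! ### The cell count of a special polyhedron -/

namespace IsSpecialPolyhedron

/-- Let there be `v` interior vertices, `s` segments and `b` boundary points. The completion is an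
arc, so `v - s + b = 1`, while counting ends gives `2 s = 2 v + b`. Eliminating `b` yields `s = v +
1`. -/
theorem ncard_segments (hL : IsSpecialPolyhedron L) (e : Edge L) :
    e.segments.ncard = e.vertices.ncard + 1 := by
  have hfs : e.segments.Finite := (hL.simple.edge_finite e).subset fun _ h => h.1
  have hfv : e.vertices.Finite := (hL.simple.edge_finite e).subset fun _ h => h.1
  obtain ⟨hf, h⟩ := (hL.edge_arc e).finite_and_eulerChar (stdSimplexComplex_finite 1)
  have hb : ∀ ρ ∈ completionBoundary e.simplices, ρ.card = 1 := by
    rintro ρ ⟨hρ, hb⟩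
    obtain ⟨hn, s, hs, hsub⟩ := mem_completion.1 hρ
    have hbs := baseSimplex_subset hsub
    have hcb := card_baseSimplex hρ
    have hpos := hn.card_pos
    have hle := Finset.card_le_card hbs
    have hs2 := card_of_mem_singularSet hs.1.1
    by_contra h
    exact hb ((Finset.eq_of_subset_of_card_le hbs (by omega)) ▸ hs)
  rw [eulerChar_stdSimplexComplex, eulerChar_completion (fun σ h => nonempty_of_mem h.1.1.1) hf,
    IsSimplePolyhedron.edge_simplices_eq e, eulerChar_union _ hfv hfs,
    eulerChar_of_card hfv (k := 1) fun _ h => h.2, eulerChar_of_card hfs (k := 2) fun _ h => h.2,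
    ← IsSimplePolyhedron.edge_simplices_eq e,
    eulerChar_of_card (hf.subset fun _ h => h.1) hb] at h
  · have := hL.simple.two_mul_ncard_segments e
    norm_num at h
    omega
  · exact Set.disjoint_left.2 fun σ h h' => by
      have h1 := h.2
      have h2 := h'.2
      omega

theorem eulerChar_edge (hL : IsSpecialPolyhedron L) (e : Edge L) :
    eulerChar e.simplices = -1 := by
  have hfs : e.segments.Finite := (hL.simple.edge_finite e).subset fun _ h => h.1
  have hfv : e.vertices.Finite := (hL.simple.edge_finite e).subset fun _ h => h.1
  rw [IsSimplePolyhedron.edge_simplices_eq e, eulerChar_union _ hfv hfs,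
    eulerChar_of_card hfv (k := 1) fun _ h => h.2, eulerChar_of_card hfs (k := 2) fun _ h => h.2,
    hL.ncard_segments e]
  · push_cast
    ring
  · exact Set.disjoint_left.2 fun σ h h' => by
      have h1 := h.2
      have h2 := h'.2
      omega

/-- Every edge contains a segment, so the choice in `Edge.segment` is a genuine one. -/
theorem segment_mem (hL : IsSpecialPolyhedron L) (e : Edge L) :
    e.segment ∈ e.simplices ∧ e.segment.card = 2 := by
  refine Classical.epsilon_spec (p := fun s => s ∈ e.simplices ∧ s.card = 2) ?_
  have : e.segments.Nonempty := by
    rw [Set.nonempty_iff_ne_empty]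
    intro h
    have := hL.ncard_segments e
    rw [h, Set.ncard_empty] at this
    omega
  exact this

/-- The Euler characteristic of a special polyhedron, computed from its cell structure. -/
theorem eulerChar_eq (hL : IsSpecialPolyhedron L) : eulerChar L.faces =
    Nat.card (Region L) - Nat.card (Edge L) + {v | IsTrueVertex L v}.ncard := by
  have hf := hL.simple.1
  have hfr : (regularSet L).Finite := hf.subset fun _ h => h.1
  have hfe := hL.simple.edgeSet_finite
  have hun : L.faces = (regularSet L ∪ edgeSet L) ∪ (fun v : ℕ => ({v} : Finset ℕ)) ''
      {v | IsTrueVertex L v} := by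
    ext σ
    constructor
    · intro h
      by_cases hs : σ ∈ singularSet L
      · by_cases hv : ∃ v, σ = {v} ∧ IsTrueVertex L v
        · obtain ⟨v, rfl, hv⟩ := hv
          exact Or.inr ⟨v, hv, rfl⟩
        · exact Or.inl (Or.inr ⟨hs, hv⟩)
      · exact Or.inl (Or.inl ⟨h, hs⟩)
    · rintro ((h | h) | ⟨v, h, rfl⟩)
      · exact h.1
      · exact h.1.1
      · exact h.1
  have hfv : ((fun v : ℕ => ({v} : Finset ℕ)) '' {v | IsTrueVertex L v}).Finite :=
    hf.subset fun σ h => by rw [hun]; exact Or.inr h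
  have := Pieces.finite hfr
  have := Pieces.finite hfe
  have hr : eulerChar (regularSet L) = Nat.card (Region L) := by
    have := Fintype.ofFinite (Region L)
    refine (Pieces.finsum_simplices hfr _).symm.trans
      ((finsum_congr fun R => hL.eulerChar_region R).trans ?_)
    rw [finsum_eq_sum_of_fintype]
    simp
  have he : eulerChar (edgeSet L) = -Nat.card (Edge L) := by
    have := Fintype.ofFinite (Edge L)
    refine (Pieces.finsum_simplices hfe _).symm.trans
      ((finsum_congr fun e => hL.eulerChar_edge e).trans ?_)
    rw [finsum_eq_sum_of_fintype]
    simp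
  rw [hun, eulerChar_union _ (hfr.union hfe) hfv, eulerChar_union _ hfr hfe, hr, he,
    eulerChar_of_card hfv (k := 1), Set.ncard_image_of_injective _ Finset.singleton_injective]
  · ring
  · rintro _ ⟨v, -, rfl⟩
    exact Finset.card_singleton v
  · exact Set.disjoint_left.2 fun σ h h' => h.2 h'.1
  · rw [Set.disjoint_left]
    rintro _ h ⟨v, hv, rfl⟩
    rcases h with h | h
    · exact h.2 (singleton_mem_singularSet.2 (Or.inr hv))
    · exact h.2 ⟨v, rfl, hv⟩

end IsSpecialPolyhedron

end

noncomputable section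

open PreAbstractSimplicialComplex

variable {L : PreAbstractSimplicialComplex ℕ}

/-! ### Maximal trees -/

theorem incidence_pair {p q : ℕ} (h : p ≠ q) :
    incidence {p, q} {p} + incidence {p, q} {q} = 0 := by
  have h1 : ({p, q} : Finset ℕ).erase p = {q} := Finset.erase_insert (by simpa using h)
  have h2 : ({p, q} : Finset ℕ).erase q = {p} := by
    rw [Finset.pair_comm]; exact Finset.erase_insert (by simpa using h.symm)
  unfold incidence
  rw [Finset.sum_pair h, Finset.sum_pair h, h1, h2]
  rcases lt_or_gt_of_ne h with h' | h' <;>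
    simp [Finset.filter_insert, Finset.filter_singleton, h, h.symm, h', h'.not_gt]

/-- Used for a cut of a graph: with `incidence_pair` the total is zero for a segment with both ends
or neither end in `C`, so only segments across the cut contribute. -/
theorem sum_incidence_pair {p q : ℕ} (h : p ≠ q) (C : Finset ℕ) :
    ∑ x ∈ C, incidence {p, q} {x} = (if p ∈ C then incidence {p, q} {p} else 0) +
      if q ∈ C then incidence {p, q} {q} else 0 := by
  rw [← Finset.sum_pair (f := fun x => if x ∈ C then incidence {p, q} {x} else 0) h,
    ← Finset.sum_filter, Finset.filter_mem_eq_inter, Finset.inter_comm]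
  symm
  refine Finset.sum_subset Finset.inter_subset_left fun x hx hx' => ?_
  by_contra hne
  refine hx' (Finset.mem_inter.2 ⟨hx, ?_⟩)
  simpa using (incidence_ne_zero_iff.1 hne).1

/-- The segments on the edges in `T`. -/
def segmentsOf (T : Set (Edge L)) : Set (Finset ℕ) := {s | s.card = 2 ∧ ∃ e ∈ T, s ∈ e.simplices}

/-- A vertex of a segment on an edge in `T` is a vertex of the graph formed by these edges. -/
theorem isVertex_of_mem_segment (hL : IsSimplePolyhedron L) {T : Set (Edge L)} {e : Edge L}
    (he : e ∈ T) {s : Finset ℕ} (hs : s ∈ e.simplices) {v : ℕ} (hv : v ∈ s) :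
    IsTrueVertex L v ∨ ∃ e ∈ T, {v} ∈ e.simplices := by
  rcases hL.isSingularVertex_of_mem hs.1.1 hv with h | h
  · exact Or.inr ⟨e, he, (Edge.singleton_mem_iff hs hv).2 h⟩
  · exact Or.inl h

theorem finite_edgeSubgraph_vertices (hL : IsSimplePolyhedron L) (T : Set (Edge L)) :
    {v | IsTrueVertex L v ∨ ∃ e ∈ T, {v} ∈ e.simplices}.Finite := by
  refine (hL.1.preimage (f := fun v : ℕ => ({v} : Finset ℕ))
    Finset.singleton_injective.injOn).subset ?_
  rintro v (h | ⟨e, -, h⟩)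
  · exact h.1
  · exact h.1.1.1

/-- A tree carries no 1-cycles. -/
theorem IsMaximalTree.eq_zero_of_chainBoundary_eq_zero (hL : IsSimplePolyhedron L)
    {T : Set (Edge L)} (hT : IsMaximalTree L T) {y : Finset ℕ →₀ ℚ}
    (hy : ∀ s, y s ≠ 0 → s ∈ segmentsOf T) (hb : chainBoundary y = 0) : y = 0 := by
  classical
  by_contra hne
  obtain ⟨s, hs⟩ := Finsupp.ne_iff.1 hne
  rw [Finsupp.zero_apply] at hs
  obtain ⟨h2, e, he, hse⟩ := hy s hs
  obtain ⟨a, b, hab, rfl⟩ := Finset.card_eq_two.1 h2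
  set G := edgeSubgraph L T
  have ha := isVertex_of_mem_segment hL he hse (Finset.mem_insert_self a _)
  have hb' := isVertex_of_mem_segment hL he hse (v := b) (by simp)
  have hadj : G.Adj ⟨a, ha⟩ ⟨b, hb'⟩ := ⟨fun h => hab (congrArg Subtype.val h), e, he, hse⟩
  -- Every edge of an acyclic graph is a bridge. Summing the boundary of `y` over the side of `a` in
  -- the cut at `{a, b}` leaves only the contribution of `{a, b}`, whose coefficient must therefore
  -- vanish.
  have hbr := SimpleGraph.isAcyclic_iff_forall_adj_isBridge.1 hT.isAcyclic hadj
  rw [SimpleGraph.isBridge_iff] at hbr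
  set G' := G.deleteEdges {s(⟨a, ha⟩, ⟨b, hb'⟩)}
  have hf : {x | ∃ h, G'.Reachable ⟨a, ha⟩ ⟨x, h⟩}.Finite :=
    (finite_edgeSubgraph_vertices hL T).subset fun x hx => hx.1
  have hCa : a ∈ hf.toFinset := hf.mem_toFinset.2 ⟨ha, SimpleGraph.Reachable.refl _⟩
  have hCb : b ∉ hf.toFinset := fun h => hbr (hf.mem_toFinset.1 h).2
  have hsum : ∑ x ∈ hf.toFinset, chainBoundary y {x} = 0 := by simp [hb]
  rw [Finset.sum_congr rfl fun x _ => chainBoundary_apply y (Finset.singleton_nonempty x)] at hsum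
  unfold Finsupp.sum at hsum
  rw [Finset.sum_comm, Finset.sum_eq_single ({a, b} : Finset ℕ), ← Finset.mul_sum, ← Int.cast_sum,
    sum_incidence_pair hab, if_pos hCa, if_neg hCb, add_zero] at hsum
  · have : incidence {a, b} {a} ≠ 0 :=
      incidence_ne_zero_iff.2 ⟨by simp, by rw [h2, Finset.card_singleton]⟩
    rcases mul_eq_zero.1 hsum with h | h
    · exact hs h
    · exact this (by exact_mod_cast h)
  · intro τ hτ hne
    obtain ⟨h2', e', he', hτe⟩ := hy τ (Finsupp.mem_support_iff.1 hτ)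
    obtain ⟨p, q, hpq, rfl⟩ := Finset.card_eq_two.1 h2'
    have hp := isVertex_of_mem_segment hL he' hτe (Finset.mem_insert_self p _)
    have hq := isVertex_of_mem_segment hL he' hτe (v := q) (by simp)
    have hadj' : G'.Adj ⟨p, hp⟩ ⟨q, hq⟩ := by
      rw [SimpleGraph.deleteEdges_adj]
      refine ⟨⟨fun h => hpq (congrArg Subtype.val h), e', he', hτe⟩, fun h => hne ?_⟩
      rw [Set.mem_singleton_iff, Sym2.eq_iff] at h
      rcases h with ⟨h, h'⟩ | ⟨h, h'⟩
      · rw [show p = a from congrArg Subtype.val h, show q = b from congrArg Subtype.val h']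
      · rw [show p = b from congrArg Subtype.val h, show q = a from congrArg Subtype.val h',
          Finset.pair_comm]
    have hiff : p ∈ hf.toFinset ↔ q ∈ hf.toFinset := by
      rw [hf.mem_toFinset, hf.mem_toFinset]
      exact ⟨fun h => ⟨hq, h.2.trans hadj'.reachable⟩,
        fun h => ⟨hp, h.2.trans hadj'.symm.reachable⟩⟩
    rw [← Finset.mul_sum, ← Int.cast_sum, sum_incidence_pair hpq]
    by_cases h : p ∈ hf.toFinset
    · rw [if_pos h, if_pos (hiff.1 h), incidence_pair hpq, Int.cast_zero, mul_zero]
    · rw [if_neg h, if_neg (mt hiff.2 h), add_zero, Int.cast_zero, mul_zero]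
  · intro h
    exact absurd (Finsupp.notMem_support_iff.1 h) hs

/-- The number of edges of the graph is the number of segments. -/
theorem ncard_segmentsOf_eq (hL : IsSimplePolyhedron L) (T : Set (Edge L)) :
    (segmentsOf T).ncard = Nat.card (edgeSubgraph L T).edgeSet := by
  classical
  set f : Sym2 {v : ℕ // IsTrueVertex L v ∨ ∃ e ∈ T, {v} ∈ e.simplices} → Finset ℕ :=
    fun z => (z.map Subtype.val).toFinset
  have hfp : ∀ u v, f s(u, v) = {u.1, v.1} := fun u v => by
    ext x
    simp [f]
  have hinj : Function.Injective f := by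
    intro z z' h
    refine Sym2.map.injective Subtype.val_injective (Sym2.ext fun x => ?_)
    rw [← Sym2.mem_toFinset, ← Sym2.mem_toFinset]
    exact Finset.ext_iff.1 h x
  change _ = (edgeSubgraph L T).edgeSet.ncard
  rw [← Set.ncard_image_of_injective _ hinj]
  congr 1
  ext s
  constructor
  · rintro ⟨h2, e, he, hs⟩
    obtain ⟨p, q, hpq, rfl⟩ := Finset.card_eq_two.1 h2
    have hp := isVertex_of_mem_segment hL he hs (Finset.mem_insert_self p _)
    have hq := isVertex_of_mem_segment hL he hs (v := q) (by simp)
    exact ⟨s(⟨p, hp⟩, ⟨q, hq⟩), ⟨fun h => hpq (congrArg Subtype.val h), e, he, hs⟩, hfp _ _⟩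
  · rintro ⟨z, hz, rfl⟩
    induction z using Sym2.ind with
    | _ u v =>
      obtain ⟨hne, e, he, hs⟩ := hz
      rw [hfp]
      exact ⟨Finset.card_pair fun h => hne (Subtype.ext h), e, he, hs⟩

/-- The subdivided tree has one vertex more than it has segments, and on each edge of `P` in `T` the
segments outnumber the interior vertices by one. So the subdivision cancels from the count. -/
theorem IsMaximalTree.ncard_trueVertices (hL : IsSpecialPolyhedron L) {T : Set (Edge L)}
    (hT : IsMaximalTree L T) : {v | IsTrueVertex L v}.ncard = 1 + T.ncard := by
  classical
  have hfV := finite_edgeSubgraph_vertices hL.simple T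
  have hfe := hL.simple.edgeSet_finite
  have := Pieces.finite hfe
  have := Fintype.ofFinite T
  set U : Set (Finset ℕ) := ⋃ e : T, e.1.simplices with hU
  have hmemU : ∀ σ, σ ∈ U ↔ ∃ e ∈ T, σ ∈ e.simplices := fun σ => by
    rw [hU, Set.mem_iUnion]
    exact ⟨fun ⟨e, h⟩ => ⟨e.1, e.2, h⟩, fun ⟨e, he, h⟩ => ⟨⟨e, he⟩, h⟩⟩
  have hUf : U.Finite := hfe.subset fun σ h => by
    obtain ⟨e, -, h⟩ := (hmemU σ).1 h
    exact h.1
  have hχ : eulerChar U = -(T.ncard : ℤ) := by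
    have h := finsum_mem_iUnion (f := fun σ : Finset ℕ => (-1 : ℤ) ^ (σ.card + 1))
      (t := fun e : T => e.1.simplices)
      (fun e e' hne => Pieces.pairwise_disjoint fun h => hne (Subtype.ext h))
      fun e => hL.simple.edge_finite e.1
    refine h.trans ((finsum_congr fun e : T => hL.eulerChar_edge e.1).trans ?_)
    rw [finsum_eq_sum_of_fintype, Set.ncard_eq_toFinset_card', Set.toFinset_card]
    simp
  set U₁ : Set ℕ := {v | ∃ e ∈ T, {v} ∈ e.simplices}
  have hf₁ : U₁.Finite := hfV.subset fun v h => Or.inr h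
  have hf₀ : {v | IsTrueVertex L v}.Finite := hfV.subset fun v h => Or.inl h
  have hf₂ : (segmentsOf T).Finite := hUf.subset fun s h => (hmemU s).2 h.2
  have hun : U = (fun v : ℕ => ({v} : Finset ℕ)) '' U₁ ∪ segmentsOf T := by
    ext σ
    rw [hmemU]
    constructor
    · rintro ⟨e, he, h⟩
      rcases card_of_mem_singularSet h.1.1 with h1 | h2
      · obtain ⟨v, rfl⟩ := Finset.card_eq_one.1 h1
        exact Or.inl ⟨v, ⟨e, he, h⟩, rfl⟩
      · exact Or.inr ⟨h2, e, he, h⟩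
    · rintro (⟨v, h, rfl⟩ | h)
      · exact h
      · exact h.2
  have h1 : ∀ σ ∈ (fun v : ℕ => ({v} : Finset ℕ)) '' U₁, σ.card = 1 := by
    rintro _ ⟨v, -, rfl⟩
    exact Finset.card_singleton v
  rw [hun, eulerChar_union _ (hf₁.image _) hf₂, eulerChar_of_card (hf₁.image _) h1,
    eulerChar_of_card hf₂ (k := 2) fun s h => h.1,
    Set.ncard_image_of_injective _ Finset.singleton_injective] at hχ
  · have hcard : Nat.card {v : ℕ // IsTrueVertex L v ∨ ∃ e ∈ T, ({v} : Finset ℕ) ∈ e.simplices} =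
        {v | IsTrueVertex L v}.ncard + U₁.ncard := by
      rw [← Set.ncard_union_eq _ hf₀ hf₁]
      · rfl
      · rw [Set.disjoint_left]
        rintro v h ⟨e, -, h'⟩
        exact h'.1.2 ⟨v, rfl, h⟩
    have : Finite {v : ℕ // IsTrueVertex L v ∨ ∃ e ∈ T, ({v} : Finset ℕ) ∈ e.simplices} :=
      hfV.to_subtype
    have := Fintype.ofFinite
      {v : ℕ // IsTrueVertex L v ∨ ∃ e ∈ T, ({v} : Finset ℕ) ∈ e.simplices}
    have htree := SimpleGraph.IsTree.card_edgeFinset hT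
    rw [← Nat.card_eq_fintype_card, hcard, SimpleGraph.edgeFinset, Set.toFinset_card,
      ← Nat.card_eq_fintype_card, ← ncard_segmentsOf_eq hL.simple T] at htree
    norm_num at hχ
    omega
  · exact Set.disjoint_left.2 fun σ h h' => by
      have h1 := h1 σ h
      have h2 := h'.1
      omega

/-- Outside a maximal tree there are as many edges as there are regions. -/
theorem IsMaximalTree.card_region (hL : IsSpecialPolyhedron L) (hχ : eulerChar L.faces = 1)
    {T : Set (Edge L)} (hT : IsMaximalTree L T) :
    Nat.card (Region L) = Nat.card {e : Edge L // e ∉ T} := by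
  have := Pieces.finite hL.simple.edgeSet_finite
  have h := hL.eulerChar_eq
  have hV := hT.ncard_trueVertices hL
  have hE : T.ncard + Nat.card {e : Edge L // e ∉ T} = Nat.card (Edge L) :=
    Set.ncard_add_ncard_compl T
  omega

end

noncomputable section

open PreAbstractSimplicialComplex

variable {L : PreAbstractSimplicialComplex ℕ}

/-! ### Cellular chains -/

/-- The set `F` only has to contain the relevant cofaces of `s`; neither the whole support of `z`
nor only simplices of the support need be in it. -/
theorem chainBoundary_apply_eq_sum (z : Finset ℕ →₀ ℚ) {s : Finset ℕ} (hs : s.Nonempty)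
    {F : Finset (Finset ℕ)} (hF : ∀ τ, z τ ≠ 0 → s ⊆ τ → τ.card = s.card + 1 → τ ∈ F) :
    chainBoundary z s = ∑ τ ∈ F, z τ * incidence τ s := by
  classical
  rw [chainBoundary_apply_of_subset z hs (F := z.support ∪ F) Finset.subset_union_left]
  refine (Finset.sum_subset Finset.subset_union_right fun τ _ hτ => ?_).symm
  by_cases hz : z τ = 0
  · rw [hz, zero_mul]
  · rw [incidence_eq_zero fun h => hτ (hF τ hz h.1 h.2), Int.cast_zero, mul_zero]

theorem units_cast_mul_self (u : ℤˣ) : ((u : ℤ) : ℚ) * ((u : ℤ) : ℚ) = 1 := by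
  rcases Int.units_eq_one_or u with rfl | rfl <;> norm_num

/-- Two terms with opposite incidence numbers cancel exactly if the coefficients agree after a
change of orientations. -/
theorem cancel_iff {u₁ u₂ : ℤˣ} {i₁ i₂ : ℤ} (h₁ : i₁ * i₁ = 1) (h₂ : i₂ * i₂ = 1)
    (h : (u₁ : ℤ) * i₁ + (u₂ : ℤ) * i₂ = 0) (x₁ x₂ : ℚ) :
    x₁ * i₁ + x₂ * i₂ = 0 ↔ (u₁ : ℤ) * x₁ = (u₂ : ℤ) * x₂ := by
  have hu₁ := units_cast_mul_self u₁
  have hu₂ := units_cast_mul_self u₂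
  have h₁' : (i₁ : ℚ) * i₁ = 1 := by exact_mod_cast h₁
  have h₂' : (i₂ : ℚ) * i₂ = 1 := by exact_mod_cast h₂
  have h' : ((u₁ : ℤ) : ℚ) * i₁ = -(((u₂ : ℤ) : ℚ) * i₂) := by
    have : ((u₁ : ℤ) : ℚ) * i₁ + ((u₂ : ℤ) : ℚ) * i₂ = 0 := by exact_mod_cast h
    linarith
  generalize ((u₁ : ℤ) : ℚ) = a at *
  generalize ((u₂ : ℤ) : ℚ) = b at *
  generalize (i₁ : ℚ) = p at *
  generalize (i₂ : ℚ) = q at *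
  constructor
  · intro hx
    have hx' : x₁ * p = -(x₂ * q) := by linarith
    calc a * x₁ = (a * p) * (x₁ * p) := by linear_combination (-(a * x₁)) * h₁'
      _ = (b * q) * (x₂ * q) := by rw [h', hx']; ring
      _ = b * x₂ := by linear_combination (b * x₂) * h₂'
  · intro hx
    have e1 : x₁ * p = (a * x₁) * (a * p) := by linear_combination (-(x₁ * p)) * hu₁
    have e2 : x₂ * q = (b * x₂) * (b * q) := by linear_combination (-(x₂ * q)) * hu₂
    rw [e1, e2, h', hx]
    ring

namespace IsSimplePolyhedron

/-- The triangles of `L`. -/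
theorem triangles_finite (hL : IsSimplePolyhedron L) : {t | t ∈ L ∧ t.card = 3}.Finite :=
  hL.1.subset fun _ h => h.1

open scoped Classical in
/-- The 2-chain which is `c R` times the fundamental chain on each region `R`. -/
def regionChain (hL : IsSimplePolyhedron L) (o : Finset ℕ → ℤˣ) (c : Region L → ℚ) :
    Finset ℕ →₀ ℚ :=
  chainOn hL.triangles_finite fun t =>
    if h : t ∈ regularSet L then (o t : ℤ) * c (Pieces.of h) else 0

theorem regionChain_apply (hL : IsSimplePolyhedron L) (o : Finset ℕ → ℤˣ) (c : Region L → ℚ)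
    {t : Finset ℕ} {R : Region L} (ht : t ∈ R.simplices) (h3 : t.card = 3) :
    hL.regionChain o c t = (o t : ℤ) * c R := by
  have hm : t ∈ {t | t ∈ L ∧ t.card = 3} := ⟨ht.1.1, h3⟩
  rw [regionChain, chainOn_apply_of_mem _ _ hm, dif_pos ht.1, Pieces.eq_of_mem ht]

theorem mem_of_regionChain_ne_zero (hL : IsSimplePolyhedron L) {o : Finset ℕ → ℤˣ}
    {c : Region L → ℚ} {t : Finset ℕ} (h : hL.regionChain o c t ≠ 0) : t ∈ L ∧ t.card = 3 := by
  by_contra h'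
  exact h (chainOn_apply_of_notMem _ _ h')

/-- The boundary of a 2-chain vanishes on a regular segment exactly if the coefficients of the
adjacent triangles agree. -/
theorem chainBoundary_apply_eq_zero_iff (hL : IsSimplePolyhedron L) {o : Finset ℕ → ℤˣ}
    (ho : IsBranching L o) {z : Finset ℕ →₀ ℚ} (hz : ∀ t, z t ≠ 0 → t ∈ L ∧ t.card = 3)
    {s : Finset ℕ} (hs : s ∈ regularSet L) (h2 : s.card = 2) :
    chainBoundary z s = 0 ↔ ∀ t₁ ∈ trianglesAt L s, ∀ t₂ ∈ trianglesAt L s,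
      (o t₁ : ℤ) * z t₁ = (o t₂ : ℤ) * z t₂ := by
  obtain ⟨t₁, t₂, hne, he⟩ := Set.ncard_eq_two.1 (hL.ncard_trianglesAt_of_notMem hs.1 h2 hs.2)
  have h₁ : t₁ ∈ trianglesAt L s := he ▸ by simp
  have h₂ : t₂ ∈ trianglesAt L s := he ▸ by simp
  rw [chainBoundary_apply_eq_sum z (nonempty_of_mem hs.1) (F := {t₁, t₂}), Finset.sum_pair hne,
    cancel_iff (incidence_mul_self h₁.2.2 (by rw [h₁.2.1, h2]))
      (incidence_mul_self h₂.2.2 (by rw [h₂.2.1, h2])) (ho.orientation s hs.1 h2 hs.2 t₁ h₁ t₂ h₂ hne),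
    he]
  · simp only [Set.mem_insert_iff, Set.mem_singleton_iff, forall_eq_or_imp, forall_eq, true_and,
      and_true]
    exact ⟨fun h => ⟨h, h.symm⟩, fun h => h.1⟩
  · intro τ hτ hsτ _
    have : τ ∈ trianglesAt L s := ⟨(hz τ hτ).1, (hz τ hτ).2, hsτ⟩
    rw [he] at this
    simpa using this

/-- The two triangles at a regular segment belong to the same region, so the chain has the same
oriented coefficient on both and their contributions cancel. -/
theorem regionChain_boundary_support (hL : IsSimplePolyhedron L) {o : Finset ℕ → ℤˣ}
    (ho : IsBranching L o) (c : Region L → ℚ) {s : Finset ℕ}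
    (h : chainBoundary (hL.regionChain o c) s ≠ 0) : s ∈ singularSet L ∧ s.card = 2 := by
  have hn : s.Nonempty := by
    rw [Finset.nonempty_iff_ne_empty]
    rintro rfl
    exact h (chainBoundary_apply_empty _)
  obtain ⟨t, ht, hst, hc⟩ : ∃ t, hL.regionChain o c t ≠ 0 ∧ s ⊆ t ∧ t.card = s.card + 1 := by
    by_contra h'
    push Not at h'
    refine h ?_
    rw [chainBoundary_apply_eq_sum _ hn (F := ∅) fun τ h1 h2 h3 => absurd h3 (h' τ h1 h2),
      Finset.sum_empty]
  have ht' := hL.mem_of_regionChain_ne_zero ht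
  have h2 : s.card = 2 := by omega
  refine ⟨by_contra fun hs => h ?_, h2⟩
  have hr : s ∈ regularSet L := ⟨mem_of_subset ht'.1 hst hn, hs⟩
  rw [hL.chainBoundary_apply_eq_zero_iff ho (fun _ h => hL.mem_of_regionChain_ne_zero h) hr h2]
  intro t₁ h₁ t₂ h₂
  have hr₁ := hL.mem_regularSet_of_subset hr h₁.1 h₁.2.2
  have hr₂ := hL.mem_regularSet_of_subset hr h₂.1 h₂.2.2
  have hm : t₂ ∈ (Pieces.of hr₁).simplices := by
    rw [← Pieces.of_eq_of_subset hr hr₁ h₁.2.2, Pieces.of_eq_of_subset hr hr₂ h₂.2.2]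
    exact Pieces.mem_simplices_of hr₂
  rw [hL.regionChain_apply o c (Pieces.mem_simplices_of hr₁) h₁.2.1,
    hL.regionChain_apply o c hm h₂.2.1, ← mul_assoc, ← mul_assoc, units_cast_mul_self,
    units_cast_mul_self]

/-- A 1-cycle on the singular set has constant coefficients along each edge. -/
theorem eq_of_mem_edge {w : Finset ℕ → ℤˣ} (hw : IsEdgeOrientation L w) {y : Finset ℕ →₀ ℚ}
    (hy : ∀ s, y s ≠ 0 → s ∈ singularSet L ∧ s.card = 2) (hb : chainBoundary y = 0) {e : Edge L}
    {s₁ s₂ : Finset ℕ} (h₁ : s₁ ∈ e.segments) (h₂ : s₂ ∈ e.segments) :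
    (w s₁ : ℤ) * y s₁ = (w s₂ : ℤ) * y s₂ := by
  have key : ∀ v, IsTripleVertex L v → ∀ s ∈ singularSet L, ∀ s' ∈ singularSet L, s.card = 2 →
      s'.card = 2 → v ∈ s → v ∈ s' → ((w s : ℤ) : ℚ) * y s = (w s' : ℤ) * y s' := by
    intro v hv s hs s' hs' h2 h2' hvs hvs'
    by_cases hne : s = s'
    · rw [hne]
    obtain ⟨a, b, hab, he⟩ := Set.ncard_eq_two.1 (ncard_segments_of_isTripleVertex hv)
    have hsv : s ∈ {s | s ∈ singularSet L ∧ s.card = 2 ∧ v ∈ s} := ⟨hs, h2, hvs⟩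
    have hsv' : s' ∈ {s | s ∈ singularSet L ∧ s.card = 2 ∧ v ∈ s} := ⟨hs', h2', hvs'⟩
    have hi : ∀ s : Finset ℕ, s.card = 2 → v ∈ s → incidence s {v} * incidence s {v} = 1 :=
      fun s h2 hvs => incidence_mul_self (by simpa using hvs) (by rw [h2, Finset.card_singleton])
    rw [← cancel_iff (hi s h2 hvs) (hi s' h2' hvs') (hw v hv s hs s' hs' h2 h2' hvs hvs' hne),
      ← Finset.sum_pair (f := fun s => y s * incidence s {v}) hne,
      ← chainBoundary_apply_eq_sum y (Finset.singleton_nonempty v), hb, Finsupp.zero_apply]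
    intro τ hτ hvτ _
    have hτv : τ ∈ {s | s ∈ singularSet L ∧ s.card = 2 ∧ v ∈ s} :=
      ⟨(hy τ hτ).1, (hy τ hτ).2, by simpa using hvτ⟩
    rw [he] at hsv hsv' hτv
    simp only [Set.mem_insert_iff, Set.mem_singleton_iff, Finset.mem_insert,
      Finset.mem_singleton] at hsv hsv' hτv ⊢
    grind
  -- The property passed along the edge: every singular segment that contains `σ` has the same
  -- oriented coefficient as `s₁`. At a triple vertex this is `key`.
  refine (Pieces.iff_of_mem (P := fun σ => ∀ s ∈ singularSet L, s.card = 2 → σ ⊆ s →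
    ((w s₁ : ℤ) : ℚ) * y s₁ = (w s : ℤ) * y s) ?_ h₁.1 h₂.1).1 ?_ s₂ h₂.1.1.1 h₂.2
      (Finset.Subset.refl _)
  · intro σ hσ τ hτ hst
    refine ⟨fun h s hs h2 hτs => h s hs h2 (hst.trans hτs), fun h s hs h2 hσs => ?_⟩
    rcases card_of_mem_singularSet hσ.1 with hc | hc
    · obtain ⟨v, rfl⟩ := Finset.card_eq_one.1 hc
      rw [Finset.singleton_subset_iff] at hst hσs
      have hv := singleton_mem_edgeSet.1 hσ
      rcases card_of_mem_singularSet hτ.1 with hc' | hc'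
      · obtain ⟨x, rfl⟩ := Finset.card_eq_one.1 hc'
        rw [Finset.mem_singleton] at hst
        subst hst
        exact h s hs h2 (by simpa using hσs)
      · rw [h τ hτ.1 hc' (Finset.Subset.refl _)]
        exact key v hv τ hτ.1 s hs hc' h2 hst hσs
    · have : σ = τ := Finset.eq_of_subset_of_card_le hst
        (by have := card_of_mem_singularSet hτ.1; omega)
      exact h s hs h2 (this ▸ hσs)
  · intro s hs h2 h
    rw [Finset.eq_of_subset_of_card_le h (by rw [h2, h₁.2])]

/-- The coefficients of the cellular boundary. -/
theorem chainBoundary_regionChain_apply (hL : IsSimplePolyhedron L) (o w : Finset ℕ → ℤˣ)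
    (c : Region L → ℚ) {e : Edge L} (he : e.segment.card = 2) :
    (w e.segment : ℤ) * chainBoundary (hL.regionChain o c) e.segment =
      ∑ᶠ R : Region L, c R * boundaryCoeff L o w R e := by
  set s := e.segment
  have hn : s.Nonempty := Finset.card_pos.1 (by omega)
  have hf : (trianglesAt L s).Finite := hL.1.subset fun _ h => h.1
  have := Pieces.finite (hL.1.subset fun _ h => h.1 : (regularSet L).Finite)
  have hun : ⋃ R : Region L, trianglesAt L s ∩ R.simplices = trianglesAt L s := by
    rw [← Set.inter_iUnion, Pieces.iUnion_simplices]
    exact Set.inter_eq_left.2 fun t ht => mem_regularSet_of_card_three ht.1 ht.2.1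
  rw [chainBoundary_apply_eq_sum _ hn (F := hf.toFinset), Finset.mul_sum,
    ← finsum_mem_eq_finite_toFinset_sum (f := fun t => ((w s : ℤ) : ℚ) *
      (hL.regionChain o c t * incidence t s)) hf, ← hun, finsum_mem_iUnion]
  · refine finsum_congr fun R => ?_
    have hfR : (trianglesAt L s ∩ R.simplices).Finite := hf.subset Set.inter_subset_left
    rw [boundaryCoeff, finsum_mem_eq_finite_toFinset_sum _ hfR,
      finsum_mem_eq_finite_toFinset_sum _ hfR, Int.cast_sum, Finset.mul_sum]
    refine Finset.sum_congr rfl fun t ht => ?_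
    rw [hfR.mem_toFinset] at ht
    rw [hL.regionChain_apply o c ht.2 ht.1.2.1]
    push_cast
    ring
  · exact fun R R' h => (Pieces.pairwise_disjoint h).mono Set.inter_subset_right
      Set.inter_subset_right
  · exact fun R => hf.subset Set.inter_subset_left
  · intro τ hτ hs hc
    rw [hf.mem_toFinset]
    have := hL.mem_of_regionChain_ne_zero hτ
    exact ⟨this.1, this.2, hs⟩

end IsSimplePolyhedron

/-! ### Second homology as the kernel of the cellular boundary -/

namespace IsSpecialPolyhedron

variable {o w : Finset ℕ → ℤˣ}

/-- The boundary of a combination of regions vanishes if its coefficients at the edges do. -/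
theorem chainBoundary_regionChain_eq_zero (hL : IsSpecialPolyhedron L) (ho : IsBranching L o)
    (hw : IsEdgeOrientation L w) {c : Region L → ℚ} {T : Set (Edge L)} (hT : IsMaximalTree L T ∨ T = ∅)
    (h : ∀ e ∉ T, ∑ᶠ R : Region L, c R * (boundaryCoeff L o w R e : ℚ) = 0) :
    chainBoundary (hL.simple.regionChain o c) = 0 := by
  set y := chainBoundary (hL.simple.regionChain o c) with hy
  -- On an edge outside `T` the hypothesis kills the coefficient at the chosen segment. The boundary
  -- `y` is a cycle, so its oriented coefficient is constant along the edge and the other segments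
  -- follow.
  have hsupp : ∀ s, y s ≠ 0 → s ∈ segmentsOf T := by
    intro s hs
    have hss := hL.simple.regionChain_boundary_support ho c hs
    have hse := mem_edgeSet_of_card_two hss.1 hss.2
    refine ⟨hss.2, Pieces.of hse, by_contra fun hT' => hs ?_, Pieces.mem_simplices_of hse⟩
    have hseg := hL.segment_mem (Pieces.of hse)
    have := IsSimplePolyhedron.eq_of_mem_edge hw
      (fun s hs => hL.simple.regionChain_boundary_support ho c hs) (chainBoundary_chainBoundary _)
      (e := Pieces.of hse) ⟨Pieces.mem_simplices_of hse, hss.2⟩ hseg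
    rw [hL.simple.chainBoundary_regionChain_apply o w c hseg.2, h _ hT'] at this
    have hu := units_cast_mul_self (w s)
    rcases mul_eq_zero.1 this with h0 | h0
    · rw [h0, zero_mul] at hu
      exact absurd hu zero_ne_one
    · exact h0
  rcases hT with hT | rfl
  · exact hT.eq_zero_of_chainBoundary_eq_zero hL.simple hsupp (chainBoundary_chainBoundary _)
  · ext s
    by_contra hs
    obtain ⟨-, e, he, -⟩ := hsupp s hs
    exact he

theorem eq_zero_of_regionChain_eq_zero (hL : IsSimplePolyhedron L) {c : Region L → ℚ}
    (h : hL.regionChain o c = 0) : c = 0 := by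
  funext R
  obtain ⟨t, ht, h3⟩ := hL.exists_triangle_mem_region R
  have := hL.regionChain_apply o c ht h3
  rw [h, Finsupp.zero_apply] at this
  have hu := units_cast_mul_self (o t)
  rcases mul_eq_zero.1 this.symm with h0 | h0
  · rw [h0, zero_mul] at hu
    exact absurd hu zero_ne_one
  · exact h0

/-- For a cycle the oriented coefficients of the two triangles at a regular segment agree, so they
are constant on each region. The value can be read off at any triangle of the region. -/
theorem exists_eq_regionChain (hL : IsSimplePolyhedron L) (ho : IsBranching L o)
    {z : Finset ℕ →₀ ℚ} (hz : ∀ t, z t ≠ 0 → t ∈ L ∧ t.card = 3) (hb : chainBoundary z = 0) :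
    ∃ c, hL.regionChain o c = z := by
  choose t ht h3 using hL.exists_triangle_mem_region
  refine ⟨fun R => (o (t R) : ℤ) * z (t R), ?_⟩
  ext τ
  by_cases hτ : τ ∈ L ∧ τ.card = 3
  · have hr := IsSimplePolyhedron.mem_regularSet_of_card_three hτ.1 hτ.2
    have hm := Pieces.mem_simplices_of hr
    rw [hL.regionChain_apply o _ hm hτ.2,
      hL.eq_of_mem_region (g := fun t => ((o t : ℤ) : ℚ) * z t) (fun s hs h2 =>
        (hL.chainBoundary_apply_eq_zero_iff ho hz hs h2).1 (by rw [hb]; rfl)) (ht _) hm (h3 _) hτ.2,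
      ← mul_assoc, units_cast_mul_self, one_mul]
  · rw [not_imp_comm.1 (hz τ) hτ, not_imp_comm.1 hL.mem_of_regionChain_ne_zero hτ]

/-- The second rational homology of a special polyhedron vanishes exactly if the boundary map on the
regions is injective; the edges of a maximal tree may be ignored. -/
theorem secondHomologyVanishes_iff (hL : IsSpecialPolyhedron L) (ho : IsBranching L o)
    (hw : IsEdgeOrientation L w) {T : Set (Edge L)} (hT : IsMaximalTree L T ∨ T = ∅) :
    SecondHomologyVanishes L.faces ↔ ∀ c : Region L → ℚ,
      (∀ e ∉ T, ∑ᶠ R : Region L, c R * (boundaryCoeff L o w R e : ℚ) = 0) → c = 0 := by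
  constructor
  · intro h c hc
    obtain ⟨y, hy, hyz⟩ := h _ (fun σ hσ => hL.simple.mem_of_regionChain_ne_zero hσ)
      (hL.chainBoundary_regionChain_eq_zero ho hw hT hc)
    -- There are no tetrahedra in `L`, so a cycle that bounds is zero.
    have hy0 : y = 0 := by
      ext σ
      by_contra hσ
      have := hL.simple.card_le σ (hy σ hσ).1
      have := (hy σ hσ).2
      omega
    rw [hy0, map_zero] at hyz
    exact eq_zero_of_regionChain_eq_zero hL.simple hyz.symm
  · intro h z hz hb
    obtain ⟨c, rfl⟩ := exists_eq_regionChain hL.simple ho hz hb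
    have hc : c = 0 := h c fun e _ => by
      rw [← hL.simple.chainBoundary_regionChain_apply o w c (hL.segment_mem e).2, hb,
        Finsupp.zero_apply, mul_zero]
    refine ⟨0, by simp, ?_⟩
    rw [map_zero]
    ext t
    by_contra ht
    have ht' := hz t (Ne.symm ht)
    have hr := IsSimplePolyhedron.mem_regularSet_of_card_three ht'.1 ht'.2
    refine ht ?_
    rw [hL.simple.regionChain_apply o c (Pieces.mem_simplices_of hr) ht'.2, hc]
    simp

end IsSpecialPolyhedron

end

noncomputable section

open PreAbstractSimplicialComplex

variable {L : PreAbstractSimplicialComplex ℕ} {o w : Finset ℕ → ℤˣ}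

/-! ### Conclusion -/

/-- Regions index the rows, so the boundary map off the tree is multiplication of row vectors by the
matrix. It is injective over `ℚ` exactly if the determinant, which is the same over `ℤ` and over
`ℚ`, is not zero. -/
theorem det_ne_zero_iff_secondHomologyVanishes (hL : IsSpecialPolyhedron L) (ho : IsBranching L o)
    (hw : IsEdgeOrientation L w) {T : Set (Edge L)} (hT : IsMaximalTree L T) {n : ℕ}
    (r : Fin n ≃ Region L) (c : Fin n ≃ {e : Edge L // e ∉ T}) :
    (Matrix.of fun i j => boundaryCoeff L o w (r i) (c j).1).det ≠ 0 ↔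
      SecondHomologyVanishes L.faces := by
  set A : Matrix (Fin n) (Fin n) ℤ := Matrix.of fun i j => boundaryCoeff L o w (r i) (c j).1
  have hdet : A.det ≠ 0 ↔ (A.map (Int.cast : ℤ → ℚ)).det ≠ 0 := by
    have := (Int.castRingHom ℚ).map_det A
    rw [RingHom.mapMatrix_apply] at this
    change _ = (A.map (Int.cast : ℤ → ℚ)).det at this
    rw [← this]
    simp
  have hsum : ∀ (x : Region L → ℚ) (j : Fin n),
      ∑ᶠ R : Region L, x R * (boundaryCoeff L o w R (c j).1 : ℚ) =
        Matrix.vecMul (x ∘ r) (A.map (Int.cast : ℤ → ℚ)) j := fun x j => by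
    rw [← finsum_comp_equiv r, finsum_eq_sum_of_fintype]
    rfl
  rw [hL.secondHomologyVanishes_iff ho hw (Or.inl hT), hdet, Ne,
    ← Matrix.exists_vecMul_eq_zero_iff, not_exists]
  constructor
  · intro h x hx
    have h0 : x ∘ r = 0 := by
      by_contra hne
      refine h (x ∘ r) ⟨hne, funext fun j => ?_⟩
      rw [← hsum x j]
      exact hx _ (c j).2
    funext R
    simpa using congrFun h0 (r.symm R)
  · rintro h v ⟨hv, hvA⟩
    refine hv ?_
    have h0 := h (v ∘ r.symm) fun e he => by
      obtain ⟨j, hj⟩ := c.surjective ⟨e, he⟩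
      have h1 := hsum (v ∘ r.symm) j
      rw [hj, Function.comp_assoc, Equiv.symm_comp_self, Function.comp_id, hvA] at h1
      exact h1
    funext i
    simpa using congrFun h0 (r i)

/-- Injectivity of `c ↦ c B`, with all edges kept, gives a left inverse `ψ`. Let `x_e` be the sum of
the entries of `ψ` at the unit vector of `e`. Then `∑ e, B R e * x_e` is the sum of the entries of
`ψ (B R)`, and since `B R` is the image of the unit vector of `R`, that sum is `1`. -/
theorem isAdmissible_of_secondHomologyVanishes (hL : IsSpecialPolyhedron L)
    (ho : IsBranching L o) (hw : IsEdgeOrientation L w) (h : SecondHomologyVanishes L.faces) :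
    IsAdmissible L o w := by
  classical
  have hfr : (regularSet L).Finite := hL.simple.1.subset fun _ h => h.1
  have := Pieces.finite hfr
  have := Pieces.finite hL.simple.edgeSet_finite
  have := Fintype.ofFinite (Region L)
  have := Fintype.ofFinite (Edge L)
  rw [hL.secondHomologyVanishes_iff ho hw (Or.inr rfl)] at h
  set B : Matrix (Region L) (Edge L) ℚ := Matrix.of fun R e => (boundaryCoeff L o w R e : ℚ)
  obtain ⟨ψ, hψ⟩ := B.vecMulLinear.exists_leftInverse_of_injective <| LinearMap.ker_eq_bot'.2
    fun c hc => h c fun e _ => by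
      rw [finsum_eq_sum_of_fintype]
      exact congrFun hc e
  refine ⟨fun e => ((∑ R, ψ (Pi.single e 1) R : ℚ) : ℝ), fun R => ?_⟩
  rw [finsum_eq_sum_of_fintype]
  have key : ∑ e, (boundaryCoeff L o w R e : ℚ) * ∑ R', ψ (Pi.single e 1) R' = 1 := by
    have h1 : ψ (B.vecMulLinear (Pi.single R 1)) = Pi.single R 1 := LinearMap.congr_fun hψ _
    have h2 : B.vecMulLinear (Pi.single R 1) = B R := by
      rw [Matrix.vecMulLinear_apply, Matrix.single_one_vecMul]
      rfl
    rw [h2, LinearMap.pi_apply_eq_sum_univ ψ (B R)] at h1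
    have h3 := congrArg (fun f => ∑ R', f R') h1
    rw [Finset.sum_pi_single', if_pos (Finset.mem_univ _)] at h3
    simp only [Finset.sum_apply, Pi.smul_apply, smul_eq_mul] at h3
    rw [Finset.sum_comm] at h3
    refine Eq.trans ?_ h3
    refine Finset.sum_congr rfl fun e _ => ?_
    rw [Finset.mul_sum]
    refine Finset.sum_congr rfl fun R' _ => ?_
    refine congrArg (fun f => B R e * ψ f R') (funext fun e' => ?_)
    simp [Pi.single_apply, eq_comm]
  have : ∑ e, (boundaryCoeff L o w R e : ℝ) * ((∑ R', ψ (Pi.single e 1) R' : ℚ) : ℝ) = 1 := by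
    exact_mod_cast congrArg (Rat.cast : ℚ → ℝ) key
  rw [this]
  exact one_pos

theorem proposition4 (K L : PreAbstractSimplicialComplex ℕ)
    (hM : IsClosedOrientableThreeManifold K) (hP : IsSpine K L) (hL : IsSpecialPolyhedron L)
    (o : Finset ℕ → ℤˣ) (ho : IsBranching L o)
    (w : Finset ℕ → ℤˣ) (hw : IsEdgeOrientation L w) :
    (∀ T : Set (Edge L), IsMaximalTree L T →
      Nat.card (Region L) = Nat.card {e : Edge L // e ∉ T} ∧
      ∀ (n : ℕ) (r : Fin n ≃ Region L) (c : Fin n ≃ {e : Edge L // e ∉ T}),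
        (Matrix.of fun i j => boundaryCoeff L o w (r i) (c j).1).det ≠ 0 ↔
          IsRationalHomologyThreeSphere K) ∧
    (IsRationalHomologyThreeSphere K → IsAdmissible L o w) := by
  obtain ⟨hχ, hH⟩ := hP.eulerChar_and_secondHomologyVanishes hM
  refine ⟨fun T hT => ⟨hT.card_region hL hχ, fun n r c => ?_⟩, fun h => ?_⟩
  · rw [hH]
    exact det_ne_zero_iff_secondHomologyVanishes hL ho hw hT r c
  · exact isAdmissible_of_secondHomologyVanishes hL ho hw (hH.1 h)

end
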